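/- Fix an integer $k\ge 1$ and sketching dimensions $\tilde k=\tilde k_n\ge k$. There is a constant $C>0$, depending only on $k$ and on the sequence $(\tilde k_n)$, and with $C\le 15$ if $\tilde k_n\to\infty$, such that the following holds. **Setting.** For all large $n$ let $M=M_n$ be a deterministic symmetric $n\times n$ matrix of rank $k$, $M=U\Lambda U^\top$ with $U^\top U=I_k$, $\Lambda=\mathrm{diag}(\lambda_1,\dots,\lambda_k)$, $|\lambda_1|\ge\dots\ge|\lambda_k|>0$, and assume that $\psi=|\lambda_1/\lambda_k|$ is bounded in $n$. Let $S_n=\|M\|$ (spectral norm), let $E=E^{(n)}$ be a random symmetric $n\times n$ matrix and put $\hat M=M+E$. Write $a_n\precsim b_n$ if $a_n\le c\,b_n$ for all large $n$ with a constant $c$; $[A]_i$ for the $i$th row of $A$ viewed as a column vector; $\|A\|_{2\to\infty}=\max_i\|[A]_i\|$; and $\|u\|_{\max}=\max_j|u_j|$. **Assumptions.** Let $\beta_\Delta>0$, $\delta>1$, and real numbers $E_n$, $\sigma_n$ be given such that 1. (signal-to-noise ratio) $n^{\beta_\Delta}\precsim S_n/E_n$, and $\mathbb P[\|E\|\le E_n]\ge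 1-n^{-6}$ for all large $n$; 2. (row-wise concentration) there is a constant $C'$ such that for all large $n$, all integers $1\le r\le\log n$ and every deterministic $u\in\mathbb R^n$, with probability at least $1-n^{-8}$, $\max_{i}|e_i^\top E^{r}u|\le C'E_n^{r}(\log n)^{\delta r}\|u\|_{\max}$; 3. (CLT) $(\sigma_n)$ is bounded and non-negative, $E_n=\Theta(\sqrt n\,\sigma_n)$, $S_n/E_n\precsim n^{\beta_\Delta}$, and for every fixed $i$ there are deterministic symmetric $k\times k$ matrices $\Gamma_i=\Gamma_i^{(n)}$ with $\Gamma_i\succeq c_iI$ for all large $n$, where $c_i>0$ does not depend on $n$, such that $S_n\sigma_n^{-1}\Gamma_i^{-1/2}[EU\Lambda^{-1}]_i$ converges in distribution to $N(0,I_k)$ as $n\to\infty$. **Algorithm.** Let $g\ge 2+(2\beta_\Delta)^{-1}$ be a fixed integer, and let $a_n\ge1$ be integers with $a_n\ge\lceil C\tilde k^{-1}\log n\rceil$. Let $G_1,\dots,G_{a_n}\in\mathbb R^{n\times\tilde k}$ be i.i.d. matrices with independent standard normal entries, independent of $E$; choose $\tilde a$ maximizing the $k$th largest singular value of $\hat M^gG_a$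 over $a\le a_n$, and let $\hat U_g\in\mathbb R^{n\times k}$ be a (measurable) matrix of $k$ leading left singular vectors of $\hat M^gG_{\tilde a}$. **Condition.** With $\vartheta=\max\{1,\tilde k^{-1/2}(\log n)^{1/2}\}$, and with $\ell_{\rm clt}=(\log n)^{g\delta+1/2}$ if $g=2+(2\beta_\Delta)^{-1}$ and $\ell_{\rm clt}=(\log n)^{2\delta}\vartheta$ if $g>2+(2\beta_\Delta)^{-1}$, assume $$\max\bigl\{\sigma_n^{-1}\|U^\top EU\|,\ n\sigma_n\ell_{\rm clt}S_n^{-1}\bigr\}\,\|U\|_{2\to\infty}\to0\quad\text{in probability.}$$ **Conclusion.** There are random (measurable) orthogonal $k\times k$ matrices $W_{\rm clt}=W_{\rm clt}^{(n)}$, each of which solves the orthogonal Procrustes problem $\min_{W\in\mathbb O_k}\|\hat U_g-UW\|_F$, such that for every fixed $i$ $$S_n\sigma_n^{-1}\Gamma_i^{-1/2}\bigl(W_{\rm clt}[\hat U_g]_i-[U]_i\bigr)$$ converges in distribution to $N(0,I_k)$ as $n\to\infty$. -/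

import Mathlib

open MeasureTheory ProbabilityTheory Filter Topology Matrix

noncomputable section

namespace RsRSVD

/-! ### Asymptotic comparison of sequences -/

/-- `a ≾ b`: there is a constant `c`, not depending on `n`, with `a n ≤ c * b n` for all but
finitely many `n`. -/
def Precsim (a b : ℕ → ℝ) : Prop :=
  ∃ c : ℝ, ∀ᶠ n in atTop, a n ≤ c * b n

/-- `a ≍ b`, that is `a = Θ(b)`. -/
def Asymp (a b : ℕ → ℝ) : Prop :=
  Precsim a b ∧ Precsim b a

/-- Convergence to `0` in probability, for random variables that may live on different
probability spaces. -/
def TendstoZeroInProbability {Ω : ℕ → Type*} [∀ n, MeasurableSpace (Ω n)]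
    (P : ∀ n, Measure (Ω n)) (X : ∀ n, Ω n → ℝ) : Prop :=
  ∀ ε : ℝ, 0 < ε → Tendsto (fun n => P n {ω | ε ≤ |X n ω|}) atTop (𝓝 0)

/-! ### Matrix norms, rows, square roots -/

/-- The spectral norm `‖A‖`. -/
def opNorm {m n : ℕ} (A : Matrix (Fin m) (Fin n) ℝ) : ℝ :=
  ‖(Matrix.toEuclideanLin A).toContinuousLinearMap‖

/-- The Frobenius norm `‖A‖_F`. -/
def frobNorm {m n : ℕ} (A : Matrix (Fin m) (Fin n) ℝ) : ℝ :=
  √(∑ i, ∑ j, A i j ^ 2)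

/-- The `2 → ∞` norm: the maximum of the Euclidean norms of the rows. -/
def twoInfNorm {m n : ℕ} (A : Matrix (Fin m) (Fin n) ℝ) : ℝ :=
  ⨆ i, √(∑ j, A i j ^ 2)

/-- The row of `A` with (zero-based) index `i`, as a vector; `0` if there is no such row. -/
def rowVec {n k : ℕ} (A : Matrix (Fin n) (Fin k) ℝ) (i : ℕ) : Fin k → ℝ :=
  if h : i < n then A ⟨i, h⟩ else 0

/-- `A ^ (-1/2)` for a (symmetric) positive definite matrix `A`, by functional calculus. -/
def invSqrt {k : ℕ} (A : Matrix (Fin k) (Fin k) ℝ) : Matrix (Fin k) (Fin k) ℝ :=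
  cfc (fun x : ℝ => (√x)⁻¹) A

/-- The vector `S σ⁻¹ Γ^{-1/2} v`, in `ℝᵏ` with its Euclidean structure. -/
def standardize {k : ℕ} (S σ : ℝ) (Γ : Matrix (Fin k) (Fin k) ℝ) (v : Fin k → ℝ) :
    EuclideanSpace ℝ (Fin k) :=
  WithLp.toLp 2 ((S * σ⁻¹) • (invSqrt Γ *ᵥ v))

/-! ### Eigenvectors and singular vectors -/

/-- `M = U Λ Uᵀ` with `UᵀU = I` and `Λ = diag(lam)`, where all `lam j` are nonzero and in
non-increasing order of magnitude. So `M` is symmetric of rank `k`, and `lam`, `U` are its nonzero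
eigenvalues with corresponding orthonormal eigenvectors. -/
structure IsEigendecomposition {n k : ℕ} (M : Matrix (Fin n) (Fin n) ℝ)
    (U : Matrix (Fin n) (Fin k) ℝ) (lam : Fin k → ℝ) : Prop where
  orthonormal : Uᵀ * U = 1
  eq_mul : M = U * Matrix.diagonal lam * Uᵀ
  ne_zero : ∀ j, lam j ≠ 0
  antitone : Antitone fun j => |lam j|

/-- The condition number `ψ = |λ₁ / λ_k|`. -/
def condNumber {k : ℕ} (hk : 1 ≤ k) (lam : Fin k → ℝ) : ℝ :=
  |lam ⟨0, hk⟩ / lam ⟨k - 1, Nat.sub_lt hk Nat.one_pos⟩|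

/-- The singular values of `Y` in non-increasing order, `sv Y 0` being the largest one; followed by
zeros. -/
def sv {n q : ℕ} (Y : Matrix (Fin n) (Fin q) ℝ) (j : ℕ) : ℝ :=
  (Matrix.toEuclideanLin Y).singularValues j

/-- `Uhat` is a matrix of `k` leading left singular vectors of `Y`: there is a full singular value
decomposition `Y = A Σ Bᵀ` (`A`, `B` orthogonal, `Σ` rectangular diagonal carrying the singular
values in non-increasing order) such that `Uhat` consists of the first `k` columns of `A`. -/
def IsLeadingLeftSingular {n q k : ℕ} (Y : Matrix (Fin n) (Fin q) ℝ)
    (Uhat : Matrix (Fin n) (Fin k) ℝ) : Prop :=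
  ∃ hkn : k ≤ n, ∃ A ∈ Matrix.orthogonalGroup (Fin n) ℝ, ∃ B ∈ Matrix.orthogonalGroup (Fin q) ℝ,
    Y = A * (Matrix.of fun (i : Fin n) (j : Fin q) => if (i : ℕ) = (j : ℕ) then sv Y i else 0) * Bᵀ ∧
    Uhat = Matrix.of fun i j => A i (Fin.castLE hkn j)

/-- `Uhat` is an output of the repeated-sampling randomized SVD of `Mhat` with target rank `k`, `g`
power iterations and sketching matrices `G 0, …, G (a - 1)`: among the sketches `Mhat ^ g * G b`
one with the largest `k`-th singular value is chosen, and `Uhat` consists of its `k` leading left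
singular vectors. -/
def IsRSVDOutput {n q k a : ℕ} (g : ℕ) (Mhat : Matrix (Fin n) (Fin n) ℝ)
    (G : Fin a → Matrix (Fin n) (Fin q) ℝ) (Uhat : Matrix (Fin n) (Fin k) ℝ) : Prop :=
  ∃ b : Fin a, (∀ b', sv (Mhat ^ g * G b') (k - 1) ≤ sv (Mhat ^ g * G b) (k - 1)) ∧
    IsLeadingLeftSingular (Mhat ^ g * G b) Uhat

/-- `W` solves the orthogonal Procrustes problem `min ‖Uhat - U W‖_F` over orthogonal `W`. -/
def IsProcrustes {n k : ℕ} (Uhat U : Matrix (Fin n) (Fin k) ℝ) (W : Matrix (Fin k) (Fin k) ℝ) :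
    Prop :=
  W ∈ Matrix.orthogonalGroup (Fin k) ℝ ∧
    ∀ W' ∈ Matrix.orthogonalGroup (Fin k) ℝ, frobNorm (Uhat - U * W) ≤ frobNorm (Uhat - U * W')

/-! ### The random matrices -/

/-- The entries of all the sketching matrices are i.i.d. standard normal, and the sketching matrices
are independent of the noise matrix `E`. -/
structure IsGaussianSketch {Ω : Type*} [MeasurableSpace Ω] (P : Measure Ω) {n q a : ℕ}
    (E : Ω → Matrix (Fin n) (Fin n) ℝ) (G : Ω → Fin a → Matrix (Fin n) (Fin q) ℝ) : Prop where
  law : HasLaw (fun ω (p : Fin a × Fin n × Fin q) => G ω p.1 p.2.1 p.2.2)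
    (Measure.pi fun _ => gaussianReal 0 1) P
  indep : IndepFun (fun ω (p : Fin n × Fin n) => E ω p.1 p.2)
    (fun ω (p : Fin a × Fin n × Fin q) => G ω p.1 p.2.1 p.2.2) P

/-! ### The assumptions -/

/-- Signal-to-noise ratio: `S_n / E_n ≿ n ^ β` and `‖E‖ ≤ E_n` with probability at least
`1 - n⁻⁶`, for all large `n`. -/
def SNRAssumption {Ω : ℕ → Type*} [∀ n, MeasurableSpace (Ω n)] (P : ∀ n, Measure (Ω n))
    (E : ∀ n, Ω n → Matrix (Fin n) (Fin n) ℝ) (S En : ℕ → ℝ) (β : ℝ) : Prop :=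
  Precsim (fun n => (n : ℝ) ^ β) (fun n => S n / En n) ∧
    ∀ᶠ n : ℕ in atTop, 1 - ((n : ℝ) ^ 6)⁻¹ ≤ (P n).real {ω | opNorm (E n ω) ≤ En n}

/-- Row-wise concentration of the powers of the noise; `‖u‖` is the maximum norm of the
(deterministic) vector `u`. -/
def RowConcentration {Ω : ℕ → Type*} [∀ n, MeasurableSpace (Ω n)] (P : ∀ n, Measure (Ω n))
    (E : ∀ n, Ω n → Matrix (Fin n) (Fin n) ℝ) (En : ℕ → ℝ) (δ : ℝ) : Prop :=
  ∃ C : ℝ, ∀ᶠ n : ℕ in atTop, ∀ r : ℕ, 1 ≤ r → (r : ℝ) ≤ Real.log n → ∀ u : Fin n → ℝ,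
    1 - ((n : ℝ) ^ 8)⁻¹ ≤
      (P n).real {ω | ∀ i, |((E n ω ^ r) *ᵥ u) i| ≤
        C * En n ^ r * Real.log n ^ (δ * r) * ‖u‖}

/-- `ϑ = max {1, q^{-1/2} (log n)^{1/2}}`, with `q` the sketching dimension. -/
def vartheta (q n : ℕ) : ℝ :=
  max 1 ((q : ℝ) ^ (-(1 / 2) : ℝ) * Real.log n ^ (1 / 2 : ℝ))

open Classical in
/-- The logarithmic factor `ℓ_clt`. -/
def lclt (β δ : ℝ) (g q n : ℕ) : ℝ :=
  if (g : ℝ) = 2 + (2 * β)⁻¹ then Real.log n ^ (g * δ + 1 / 2)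
  else Real.log n ^ (2 * δ) * vartheta q n

/-- The noise level is `E_n = Θ(√n σ_n)` with `S_n / E_n ≾ n ^ β`, where `σ_n` is bounded and
non-negative; the matrices `Γ_i` are deterministic and uniformly (in `n`) non-degenerate,
`Γ_i ⪰ c_i I` with `c_i > 0`; and `S_n σ_n⁻¹ Γ_i^{-1/2} [E U Λ⁻¹]_i` converges in distribution to
`N(0, I)` for every fixed `i`. -/
structure CLTAssumption {Ω : ℕ → Type*} [∀ n, MeasurableSpace (Ω n)] (P : ∀ n, Measure (Ω n))
    [∀ n, IsProbabilityMeasure (P n)] {k : ℕ}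
    (E : ∀ n, Ω n → Matrix (Fin n) (Fin n) ℝ) (U : ∀ n, Matrix (Fin n) (Fin k) ℝ)
    (lam : ℕ → Fin k → ℝ) (S En σ : ℕ → ℝ) (β : ℝ)
    (Γ : ℕ → ℕ → Matrix (Fin k) (Fin k) ℝ) : Prop where
  sigma_nonneg : ∀ n, 0 ≤ σ n
  sigma_bounded : ∃ B, ∀ n, σ n ≤ B
  noise_level : Asymp En fun n => √n * σ n
  snr_upper : Precsim (fun n => S n / En n) fun n => (n : ℝ) ^ β
  nondegenerate : ∀ i, ∃ c : ℝ, 0 < c ∧ ∀ᶠ n in atTop,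
    (Γ n i - c • (1 : Matrix (Fin k) (Fin k) ℝ)).PosSemidef
  clt : ∀ i, TendstoInDistribution
    (fun n (ω : Ω n) => standardize (S n) (σ n) (Γ n i)
      (rowVec (E n ω * U n * (Matrix.diagonal (lam n))⁻¹) i))
    atTop id P (stdGaussian (EuclideanSpace ℝ (Fin k)))

end RsRSVD

end

open RsRSVD

/-! Put `ε = En / S`, which is at most a multiple of `n ^ (-β)`. The aim is the first-order
expansion `Uhat * Wᵀ - U = E * U * Λ⁻¹ + error` in a fixed row, with an error negligible against `σ
/ S`. The assumed limit law of the rows of `E * U * Λ⁻¹` then passes to `Uhat` by Slutsky's theorem.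

Deterministic part (`exists_rowNorm_expansion_le`). The output has the form `Mhat ^ g * Q` with `Q =
G b * R`. Expanding `Mhat = M + E` from the left, and stopping at the first signal factor, gives
terms `E ^ r * U * Λ * p (g - 1 - r)`, where `p s = Uᵀ * Mhat ^ s * Q` has only `k` rows, plus `E ^
g * Q`. These compressed iterates satisfy `p (s + 1) = Λ * p s + Uᵀ * E * Mhat ^ s * Q`. Solved
backwards from `P = Uᵀ * Uhat`, the recursion yields `Uhat = (U + E * U * Λ⁻¹) * P + error`; the
rows of `E ^ r * U` are small by row-wise concentration. A Procrustes solution `W` differs from `P`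
only to second order, since `Pᵀ * P - 1` is quadratic in `Uhat - U * P`. With `μ = twoInfNorm U` and
`L` of order `(log n) ^ δ`, the error is a multiple of `μ * ‖Uᵀ * E * U‖ / S + (L * ε) ^ 2 * μ + κ *
ε ^ g`, where `κ` measures the quality of the sketch.

Random part. What matters is the size of the sketched noise terms relative to the `k`-th singular
value of `Uᵀ * G b` for the best `b`. Both are compared with `T = sketchLevel k q N`. With
probability tending to one some sketch reaches `T` (`exists_gaussPi_sketchLevel_le`). A given linear
form is at most `κ * T` times its norm on all `N` sketches at once, except with probability `exp
(-(κ ^ 2 - 8) / 16)` (`sketch_level_union_bound`). Then `T` cancels, and neither the number nor the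
dimension of the sketches survives in the bound. The choice `κ = n ^ (β / 2)` makes the exceptional
probability vanish. After multiplication by `S / σ`, the first two error terms are bounded by the
quantity assumed to vanish, and the last one by a multiple of `√n * κ * ε ^ (g - 1)`, which tends to
`0` because of the lower bound on `g`.

No rate is needed for the event that a good sketch exists: it suffices that the number or the
dimension of the sketches is large. This follows from `a n * kt n ≥ C * log n` for any positive `C`,
so `C = 1` will do. -/

namespace RsRSVD

open scoped Matrix.Norms.L2Operator

set_option linter.unusedSectionVars false

/-! ### Spectral norms and Euclidean norms of rows -/

section Norms

variable {l m n : Type*} [Fintype l] [Fintype m] [Fintype n] [DecidableEq l] [DecidableEq m]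
  [DecidableEq n]

/-- The Euclidean norm of the `i`-th row. -/
noncomputable def rowNorm {m n : Type*} [Fintype n] (A : Matrix m n ℝ) (i : m) : ℝ :=
  ‖(WithLp.toLp 2 (A i) : EuclideanSpace ℝ n)‖

theorem norm_mulVec_le (A : Matrix m n ℝ) (v : n → ℝ) :
    ‖(WithLp.toLp 2 (A *ᵥ v) : EuclideanSpace ℝ m)‖ ≤
      ‖A‖ * ‖(WithLp.toLp 2 v : EuclideanSpace ℝ n)‖ :=
  l2_opNorm_mulVec A (WithLp.toLp 2 v)

theorem norm_le_of_mulVec_le (A : Matrix m n ℝ) {c : ℝ} (hc : 0 ≤ c)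
    (h : ∀ v : n → ℝ, ‖(WithLp.toLp 2 (A *ᵥ v) : EuclideanSpace ℝ m)‖ ≤
      c * ‖(WithLp.toLp 2 v : EuclideanSpace ℝ n)‖) : ‖A‖ ≤ c := by
  rw [l2_opNorm_def]
  exact ContinuousLinearMap.opNorm_le_bound _ hc fun v => h v.ofLp

theorem norm_transpose_eq (A : Matrix m n ℝ) : ‖Aᵀ‖ = ‖A‖ := by
  rw [← conjTranspose_eq_transpose_of_trivial, l2_opNorm_conjTranspose]

theorem norm_transpose_mul_self (A : Matrix m n ℝ) : ‖Aᵀ * A‖ = ‖A‖ * ‖A‖ := by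
  rw [← conjTranspose_eq_transpose_of_trivial, l2_opNorm_conjTranspose_mul_self]

theorem norm_one_le : ‖(1 : Matrix n n ℝ)‖ ≤ 1 := by
  refine norm_le_of_mulVec_le _ zero_le_one fun v => ?_
  simp

theorem norm_le_one_of_orthonormal {U : Matrix m n ℝ} (hU : Uᵀ * U = 1) : ‖U‖ ≤ 1 := by
  have h := norm_transpose_mul_self U
  rw [hU] at h
  nlinarith [norm_one_le (n := n), norm_nonneg U]

theorem norm_pow_le_of_le {A : Matrix n n ℝ} {c : ℝ} (h : ‖A‖ ≤ c) (r : ℕ) :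
    ‖A ^ r‖ ≤ c ^ r := by
  induction r with
  | zero => simpa using norm_one_le
  | succ r ih =>
    rw [pow_succ, pow_succ]
    exact (l2_opNorm_mul _ _).trans (mul_le_mul ih h (norm_nonneg _) ((norm_nonneg _).trans ih))

theorem rowNorm_nonneg (A : Matrix m n ℝ) (i : m) : 0 ≤ rowNorm A i := norm_nonneg _

theorem rowNorm_eq_sqrt (A : Matrix m n ℝ) (i : m) : rowNorm A i = √(∑ j, A i j ^ 2) := by
  simp [rowNorm, EuclideanSpace.norm_eq]

theorem rowNorm_add_le (A B : Matrix m n ℝ) (i : m) :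
    rowNorm (A + B) i ≤ rowNorm A i + rowNorm B i :=
  norm_add_le (WithLp.toLp 2 (A i) : EuclideanSpace ℝ n) (WithLp.toLp 2 (B i))

theorem rowNorm_sub_le (A B : Matrix m n ℝ) (i : m) :
    rowNorm (A - B) i ≤ rowNorm A i + rowNorm B i :=
  norm_sub_le (WithLp.toLp 2 (A i) : EuclideanSpace ℝ n) (WithLp.toLp 2 (B i))

theorem rowNorm_smul (c : ℝ) (A : Matrix m n ℝ) (i : m) :
    rowNorm (c • A) i = |c| * rowNorm A i :=
  norm_smul c (WithLp.toLp 2 (A i) : EuclideanSpace ℝ n)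

theorem rowNorm_sum_le {ι : Type*} (s : Finset ι) (A : ι → Matrix m n ℝ) (i : m) :
    rowNorm (∑ r ∈ s, A r) i ≤ ∑ r ∈ s, rowNorm (A r) i := by
  classical
  induction s using Finset.induction_on with
  | empty =>
    rw [Finset.sum_empty, Finset.sum_empty]
    exact le_of_eq (norm_zero (E := EuclideanSpace ℝ n))
  | insert a s ha ih =>
    rw [Finset.sum_insert ha, Finset.sum_insert ha]
    exact (rowNorm_add_le _ _ _).trans (by gcongr)

theorem rowNorm_mul_le (A : Matrix l m ℝ) (B : Matrix m n ℝ) (i : l) :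
    rowNorm (A * B) i ≤ rowNorm A i * ‖B‖ := by
  have : (A * B) i = Bᵀ *ᵥ A i := by
    rw [mulVec_transpose]; rfl
  rw [rowNorm, this, mul_comm, ← norm_transpose_eq]
  exact norm_mulVec_le _ _

theorem rowNorm_le_norm (A : Matrix m n ℝ) (i : m) : rowNorm A i ≤ ‖A‖ := by
  have h := rowNorm_mul_le (1 : Matrix m m ℝ) A i
  rw [Matrix.one_mul] at h
  have h1 : rowNorm (1 : Matrix m m ℝ) i = 1 := by
    rw [rowNorm_eq_sqrt]
    simp [Matrix.one_apply]
  rwa [h1, one_mul] at h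

theorem abs_entry_le_norm (A : Matrix m n ℝ) (i : m) (j : n) : |A i j| ≤ ‖A‖ :=
  le_trans (PiLp.norm_apply_le (WithLp.toLp 2 (A i) : EuclideanSpace ℝ n) j)
    (rowNorm_le_norm A i)

theorem norm_le_frob (A : Matrix m n ℝ) : ‖A‖ ≤ √(∑ i, rowNorm A i ^ 2) := by
  refine norm_le_of_mulVec_le _ (Real.sqrt_nonneg _) fun v => ?_
  rw [EuclideanSpace.norm_eq, ← Real.sqrt_sq (norm_nonneg (WithLp.toLp 2 v : EuclideanSpace ℝ n)),
    ← Real.sqrt_mul (by positivity)]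
  refine Real.sqrt_le_sqrt ?_
  rw [Finset.sum_mul]
  refine Finset.sum_le_sum fun i _ => ?_
  rw [← mul_pow]
  refine pow_le_pow_left₀ (norm_nonneg _) ?_ 2
  have := norm_inner_le_norm (𝕜 := ℝ) (WithLp.toLp 2 (A i) : EuclideanSpace ℝ n) (WithLp.toLp 2 v)
  refine le_trans (le_of_eq ?_) this
  simp [mulVec, PiLp.inner_apply, dotProduct, mul_comm]

theorem norm_le_sqrt_card_mul (A : Matrix m n ℝ) {b : ℝ} (hb : 0 ≤ b)
    (h : ∀ i, rowNorm A i ≤ b) : ‖A‖ ≤ √(Fintype.card m) * b := by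
  refine (norm_le_frob A).trans ?_
  rw [← Real.sqrt_sq hb, ← Real.sqrt_mul (by positivity)]
  refine Real.sqrt_le_sqrt ?_
  calc ∑ i, rowNorm A i ^ 2 ≤ ∑ _i : m, √(b ^ 2) ^ 2 := by
        refine Finset.sum_le_sum fun i _ => pow_le_pow_left₀ (rowNorm_nonneg _ _) ?_ 2
        rw [Real.sqrt_sq hb]; exact h i
    _ = _ := by simp [Real.sqrt_sq hb]

end Norms

/-! ### Expansion of powers of signal plus noise -/

section PowerExpansion

variable {k n q : Type*} [Fintype k] [Fintype n] [DecidableEq k] [DecidableEq n]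
  (U : Matrix n k ℝ) (Λ : Matrix k k ℝ) (E : Matrix n n ℝ) (Q : Matrix n q ℝ)

/-- Multiply out from the left and stop at the first signal factor. The point is that the remaining
powers occur only in compressed form, as matrices indexed by `k` on the left, so that rows are
governed by `E ^ r * U` alone. -/
theorem pow_mul_expansion (s : ℕ) :
    (U * Λ * Uᵀ + E) ^ s * Q =
      ∑ r ∈ Finset.range s, E ^ r * U * Λ * (Uᵀ * (U * Λ * Uᵀ + E) ^ (s - 1 - r) * Q) +
        E ^ s * Q := by
  induction s with
  | zero => simp
  | succ s ih =>
    rw [Finset.sum_range_succ', pow_succ' E, Matrix.mul_assoc E]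
    have h1 : ∀ r ∈ Finset.range s,
        E * (E ^ r * U * Λ * (Uᵀ * (U * Λ * Uᵀ + E) ^ (s - 1 - r) * Q)) =
        E ^ (r + 1) * U * Λ * (Uᵀ * (U * Λ * Uᵀ + E) ^ (s + 1 - 1 - (r + 1)) * Q) := by
      intro r _
      rw [show s + 1 - 1 - (r + 1) = s - 1 - r by omega, pow_succ' E]
      simp only [Matrix.mul_assoc]
    rw [← Finset.sum_congr rfl h1, ← Matrix.mul_sum, add_right_comm, ← Matrix.mul_add, ← ih,
      pow_succ' (U * Λ * Uᵀ + E)]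
    simp only [pow_zero, Matrix.one_mul, Nat.sub_zero, Nat.add_sub_cancel, Matrix.mul_assoc,
      Matrix.add_mul]
    abel

/-- Since `Uᵀ * U = 1`, compression turns power iteration into a `k`-dimensional linear recursion
with a noise perturbation. It is run backwards to control the output and forwards to bound a
singular value from below. -/
theorem transpose_mul_pow_succ (hU : Uᵀ * U = 1) (s : ℕ) :
    Uᵀ * (U * Λ * Uᵀ + E) ^ (s + 1) * Q =
      Λ * (Uᵀ * (U * Λ * Uᵀ + E) ^ s * Q) + Uᵀ * E * (U * Λ * Uᵀ + E) ^ s * Q := by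
  have h : Uᵀ * (U * Λ * Uᵀ + E) = Λ * Uᵀ + Uᵀ * E := by
    rw [Matrix.mul_add]
    congr 1
    rw [← Matrix.mul_assoc, ← Matrix.mul_assoc, hU, Matrix.one_mul]
  rw [pow_succ', ← Matrix.mul_assoc Uᵀ, h]
  simp only [Matrix.add_mul, Matrix.mul_assoc]

end PowerExpansion

theorem norm_mul_le_of_le {l m n : Type*} [Fintype l] [Fintype m] [Fintype n]
    [DecidableEq l] [DecidableEq m] [DecidableEq n] {A : Matrix l m ℝ} {B : Matrix m n ℝ} {a b : ℝ}
    (hA : ‖A‖ ≤ a) (hB : ‖B‖ ≤ b) : ‖A * B‖ ≤ a * b :=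
  (l2_opNorm_mul _ _).trans (mul_le_mul hA hB (norm_nonneg _) ((norm_nonneg _).trans hA))

/-! ### Deterministic analysis of power iteration -/

section PowerIteration

variable {n k : Type*} [Fintype k] [Fintype n] [DecidableEq k] [DecidableEq n]
  {U : Matrix n k ℝ} {Λ Λi : Matrix k k ℝ} {E : Matrix n n ℝ} {Q : Matrix n k ℝ}
  {g : ℕ} {ε ψ τ : ℝ}

/-- The compressed iterates `Uᵀ (M + E)^s Q` are bounded when the last one is. -/
theorem norm_transpose_mul_pow_le (hU : Uᵀ * U = 1) (hΛi : Λi * Λ = 1) (hψ : 1 ≤ ψ)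
    (hΛin : ‖Λi‖ ≤ ψ) (hlast : ‖Uᵀ * (U * Λ * Uᵀ + E) ^ g * Q‖ ≤ 1)
    (hd : ∀ s < g, ‖Uᵀ * E * (U * Λ * Uᵀ + E) ^ s * Q‖ ≤ 1) :
    ∀ s ≤ g, ‖Uᵀ * (U * Λ * Uᵀ + E) ^ s * Q‖ ≤ 2 * (2 * ψ) ^ g := by
  -- Run the recursion backwards from the last iterate. The summand `1` absorbs the perturbation: `x
  -- = ‖p‖ + 1` grows at most from `x` to `ψ * x + 1`, which stays below `2 * ψ` times the bound for
  -- `x`.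
  have key : ∀ j ≤ g, ‖Uᵀ * (U * Λ * Uᵀ + E) ^ (g - j) * Q‖ + 1 ≤ 2 * (2 * ψ) ^ j := by
    intro j
    induction j with
    | zero => intro _; simp only [Nat.sub_zero, pow_zero]; linarith
    | succ j ih =>
      intro hj
      have ih := ih (by omega)
      have hs : g - j = (g - (j + 1)) + 1 := by omega
      have hstep := transpose_mul_pow_succ U Λ E Q hU (g - (j + 1))
      rw [← hs] at hstep
      have hb := hd (g - (j + 1)) (by omega)
      set p := Uᵀ * (U * Λ * Uᵀ + E) ^ (g - (j + 1)) * Q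
      set d := Uᵀ * E * (U * Λ * Uᵀ + E) ^ (g - (j + 1)) * Q
      set p' := Uᵀ * (U * Λ * Uᵀ + E) ^ (g - j) * Q
      have hp : p = Λi * (p' - d) := by
        rw [hstep, add_sub_cancel_right, ← Matrix.mul_assoc, hΛi, Matrix.one_mul]
      have h1 : ‖p‖ ≤ ψ * (‖p'‖ + 1) := by
        rw [hp]
        exact norm_mul_le_of_le hΛin ((norm_sub_le _ _).trans (by linarith))
      have h2 : ψ * (‖p'‖ + 1) ≤ ψ * (2 * (2 * ψ) ^ j) := by gcongr
      have h3 : 1 ≤ (2 * ψ) ^ j := one_le_pow₀ (by linarith)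
      have h4 : (2 * ψ) ^ (j + 1) = 2 * ψ * (2 * ψ) ^ j := by rw [pow_succ]; ring
      rw [h4]
      nlinarith
  intro s hs
  have h := key (g - s) (by omega)
  rw [show g - (g - s) = s by omega] at h
  have : (2 * ψ) ^ (g - s) ≤ (2 * ψ) ^ g := pow_le_pow_right₀ (by linarith) (by omega)
  linarith

/-- First-order bound on `Uᵀ E (M + E)^s Q`. -/
theorem norm_transpose_mul_noise_mul_pow_le {K : ℝ} (hU : Uᵀ * U = 1) (hΛ : ‖Λ‖ ≤ 1)
    (hε0 : 0 ≤ ε) (hε1 : ε ≤ 1)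
    (hE : ‖E‖ ≤ ε) (hp : ∀ s ≤ g, ‖Uᵀ * (U * Λ * Uᵀ + E) ^ s * Q‖ ≤ K)
    (hs2 : ∀ s < g, ‖Uᵀ * E ^ (s + 1) * Q‖ ≤ τ * ε ^ (s + 1)) (s : ℕ) (hs : s + 1 < g) :
    ‖Uᵀ * E * (U * Λ * Uᵀ + E) ^ (s + 1) * Q‖ ≤
      K * ‖Uᵀ * E * U‖ + g * K * ε ^ 2 + τ * ε ^ (s + 2) := by
  have hK : 0 ≤ K := (norm_nonneg _).trans (hp 0 (Nat.zero_le _))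
  have hUn : ‖U‖ ≤ 1 := norm_le_one_of_orthonormal hU
  have hUt : ‖Uᵀ‖ ≤ 1 := by rwa [norm_transpose_eq]
  have hexp := pow_mul_expansion U Λ E Q (s + 1)
  -- The term with `Uᵀ * E * U` is isolated, because the final condition bounds it separately from
  -- `ε`. All other signal terms contain at least two noise factors.
  have : Uᵀ * E * (U * Λ * Uᵀ + E) ^ (s + 1) * Q =
      ∑ r ∈ Finset.range s, Uᵀ * (E ^ (r + 2) * U * (Λ *
        (Uᵀ * (U * Λ * Uᵀ + E) ^ (s + 1 - 1 - (r + 1)) * Q))) +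
      Uᵀ * E * U * (Λ * (Uᵀ * (U * Λ * Uᵀ + E) ^ s * Q)) + Uᵀ * E ^ (s + 2) * Q := by
    rw [Matrix.mul_assoc _ _ Q, hexp, Finset.sum_range_succ', Matrix.mul_add, Matrix.mul_add,
      Matrix.mul_sum]
    congr 1
    · congr 1
      · refine Finset.sum_congr rfl fun r _ => ?_
        rw [pow_succ' E (r + 1)]
        simp only [Matrix.mul_assoc]
      · simp [Matrix.mul_assoc]
    · rw [pow_succ' E (s + 1)]
      simp only [Matrix.mul_assoc]
  rw [this]
  have hΛp : ∀ t ≤ g, ‖Λ * (Uᵀ * (U * Λ * Uᵀ + E) ^ t * Q)‖ ≤ K := fun t ht => by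
    simpa using norm_mul_le_of_le hΛ (hp t ht)
  have hsum : ‖∑ r ∈ Finset.range s, Uᵀ * (E ^ (r + 2) * U * (Λ *
        (Uᵀ * (U * Λ * Uᵀ + E) ^ (s + 1 - 1 - (r + 1)) * Q)))‖ ≤ g * K * ε ^ 2 := by
    refine (norm_sum_le _ _).trans ?_
    have : ∀ r ∈ Finset.range s, ‖Uᵀ * (E ^ (r + 2) * U * (Λ *
        (Uᵀ * (U * Λ * Uᵀ + E) ^ (s + 1 - 1 - (r + 1)) * Q)))‖ ≤ K * ε ^ 2 := by
      intro r _
      refine (norm_mul_le_of_le hUt (norm_mul_le_of_le (norm_mul_le_of_le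
        (norm_pow_le_of_le hE (r + 2)) hUn) (hΛp _ (by omega)))).trans ?_
      have : ε ^ (r + 2) ≤ ε ^ 2 := pow_le_pow_of_le_one hε0 hε1 (by omega)
      nlinarith
    refine (Finset.sum_le_sum this).trans ?_
    rw [Finset.sum_const, Finset.card_range, nsmul_eq_mul]
    have : (s : ℝ) ≤ g := by exact_mod_cast (by omega : s ≤ g)
    have h2 : 0 ≤ K * ε ^ 2 := by positivity
    nlinarith
  have h1 : ‖Uᵀ * E * U * (Λ * (Uᵀ * (U * Λ * Uᵀ + E) ^ s * Q))‖ ≤ ‖Uᵀ * E * U‖ * K :=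
    norm_mul_le_of_le le_rfl (hΛp s (by omega))
  have h2 := hs2 (s + 1) hs
  refine (norm_add₃_le).trans ?_
  linarith

set_option maxHeartbeats 1000000 in
/-- Deterministic first-order expansion of a row of the output of power iteration. -/
theorem exists_rowNorm_expansion_le (ψ c : ℝ) (g : ℕ) (hg : 3 ≤ g) (hψ : 1 ≤ ψ) (hc : 0 ≤ c) :
    ∃ K : ℝ, 0 ≤ K ∧ ∀ {n k : Type} [Fintype k] [Fintype n] [DecidableEq k] [DecidableEq n]
      (U : Matrix n k ℝ) (Λ Λi W : Matrix k k ℝ) (E : Matrix n n ℝ) (Q Uh : Matrix n k ℝ)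
      (ε τ μ L : ℝ) (i : n),
      Uᵀ * U = 1 → Λi * Λ = 1 → ‖Λ‖ ≤ 1 → ‖Λi‖ ≤ ψ → 0 ≤ ε → ε ≤ 1 → ‖E‖ ≤ ε →
      Uh = (U * Λ * Uᵀ + E) ^ g * Q → Uhᵀ * Uh = 1 →
      0 ≤ τ → τ * ε ≤ 1 →
      (∀ s < g, ‖Uᵀ * E * (U * Λ * Uᵀ + E) ^ s * Q‖ ≤ 1) →
      (∀ s < g, ‖Uᵀ * E ^ (s + 1) * Q‖ ≤ τ * ε ^ (s + 1)) →
      ‖E ^ g * Q‖ ≤ ε → rowNorm (E ^ g * Q) i ≤ τ * ε ^ g →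
      0 ≤ μ → μ ≤ 1 → 1 ≤ L → L * ε ≤ 1 →
      rowNorm U i ≤ μ →
      (∀ r, 1 ≤ r → r < g → rowNorm (E ^ r * U) i ≤ (L * ε) ^ r * μ) →
      W * Wᵀ = 1 →
      ‖Uᵀ * Uh - W‖ ≤ c * ‖(Uᵀ * Uh)ᵀ * (Uᵀ * Uh) - 1‖ →
      rowNorm (Uh * Wᵀ - U - E * U * Λi) i ≤
        K * (μ * ‖Uᵀ * E * U‖ + (L * ε) ^ 2 * μ + τ * ε ^ g) := by
  obtain ⟨m, rfl⟩ : ∃ m, g = m + 3 := ⟨g - 3, by omega⟩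
  -- `B` bounds the compressed iterates, `D * ε` the last two perturbations `d1` and `d2`, and `D2 *
  -- ε` the residual `Uh - U * P`. Here `g ≥ 3` makes the exponent `m + 1` in `d2` positive, as the
  -- bound on the perturbations requires.
  set B : ℝ := 2 * (2 * ψ) ^ (m + 3) with hB
  have hB1 : 1 ≤ B := by
    have : 1 ≤ (2 * ψ) ^ (m + 3) := one_le_pow₀ (by linarith)
    linarith
  set G : ℝ := ((m + 3 : ℕ) : ℝ) with hG
  have hG0 : 0 ≤ G := Nat.cast_nonneg _
  set D : ℝ := B + G * B + 1 with hD
  have hD0 : 0 ≤ D := by positivity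
  set D2 : ℝ := G * B + 1 + D with hD2
  have hD20 : 0 ≤ D2 := by positivity
  refine ⟨B + G * B + (ψ + 1) * D + G * B + 2 + (1 + ψ) * (c * D2 ^ 2), by positivity, ?_⟩
  intro n k _ _ _ _ U Λ Λi W E Q Uh ε τ μ L i hU hΛi hΛ hΛin hε0 hε1 hE hUh hUhU hτ hτε hs1 hs2 hs3
    hs3i hμ hμ1 hL hLε hUi hrow hW hproc
  have hUn : ‖U‖ ≤ 1 := norm_le_one_of_orthonormal hU
  have hUt : ‖Uᵀ‖ ≤ 1 := by rwa [norm_transpose_eq]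
  have hUhn : ‖Uh‖ ≤ 1 := norm_le_one_of_orthonormal hUhU
  have hWt : ‖Wᵀ‖ ≤ 1 := norm_le_one_of_orthonormal (by rwa [transpose_transpose])
  have hpg : Uᵀ * (U * Λ * Uᵀ + E) ^ (m + 3) * Q = Uᵀ * Uh := by rw [hUh, Matrix.mul_assoc]
  have hp : ∀ s ≤ m + 3, ‖Uᵀ * (U * Λ * Uᵀ + E) ^ s * Q‖ ≤ B :=
    norm_transpose_mul_pow_le hU hΛi hψ hΛin
      (by rw [hpg]; simpa using norm_mul_le_of_le hUt hUhn) hs1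
  have hdb := norm_transpose_mul_noise_mul_pow_le hU hΛ hε0 hε1 hE hp hs2
  have hu : ‖Uᵀ * E * U‖ ≤ ε := by
    simpa using norm_mul_le_of_le (norm_mul_le_of_le hUt hE) hUn
  have hd1 := hdb (m + 1) (by omega)
  have hd2 := hdb m (by omega)
  have hstep1 := transpose_mul_pow_succ U Λ E Q hU (m + 2)
  have hstep2 := transpose_mul_pow_succ U Λ E Q hU (m + 1)
  have hexp := pow_mul_expansion U Λ E Q (m + 3)
  rw [← hUh, Finset.sum_range_succ', Finset.sum_range_succ'] at hexp
  set p : ℕ → Matrix k k ℝ := fun s => Uᵀ * (U * Λ * Uᵀ + E) ^ s * Q with hpdef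
  set d1 := Uᵀ * E * (U * Λ * Uᵀ + E) ^ (m + 1 + 1) * Q with hd1def
  set d2 := Uᵀ * E * (U * Λ * Uᵀ + E) ^ (m + 1) * Q with hd2def
  set u := ‖Uᵀ * E * U‖ with hudef
  set P := Uᵀ * Uh with hP
  have hu0 : 0 ≤ u := norm_nonneg _
  have hs1' : P = Λ * p (m + 2) + d1 := by rw [← hpg]; exact hstep1
  have hs2' : p (m + 2) = Λ * p (m + 1) + d2 := hstep2
  have hpow2 : ε ^ 2 ≤ ε := by nlinarith
  have hτpow : ∀ j, τ * ε ^ (j + 2) ≤ ε := by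
    intro j
    have h1 : ε ^ (j + 1) ≤ ε := by
      simpa using pow_le_pow_of_le_one hε0 hε1 (show 1 ≤ j + 1 by omega)
    have : τ * ε ^ (j + 2) = (τ * ε) * ε ^ (j + 1) := by ring
    rw [this]
    have : 0 ≤ ε ^ (j + 1) := by positivity
    nlinarith
  have hd1ε : ‖d1‖ ≤ D * ε := by
    have := hτpow (m + 1)
    have h3 : G * B * ε ^ 2 ≤ G * B * ε := by gcongr
    have h4 : B * u ≤ B * ε := by gcongr
    calc ‖d1‖ ≤ _ := hd1
      _ ≤ D * ε := by rw [hD]; linarith only [this, h3, h4]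
  have hd2ε : ‖d2‖ ≤ D * ε := by
    have := hτpow m
    have h3 : G * B * ε ^ 2 ≤ G * B * ε := by gcongr
    have h4 : B * u ≤ B * ε := by gcongr
    calc ‖d2‖ ≤ _ := hd2
      _ ≤ D * ε := by rw [hD]; linarith only [this, h3, h4]
  have hΛp : ∀ t ≤ m + 3, ‖Λ * p t‖ ≤ B := fun t ht => by
    simpa using norm_mul_le_of_le hΛ (hp t ht)
  have hGm : (m : ℝ) + 1 + 1 ≤ G := by rw [hG]; push_cast; linarith
  have hexp' : Uh = ∑ r ∈ Finset.range (m + 1), E ^ (r + 2) * U * (Λ * p (m - r)) +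
      E * U * (Λ * p (m + 1)) + U * (Λ * p (m + 2)) + E ^ (m + 3) * Q := by
    rw [hexp]
    congr 1
    congr 1
    · congr 1
      · refine Finset.sum_congr rfl fun r hr => ?_
        rw [show m + 3 - 1 - (r + 1 + 1) = m - r by omega]
        simp only [hpdef, Matrix.mul_assoc]
      · simp only [hpdef, Matrix.mul_assoc, zero_add, pow_one,
          show m + 3 - 1 - 1 = m + 1 by omega]
    · simp only [hpdef, Matrix.mul_assoc, pow_zero, Matrix.one_mul,
          show m + 3 - 1 - 0 = m + 2 by omega]
  set R := ∑ r ∈ Finset.range (m + 1), E ^ (r + 2) * U * (Λ * p (m - r)) with hR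
  -- The coefficients of `U` and `E * U` are expressed through `P`, up to `d1` and `d2`, so that `P`
  -- becomes a common right factor.
  have hLp1 : Λ * p (m + 1) = Λi * (P - d1) - d2 := by
    rw [hs1', add_sub_cancel_right, ← Matrix.mul_assoc Λi Λ, hΛi, Matrix.one_mul, hs2',
      add_sub_cancel_right]
  have hLp2 : Λ * p (m + 2) = P - d1 := by rw [hs1', add_sub_cancel_right]
  -- first-order expansion
  have hmain : Uh - (U + E * U * Λi) * P =
      R - U * d1 - E * U * (Λi * d1) - E * U * d2 + E ^ (m + 3) * Q := by
    conv_lhs => rw [hexp', hLp1, hLp2]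
    simp only [Matrix.mul_sub, Matrix.add_mul, Matrix.mul_assoc]
    abel
  have hEUi : rowNorm (E * U) i ≤ L * ε * μ := by simpa using hrow 1 le_rfl (by omega)
  have hLε0 : 0 ≤ L * ε := by positivity
  have hRi : rowNorm R i ≤ G * B * ((L * ε) ^ 2 * μ) := by
    refine (rowNorm_sum_le _ _ _).trans ?_
    have : ∀ r ∈ Finset.range (m + 1), rowNorm (E ^ (r + 2) * U * (Λ * p (m - r))) i ≤
        (L * ε) ^ 2 * μ * B := by
      intro r hr
      rw [Finset.mem_range] at hr
      refine (rowNorm_mul_le _ _ _).trans ?_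
      have h1 := hrow (r + 2) (by omega) (by omega)
      have h2 : (L * ε) ^ (r + 2) ≤ (L * ε) ^ 2 := pow_le_pow_of_le_one hLε0 hLε (by omega)
      exact mul_le_mul (h1.trans (by gcongr)) (hΛp _ (by omega)) (norm_nonneg _) (by positivity)
    refine (Finset.sum_le_sum this).trans ?_
    rw [Finset.sum_const, Finset.card_range, nsmul_eq_mul]
    have : ((m + 1 : ℕ) : ℝ) ≤ G := by push_cast; linarith
    calc ((m + 1 : ℕ) : ℝ) * ((L * ε) ^ 2 * μ * B) ≤ G * ((L * ε) ^ 2 * μ * B) := by gcongr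
      _ = _ := by ring
  have hLε2 : L * ε * μ * ε ≤ (L * ε) ^ 2 * μ := by
    have : L * ε * μ * ε = (L * ε) * μ * (1 * ε) := by ring
    rw [this]
    have : (L * ε) ^ 2 * μ = (L * ε) * μ * (L * ε) := by ring
    rw [this]
    gcongr
  have hε2L : ε ^ 2 * μ ≤ (L * ε) ^ 2 * μ := by
    have : ε ≤ L * ε := le_mul_of_one_le_left hε0 hL
    gcongr
  have hτg0 : 0 ≤ τ * ε ^ (m + 3) := by positivity
  have hX0 : 0 ≤ (L * ε) ^ 2 * μ := by positivity
  have hfirst : rowNorm (Uh - (U + E * U * Λi) * P) i ≤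
      (B + G * B + (ψ + 1) * D + G * B + 2) *
        (μ * u + (L * ε) ^ 2 * μ + τ * ε ^ (m + 3)) := by
    rw [hmain]
    have e1 : rowNorm (U * d1) i ≤ μ * (B * u + G * B * ε ^ 2 + τ * ε ^ (m + 3)) :=
      (rowNorm_mul_le _ _ _).trans (mul_le_mul hUi hd1 (norm_nonneg _) hμ)
    have e2 : rowNorm (E * U * (Λi * d1)) i ≤ L * ε * μ * (ψ * (D * ε)) :=
      (rowNorm_mul_le _ _ _).trans (mul_le_mul hEUi (norm_mul_le_of_le hΛin hd1ε) (norm_nonneg _)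
        (by positivity))
    have e3 : rowNorm (E * U * d2) i ≤ L * ε * μ * (D * ε) :=
      (rowNorm_mul_le _ _ _).trans (mul_le_mul hEUi hd2ε (norm_nonneg _) (by positivity))
    have t1 := rowNorm_add_le (R - U * d1 - E * U * (Λi * d1) - E * U * d2) (E ^ (m + 3) * Q) i
    have t2 := rowNorm_sub_le (R - U * d1 - E * U * (Λi * d1)) (E * U * d2) i
    have t3 := rowNorm_sub_le (R - U * d1) (E * U * (Λi * d1)) i
    have t4 := rowNorm_sub_le R (U * d1) i
    have f1 : μ * (B * u + G * B * ε ^ 2 + τ * ε ^ (m + 3)) ≤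
        B * (μ * u) + G * B * ((L * ε) ^ 2 * μ) + τ * ε ^ (m + 3) := by
      have a1 : μ * (τ * ε ^ (m + 3)) ≤ 1 * (τ * ε ^ (m + 3)) := by gcongr
      have a2 : G * B * (ε ^ 2 * μ) ≤ G * B * ((L * ε) ^ 2 * μ) := by gcongr
      linarith only [a1, a2]
    have f2 : L * ε * μ * (ψ * (D * ε)) ≤ ψ * D * ((L * ε) ^ 2 * μ) := by
      have : ψ * D * (L * ε * μ * ε) ≤ ψ * D * ((L * ε) ^ 2 * μ) := by gcongr
      linarith only [this]
    have f3 : L * ε * μ * (D * ε) ≤ D * ((L * ε) ^ 2 * μ) := by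
      have : D * (L * ε * μ * ε) ≤ D * ((L * ε) ^ 2 * μ) := by gcongr
      linarith only [this]
    have hmu : 0 ≤ μ * u := by positivity
    have hGB : 0 ≤ G * B := by positivity
    have hψD : 0 ≤ ψ * D := by positivity
    set X := (L * ε) ^ 2 * μ
    set Y := μ * u
    set Z := τ * ε ^ (m + 3)
    calc _ ≤ G * B * X + (B * Y + G * B * X + Z) + ψ * D * X + D * X + Z := by
          linarith only [t1, t2, t3, t4, hRi, e1, e2, e3, f1, f2, f3, hs3i]
      _ ≤ _ := by
        have b1 : 0 ≤ G * B * Y := by positivity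
        have b2 : 0 ≤ G * B * Z := by positivity
        have b3 : 0 ≤ ψ * D * Y := by positivity
        have b4 : 0 ≤ ψ * D * Z := by positivity
        have b5 : 0 ≤ D * Y := by positivity
        have b6 : 0 ≤ D * Z := by positivity
        have b7 : 0 ≤ B * X := by positivity
        have b8 : 0 ≤ B * Z := by positivity
        linarith only [b1, b2, b3, b4, b5, b6, b7, b8, hX0, hmu, hτg0]
  -- second-order bound on the rotation
  have hRn : ‖R‖ ≤ G * B * ε - B * ε := by
    refine (norm_sum_le _ _).trans ?_
    have : ∀ r ∈ Finset.range (m + 1), ‖E ^ (r + 2) * U * (Λ * p (m - r))‖ ≤ B * ε := by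
      intro r hr
      have h2 : ε ^ (r + 2) ≤ ε := by
        simpa using pow_le_pow_of_le_one hε0 hε1 (show 1 ≤ r + 2 by omega)
      refine (norm_mul_le_of_le (norm_mul_le_of_le (norm_pow_le_of_le hE (r + 2)) hUn)
        (hΛp _ (by omega))).trans ?_
      nlinarith only [h2, hB1]
    refine (Finset.sum_le_sum this).trans ?_
    rw [Finset.sum_const, Finset.card_range, nsmul_eq_mul]
    have h0 : 0 ≤ B * ε := by positivity
    push_cast
    have h1 : ((m : ℝ) + 1) * (B * ε) ≤ (G - 1) * (B * ε) := by
      gcongr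
      linarith only [hGm]
    linarith only [h1]
  have hdiff : ‖Uh - U * P‖ ≤ D2 * ε := by
    have : Uh - U * P = R + E * U * (Λ * p (m + 1)) + E ^ (m + 3) * Q - U * d1 := by
      conv_lhs => rw [hexp', hLp2]
      simp only [Matrix.mul_sub]
      abel
    rw [this]
    have e1 : ‖E * U * (Λ * p (m + 1))‖ ≤ B * ε := by
      refine (norm_mul_le_of_le (norm_mul_le_of_le hE hUn) (hΛp _ (by omega))).trans ?_
      linarith
    have e2 : ‖U * d1‖ ≤ D * ε := by simpa using norm_mul_le_of_le hUn hd1ε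
    refine (norm_sub_le _ _).trans ((add_le_add_left norm_add₃_le _).trans ?_)
    rw [hD2]
    linarith only [e1, e2, hRn, hs3]
  -- By Pythagoras, as `U * P` is the orthogonal projection of `Uh` and `Uh` has orthonormal
  -- columns. Hence a first-order residual costs `P` only a second-order loss of orthogonality.
  have hPP : Pᵀ * P - 1 = -((Uh - U * P)ᵀ * (Uh - U * P)) := by
    rw [transpose_sub, Matrix.sub_mul, Matrix.mul_sub, Matrix.mul_sub, hUhU, transpose_mul U P]
    have h1 : Uhᵀ * (U * P) = Pᵀ * P := by
      rw [← Matrix.mul_assoc]; congr 1; rw [hP, transpose_mul, transpose_transpose]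
    have h2 : Pᵀ * Uᵀ * Uh = Pᵀ * P := by rw [Matrix.mul_assoc]
    have h3 : Pᵀ * Uᵀ * (U * P) = Pᵀ * P := by
      rw [Matrix.mul_assoc, ← Matrix.mul_assoc Uᵀ, hU, Matrix.one_mul]
    rw [h1, h2, h3]
    abel
  have hPW : ‖P - W‖ ≤ c * (D2 * ε) ^ 2 := by
    refine hproc.trans ?_
    rw [hPP, norm_neg, norm_transpose_mul_self]
    have := norm_nonneg (Uh - U * P)
    have : ‖Uh - U * P‖ * ‖Uh - U * P‖ ≤ (D2 * ε) ^ 2 := by nlinarith only [this, hdiff]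
    gcongr
  have hfin : Uh * Wᵀ - U - E * U * Λi =
      (Uh - (U + E * U * Λi) * P) * Wᵀ + (U + E * U * Λi) * ((P - W) * Wᵀ) := by
    rw [Matrix.sub_mul P, hW]
    simp only [Matrix.mul_sub, Matrix.sub_mul, Matrix.add_mul, Matrix.mul_assoc, Matrix.mul_one]
    abel
  rw [hfin]
  refine (rowNorm_add_le _ _ _).trans ?_
  have hmu : 0 ≤ μ * u := by positivity
  have s1 : rowNorm ((Uh - (U + E * U * Λi) * P) * Wᵀ) i ≤
      (B + G * B + (ψ + 1) * D + G * B + 2) *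
        (μ * u + (L * ε) ^ 2 * μ + τ * ε ^ (m + 3)) := by
    refine (rowNorm_mul_le _ _ _).trans ?_
    exact (mul_le_of_le_one_right (rowNorm_nonneg _ _) hWt).trans hfirst
  have s2 : rowNorm ((U + E * U * Λi) * ((P - W) * Wᵀ)) i ≤
      (1 + ψ) * (c * D2 ^ 2) * ((L * ε) ^ 2 * μ) := by
    refine (rowNorm_mul_le _ _ _).trans ?_
    have r1 : rowNorm (U + E * U * Λi) i ≤ (1 + ψ) * μ := by
      refine (rowNorm_add_le _ _ _).trans ?_
      have : rowNorm (E * U * Λi) i ≤ L * ε * μ * ψ :=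
        (rowNorm_mul_le _ _ _).trans (mul_le_mul hEUi hΛin (norm_nonneg _) (by positivity))
      have : L * ε * μ * ψ ≤ 1 * μ * ψ := by gcongr
      linarith only [hUi, this, ‹rowNorm (E * U * Λi) i ≤ L * ε * μ * ψ›]
    have r2 : ‖(P - W) * Wᵀ‖ ≤ c * (D2 * ε) ^ 2 * 1 := norm_mul_le_of_le hPW hWt
    calc _ ≤ (1 + ψ) * μ * (c * (D2 * ε) ^ 2 * 1) :=
          mul_le_mul r1 r2 (norm_nonneg _) (by positivity)
      _ = (1 + ψ) * (c * D2 ^ 2) * (ε ^ 2 * μ) := by ring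
      _ ≤ _ := by gcongr
  have s3 : (1 + ψ) * (c * D2 ^ 2) * ((L * ε) ^ 2 * μ) ≤
      (1 + ψ) * (c * D2 ^ 2) * (μ * u + (L * ε) ^ 2 * μ + τ * ε ^ (m + 3)) := by
    gcongr
    linarith only [hmu, hτg0]
  linarith only [s1, s2, s3]

end PowerIteration

/-! ### Measurable selection of minimizers -/

section Selection

variable {X Y : Type*} [MeasurableSpace X] [TopologicalSpace Y]

/-- A compact-valued correspondence such that hitting any closed set is a measurable event. -/
structure IsMeasurableCorrespondence (F : X → Set Y) : Prop where
  isCompact : ∀ x, IsCompact (F x)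
  isClosed : ∀ x, IsClosed (F x)
  nonempty : ∀ x, (F x).Nonempty
  measurableSet : ∀ C : Set Y, IsClosed C → MeasurableSet {x | (F x ∩ C).Nonempty}

/-- A minimizer lies in `C` exactly when the minimum of `c` over `F x ∩ C` does not exceed the
minimum over `F x`. Testing this on rational levels expresses the event by countably many hitting
events of closed sets for `F`. -/
theorem IsMeasurableCorrespondence.argmin {F : X → Set Y} (hF : IsMeasurableCorrespondence F)
    {c : Y → ℝ} (hc : Continuous c) :
    IsMeasurableCorrespondence fun x => {y ∈ F x | ∀ z ∈ F x, c y ≤ c z} where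
  isClosed x := by
    have : {y ∈ F x | ∀ z ∈ F x, c y ≤ c z} = F x ∩ ⋂ z ∈ F x, {y | c y ≤ c z} := by
      ext y; simp
    rw [this]
    exact (hF.isClosed x).inter (isClosed_biInter fun z _ => isClosed_le hc continuous_const)
  isCompact x := by
    have : {y ∈ F x | ∀ z ∈ F x, c y ≤ c z} = F x ∩ ⋂ z ∈ F x, {y | c y ≤ c z} := by
      ext y; simp
    rw [this]
    exact (hF.isCompact x).inter_right
      (isClosed_biInter fun z _ => isClosed_le hc continuous_const)
  nonempty x := by
    obtain ⟨y, hy, hmin⟩ := (hF.isCompact x).exists_isMinOn (hF.nonempty x) hc.continuousOn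
    exact ⟨y, hy, fun z hz => hmin hz⟩
  measurableSet C hC := by
    have key : {x | ({y ∈ F x | ∀ z ∈ F x, c y ≤ c z} ∩ C).Nonempty} =
        {x | (F x ∩ C).Nonempty} ∩ ⋂ r : ℚ, ({x | (F x ∩ {y | c y ≤ (r : ℝ)}).Nonempty}ᶜ ∪
          {x | (F x ∩ (C ∩ {y | c y ≤ (r : ℝ)})).Nonempty}) := by
      ext x
      simp only [Set.mem_ofPred_eq, Set.mem_inter_iff, Set.mem_iInter, Set.mem_union,
        Set.mem_compl_iff]
      constructor
      · rintro ⟨y, ⟨hy, hmin⟩, hyC⟩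
        refine ⟨⟨y, hy, hyC⟩, fun r => ?_⟩
        by_cases h : (F x ∩ {y | c y ≤ (r : ℝ)}).Nonempty
        · obtain ⟨z, hz, hzr⟩ := h
          exact Or.inr ⟨y, hy, hyC, (hmin z hz).trans hzr⟩
        · exact Or.inl h
      · rintro ⟨hne, h⟩
        obtain ⟨y, ⟨hy, hyC⟩, hmin⟩ :=
          ((hF.isCompact x).inter_right hC).exists_isMinOn hne hc.continuousOn
        refine ⟨y, ⟨hy, fun z hz => ?_⟩, hyC⟩
        by_contra! hlt
        obtain ⟨r, hr1, hr2⟩ := exists_rat_btwn hlt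
        rcases h r with h | ⟨w, hw, hwC, hwr⟩
        · exact h ⟨z, hz, hr1.le⟩
        · have : c y ≤ c w := hmin ⟨hw, hwC⟩
          have : c w ≤ (r : ℝ) := hwr
          linarith
    rw [key]
    refine (hF.measurableSet C hC).inter (MeasurableSet.iInter fun r => ?_)
    have hcl : IsClosed {y | c y ≤ (r : ℝ)} := isClosed_le hc continuous_const
    exact (hF.measurableSet _ hcl).compl.union (hF.measurableSet _ (hC.inter hcl))

/-- A measurable correspondence has a selection along which finitely many coordinate functions are
measurable, provided these separate points. -/
theorem IsMeasurableCorrespondence.exists_selection {J : Type*} [Finite J] {F : X → Set Y}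
    (hF : IsMeasurableCorrespondence F) (c : J → Y → ℝ) (hc : ∀ j, Continuous (c j))
    (hsep : ∀ y z, (∀ j, c j y = c j z) → y = z) :
    ∃ s : X → Y, (∀ x, s x ∈ F x) ∧ ∀ j, Measurable fun x => c j (s x) := by
  classical
  have := Fintype.ofFinite J
  -- Lexicographic minimization: minimizing one coordinate after another leaves a correspondence on
  -- which all coordinates are constant. As they separate points, its values are singletons, and a
  -- sublevel event of a coordinate is a hitting event.
  have key : ∀ S : Finset J, ∃ F' : X → Set Y, IsMeasurableCorrespondence F' ∧
      (∀ x, F' x ⊆ F x) ∧ ∀ x, ∀ y ∈ F' x, ∀ z ∈ F' x, ∀ j ∈ S, c j y = c j z := by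
    intro S
    induction S using Finset.induction_on with
    | empty => exact ⟨F, hF, fun _ => subset_rfl, by simp⟩
    | insert a S _ ih =>
      obtain ⟨F', hF', hsub, heq⟩ := ih
      refine ⟨_, hF'.argmin (hc a), fun x => (Set.sep_subset _ _).trans (hsub x), ?_⟩
      rintro x y ⟨hy, hy'⟩ z ⟨hz, hz'⟩ j hj
      rcases Finset.mem_insert.1 hj with rfl | hj
      · exact le_antisymm (hy' z hz) (hz' y hy)
      · exact heq x y hy z hz j hj
  obtain ⟨F', hF', hsub, heq⟩ := key Finset.univ
  choose s hs using hF'.nonempty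
  refine ⟨s, fun x => hsub x (hs x), fun j => measurable_of_Iic fun r => ?_⟩
  have : (fun x => c j (s x)) ⁻¹' Set.Iic r = {x | (F' x ∩ {y | c j y ≤ r}).Nonempty} := by
    ext x
    constructor
    · exact fun h => ⟨s x, hs x, h⟩
    · rintro ⟨y, hy, hyr⟩
      have : y = s x := hsep _ _ fun j => heq x y hy _ (hs x) j (Finset.mem_univ j)
      change c j (s x) ≤ r
      rw [← this]
      exact hyr
  rw [this]
  exact hF'.measurableSet _ (isClosed_le (hc j) continuous_const)

/-- The minimum of `f x` over a fixed compact set is continuous in `x`, so comparing the minima over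
`K ∩ C` and over `K` is a measurable condition on `x`. -/
theorem isMeasurableCorrespondence_argmin [TopologicalSpace X] [OpensMeasurableSpace X]
    [T2Space Y] {K : Set Y} (hK : IsCompact K) (hne : K.Nonempty) {f : X → Y → ℝ}
    (hf : Continuous ↿f) :
    IsMeasurableCorrespondence fun x => {y ∈ K | ∀ z ∈ K, f x y ≤ f x z} := by
  have hfx : ∀ x, Continuous (f x) := fun x => hf.comp (by fun_prop : Continuous fun y => (x, y))
  have hset : ∀ x, {y ∈ K | ∀ z ∈ K, f x y ≤ f x z} = K ∩ ⋂ z ∈ K, {y | f x y ≤ f x z} := by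
    intro x; ext y; simp
  have hcl : ∀ x, IsClosed (⋂ z ∈ K, {y | f x y ≤ f x z}) := fun x =>
    isClosed_biInter fun z _ => isClosed_le (hfx x) continuous_const
  refine ⟨fun x => ?_, fun x => ?_, fun x => ?_, fun C hC => ?_⟩
  · rw [hset]; exact hK.inter_right (hcl x)
  · rw [hset]; exact hK.isClosed.inter (hcl x)
  · obtain ⟨y, hy, hmin⟩ := hK.exists_isMinOn hne (hfx x).continuousOn
    exact ⟨y, hy, fun z hz => hmin hz⟩
  · rcases (K ∩ C).eq_empty_or_nonempty with he | hn
    · have : {x | ({y ∈ K | ∀ z ∈ K, f x y ≤ f x z} ∩ C).Nonempty} = ∅ := by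
        rw [Set.eq_empty_iff_forall_notMem]
        rintro x ⟨y, ⟨hy, _⟩, hyC⟩
        exact Set.notMem_empty y (he ▸ ⟨hy, hyC⟩)
      rw [this]
      exact MeasurableSet.empty
    · have hKC : IsCompact (K ∩ C) := hK.inter_right hC
      have : {x | ({y ∈ K | ∀ z ∈ K, f x y ≤ f x z} ∩ C).Nonempty} =
          {x | sInf (f x '' (K ∩ C)) ≤ sInf (f x '' K)} := by
        ext x
        have hbdd : BddBelow (f x '' K) := (hK.image (hfx x)).bddBelow
        constructor
        · rintro ⟨y, ⟨hy, hmin⟩, hyC⟩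
          change sInf (f x '' (K ∩ C)) ≤ sInf (f x '' K)
          refine le_csInf (hne.image _) ?_
          rintro _ ⟨z, hz, rfl⟩
          exact (csInf_le (hbdd.mono (Set.image_mono Set.inter_subset_left))
            ⟨y, ⟨hy, hyC⟩, rfl⟩).trans (hmin z hz)
        · intro h
          obtain ⟨y, hy, hmin⟩ := hKC.exists_isMinOn hn (hfx x).continuousOn
          refine ⟨y, ⟨hy.1, fun z hz => ?_⟩, hy.2⟩
          have hle : sInf (f x '' (K ∩ C)) ≤ f x z := le_trans h (csInf_le hbdd (Set.mem_image_of_mem _ hz))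
          refine le_trans ?_ hle
          refine le_csInf (hn.image (f x)) ?_
          rintro _ ⟨w, hw, rfl⟩
          exact hmin hw
      rw [this]
      have := (hKC.continuous_sInf hf).measurable
      have := (hK.continuous_sInf hf).measurable
      exact measurableSet_le ‹Measurable fun x => sInf (f x '' (K ∩ C))› this

end Selection

/-! ### The orthogonal Procrustes problem -/

theorem isCompact_orthogonalGroup (k : ℕ) :
    IsCompact {W : Matrix (Fin k) (Fin k) ℝ | W ∈ Matrix.orthogonalGroup (Fin k) ℝ} := by
  have hcl : IsClosed {W : Matrix (Fin k) (Fin k) ℝ | W ∈ Matrix.orthogonalGroup (Fin k) ℝ} := by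
    have : {W : Matrix (Fin k) (Fin k) ℝ | W ∈ Matrix.orthogonalGroup (Fin k) ℝ} =
        {W | W * Wᵀ = 1} := by
      ext W; exact Matrix.mem_orthogonalGroup_iff _ _
    rw [this]
    exact isClosed_eq (by fun_prop) continuous_const
  have hb : IsCompact (Set.univ.pi fun _ : Fin k => Set.univ.pi fun _ : Fin k =>
      Set.Icc (-1 : ℝ) 1) := isCompact_univ_pi fun _ => isCompact_univ_pi fun _ => isCompact_Icc
  refine hb.of_isClosed_subset hcl fun W hW => ?_
  intro i _ j _
  have := entry_norm_bound_of_unitary (𝕜 := ℝ) hW i j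
  rw [Real.norm_eq_abs, abs_le] at this
  exact this

/-- The orthogonal Procrustes problem has a measurable solution. -/
theorem exists_measurable_procrustes {Ω : Type*} [MeasurableSpace Ω] {n k : ℕ}
    (U : Matrix (Fin n) (Fin k) ℝ) (Uh : Ω → Matrix (Fin n) (Fin k) ℝ)
    (hUh : ∀ i j, Measurable fun ω => Uh ω i j) :
    ∃ W : Ω → Matrix (Fin k) (Fin k) ℝ, (∀ i j, Measurable fun ω => W ω i j) ∧
      ∀ ω, IsProcrustes (Uh ω) U (W ω) := by
  have hf : Continuous ↿(fun (A : Fin n → Fin k → ℝ) (W : Matrix (Fin k) (Fin k) ℝ) =>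
      frobNorm (Matrix.of A - U * W)) := by
    change Continuous fun p : (Fin n → Fin k → ℝ) × Matrix (Fin k) (Fin k) ℝ =>
      √(∑ i, ∑ j, (Matrix.of p.1 - U * p.2) i j ^ 2)
    simp only [Matrix.sub_apply, Matrix.of_apply, Matrix.mul_apply]
    fun_prop
  have hcor := isMeasurableCorrespondence_argmin (isCompact_orthogonalGroup k) ⟨1, one_mem (Matrix.orthogonalGroup (Fin k) ℝ)⟩ hf
  obtain ⟨s, hs, hm⟩ := hcor.exists_selection (fun (p : Fin k × Fin k) W => W p.1 p.2)
    (fun p => by fun_prop) (fun y z h => by ext i j; exact h (i, j))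
  have hmU : Measurable fun ω => (fun i j => Uh ω i j : Fin n → Fin k → ℝ) :=
    measurable_pi_lambda _ fun i => measurable_pi_lambda _ fun j => hUh i j
  exact ⟨fun ω => s fun i j => Uh ω i j, fun i j => (hm (i, j)).comp hmU,
    fun ω => ⟨(hs _).1, fun W' hW' => (hs (fun i j => Uh ω i j)).2 W' hW'⟩⟩

theorem frobNorm_sq {m n : ℕ} (A : Matrix (Fin m) (Fin n) ℝ) :
    frobNorm A ^ 2 = (Aᵀ * A).trace := by
  rw [frobNorm, Real.sq_sqrt (by positivity), Finset.sum_comm]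
  simp [Matrix.trace, Matrix.mul_apply, sq]

theorem frobNorm_nonneg {m n : ℕ} (A : Matrix (Fin m) (Fin n) ℝ) : 0 ≤ frobNorm A :=
  Real.sqrt_nonneg _

theorem norm_le_frobNorm {m n : ℕ} (A : Matrix (Fin m) (Fin n) ℝ) : ‖A‖ ≤ frobNorm A := by
  refine (norm_le_frob A).trans (le_of_eq ?_)
  rw [frobNorm]
  congr 1
  refine Finset.sum_congr rfl fun i _ => ?_
  rw [rowNorm_eq_sqrt, Real.sq_sqrt (by positivity)]

theorem frobNorm_le_sqrt_mul_norm {m n : ℕ} (A : Matrix (Fin m) (Fin n) ℝ) :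
    frobNorm A ≤ √m * ‖A‖ := by
  rw [frobNorm, ← Real.sqrt_sq (norm_nonneg A), ← Real.sqrt_mul (by positivity)]
  refine Real.sqrt_le_sqrt ?_
  calc ∑ i, ∑ j, A i j ^ 2 ≤ ∑ _i : Fin m, ‖A‖ ^ 2 := by
        refine Finset.sum_le_sum fun i _ => ?_
        have := pow_le_pow_left₀ (rowNorm_nonneg _ _) (rowNorm_le_norm A i) 2
        rwa [rowNorm_eq_sqrt, Real.sq_sqrt (by positivity)] at this
    _ = _ := by simp

theorem frobNorm_mul_orthogonal {m n : ℕ} (A : Matrix (Fin m) (Fin n) ℝ)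
    (O : Matrix (Fin n) (Fin n) ℝ) (hO : O * Oᵀ = 1) : frobNorm (A * O) = frobNorm A := by
  rw [← sq_eq_sq₀ (frobNorm_nonneg _) (frobNorm_nonneg _), frobNorm_sq, frobNorm_sq, transpose_mul,
    Matrix.mul_assoc, Matrix.trace_mul_comm, Matrix.mul_assoc, Matrix.mul_assoc, hO,
    Matrix.mul_one]

/-- The cross terms agree, and what remains is independent of `W`. The Procrustes problem is
therefore the search for an orthogonal matrix nearest to the square matrix `Uᵀ * Uh`. -/
theorem frobNorm_sub_procrustes_sq {n k : ℕ} {Uh U : Matrix (Fin n) (Fin k) ℝ}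
    (hU : Uᵀ * U = 1) {W : Matrix (Fin k) (Fin k) ℝ} (hW : Wᵀ * W = 1) :
    frobNorm (Uh - U * W) ^ 2 - frobNorm (Uᵀ * Uh - W) ^ 2 =
      (Uhᵀ * Uh).trace - ((Uᵀ * Uh)ᵀ * (Uᵀ * Uh)).trace := by
  rw [frobNorm_sq, frobNorm_sq]
  have h1 : (U * W)ᵀ * (U * W) = 1 := by
    rw [transpose_mul, Matrix.mul_assoc, ← Matrix.mul_assoc Uᵀ, hU, Matrix.one_mul, hW]
  have h2 : (U * W)ᵀ * Uh = Wᵀ * (Uᵀ * Uh) := by rw [transpose_mul, Matrix.mul_assoc]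
  have h3 : Uhᵀ * (U * W) = (Uᵀ * Uh)ᵀ * W := by
    rw [transpose_mul, transpose_transpose, Matrix.mul_assoc]
  simp only [transpose_sub, Matrix.sub_mul, Matrix.mul_sub, Matrix.trace_sub, h1, h2, h3, hW]
  ring

/-- A square matrix that is nearly orthogonal is close to an orthogonal matrix. -/
theorem exists_orthogonal_frobNorm_sub_le {k : ℕ} (P : Matrix (Fin k) (Fin k) ℝ)
    (h : ‖Pᵀ * P - 1‖ < 1) :
    ∃ W ∈ Matrix.orthogonalGroup (Fin k) ℝ, frobNorm (P - W) ≤ frobNorm (Pᵀ * P - 1) := by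
  have hH : (Pᵀ * P).IsHermitian := by
    rw [Matrix.IsHermitian, conjTranspose_eq_transpose_of_trivial, transpose_mul,
      transpose_transpose]
  set O : Matrix (Fin k) (Fin k) ℝ := (hH.eigenvectorUnitary : Matrix (Fin k) (Fin k) ℝ) with hO
  set d := hH.eigenvalues with hd
  have hO1 : Oᵀ * O = 1 := by
    have := Unitary.coe_star_mul_self hH.eigenvectorUnitary
    rwa [star_eq_conjTranspose, conjTranspose_eq_transpose_of_trivial] at this
  have hO2 : O * Oᵀ = 1 := mul_eq_one_comm.1 hO1
  have hspec : Oᵀ * (Pᵀ * P) * O = diagonal d := by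
    have hs := hH.spectral_theorem
    rw [Unitary.conjStarAlgAut_apply, star_eq_conjTranspose,
      conjTranspose_eq_transpose_of_trivial] at hs
    have : Pᵀ * P = O * diagonal d * Oᵀ := hs
    rw [this]
    calc Oᵀ * (O * diagonal d * Oᵀ) * O = (Oᵀ * O) * diagonal d * (Oᵀ * O) := by
          simp only [Matrix.mul_assoc]
      _ = diagonal d := by rw [hO1, Matrix.one_mul, Matrix.mul_one]
  have hspec1 : Oᵀ * (Pᵀ * P - 1) * O = diagonal fun j => d j - 1 := by
    rw [Matrix.mul_sub, Matrix.sub_mul, hspec, Matrix.mul_one, hO1]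
    ext i j
    by_cases hij : i = j
    · subst hij; simp
    · simp [hij]
  have hOn : ‖O‖ ≤ 1 := norm_le_one_of_orthonormal hO1
  have hOtn : ‖Oᵀ‖ ≤ 1 := by rwa [norm_transpose_eq]
  have hdpos : ∀ j, 0 < d j := by
    intro j
    have h1 : ‖Oᵀ * (Pᵀ * P - 1) * O‖ < 1 := by
      refine lt_of_le_of_lt (norm_mul_le_of_le (norm_mul_le_of_le hOtn le_rfl) hOn) ?_
      linarith
    have h2 := (abs_entry_le_norm (Oᵀ * (Pᵀ * P - 1) * O) j j).trans_lt h1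
    rw [hspec1, diagonal_apply_eq, abs_lt] at h2
    linarith
  -- The orthogonal matrix sought is the polar factor `P * (Pᵀ * P) ^ (-1/2)`, with the inverse
  -- square root formed in the eigenbasis `O`.
  set r : Fin k → ℝ := fun j => (√(d j))⁻¹ with hr
  have hdr : ∀ j, r j * d j * r j = 1 := by
    intro j
    have hs := Real.sqrt_pos.2 (hdpos j)
    have : d j = √(d j) * √(d j) := (Real.mul_self_sqrt (hdpos j).le).symm
    rw [hr]
    field_simp
    rw [sq, ← this]
  have hPO : (P * O)ᵀ * (P * O) = diagonal d := by
    rw [← hspec, transpose_mul]; simp only [Matrix.mul_assoc]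
  have hZ : (P * O * diagonal r)ᵀ * (P * O * diagonal r) = 1 := by
    rw [transpose_mul, diagonal_transpose, Matrix.mul_assoc, ← Matrix.mul_assoc _ (P * O), hPO,
      diagonal_mul_diagonal, diagonal_mul_diagonal, ← diagonal_one]
    congr 1
    ext j
    rw [← mul_assoc, hdr]
  refine ⟨P * O * diagonal r * Oᵀ, ?_, ?_⟩
  · rw [Matrix.mem_orthogonalGroup_iff']
    change (P * O * diagonal r * Oᵀ)ᵀ * (P * O * diagonal r * Oᵀ) = 1
    rw [transpose_mul, transpose_transpose, Matrix.mul_assoc, ← Matrix.mul_assoc _ _ Oᵀ, hZ,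
      Matrix.one_mul, hO2]
  · have e1 : frobNorm (P - P * O * diagonal r * Oᵀ) =
        frobNorm (P * O * diagonal fun j => 1 - r j) := by
      rw [← frobNorm_mul_orthogonal _ O hO2, Matrix.sub_mul, Matrix.mul_assoc _ Oᵀ, hO1,
        Matrix.mul_one]
      congr 1
      ext i j
      simp [Matrix.mul_diagonal, mul_sub]
    have e2 : frobNorm (Pᵀ * P - 1) = frobNorm (diagonal fun j => d j - 1) := by
      rw [← frobNorm_mul_orthogonal _ O hO2, ← hspec1]
      rw [← sq_eq_sq₀ (frobNorm_nonneg _) (frobNorm_nonneg _), frobNorm_sq, frobNorm_sq]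
      congr 1
      rw [Matrix.mul_assoc Oᵀ, transpose_mul Oᵀ, transpose_transpose, Matrix.mul_assoc,
        ← Matrix.mul_assoc O, hO2, Matrix.one_mul]
    rw [e1, e2, ← sq_le_sq₀ (frobNorm_nonneg _) (frobNorm_nonneg _), frobNorm_sq, frobNorm_sq,
      transpose_mul, Matrix.mul_assoc, ← Matrix.mul_assoc _ (P * O), hPO, diagonal_transpose,
      diagonal_transpose, diagonal_mul_diagonal, diagonal_mul_diagonal, diagonal_mul_diagonal,
      trace_diagonal, trace_diagonal]
    refine Finset.sum_le_sum fun j _ => ?_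
    have hs := Real.sqrt_pos.2 (hdpos j)
    have hds : d j = √(d j) * √(d j) := (Real.mul_self_sqrt (hdpos j).le).symm
    have h1 : (1 - r j) * (d j * (1 - r j)) = (√(d j) - 1) ^ 2 := by
      rw [hr]
      dsimp only
      set t := √(d j)
      rw [hds]
      field_simp
    rw [h1]
    -- The factor `√(d j) + 1 ≥ 1` shows that the distance to the polar factor is at most the defect
    -- of orthogonality, eigenvalue by eigenvalue.
    have h2 : (d j - 1) * (d j - 1) = (√(d j) - 1) ^ 2 * (√(d j) + 1) ^ 2 := by
      set t := √(d j)
      rw [hds]; ring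
    rw [h2]
    refine le_mul_of_one_le_right (sq_nonneg _) ?_
    nlinarith

/-- A solution of the Procrustes problem is close to `Uᵀ Uhat`. -/
theorem IsProcrustes.norm_sub_le {n k : ℕ} {Uh U : Matrix (Fin n) (Fin k) ℝ}
    {W : Matrix (Fin k) (Fin k) ℝ} (h : IsProcrustes Uh U W) (hU : Uᵀ * U = 1)
    (hUh : Uhᵀ * Uh = 1) :
    ‖Uᵀ * Uh - W‖ ≤ (√k + 2) * ‖(Uᵀ * Uh)ᵀ * (Uᵀ * Uh) - 1‖ := by
  set P := Uᵀ * Uh with hP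
  have hWW : Wᵀ * W = 1 := (Matrix.mem_orthogonalGroup_iff' _ _).1 h.1
  -- Near orthogonality, `W` is compared with the polar factor and `√k` comes from the Frobenius
  -- norm. Otherwise the defect is at least `1` and the trivial bound `‖P - W‖ ≤ 2` accounts for the
  -- summand `2`.
  by_cases hlt : ‖Pᵀ * P - 1‖ < 1
  · obtain ⟨V, hV, hle⟩ := exists_orthogonal_frobNorm_sub_le P hlt
    have hVV : Vᵀ * V = 1 := (Matrix.mem_orthogonalGroup_iff' _ _).1 hV
    have h1 := frobNorm_sub_procrustes_sq (Uh := Uh) hU hWW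
    have h2 := frobNorm_sub_procrustes_sq (Uh := Uh) hU hVV
    have h3 := pow_le_pow_left₀ (frobNorm_nonneg _) (h.2 V hV) 2
    have h4 : frobNorm (P - W) ≤ frobNorm (P - V) := by
      rw [← sq_le_sq₀ (frobNorm_nonneg _) (frobNorm_nonneg _)]
      linarith
    have h5 := frobNorm_le_sqrt_mul_norm (Pᵀ * P - 1)
    have h6 := norm_le_frobNorm (P - W)
    have := norm_nonneg (Pᵀ * P - 1)
    linarith
  · have h1 : ‖P‖ ≤ 1 := by
      have h0 : ‖Uᵀ‖ ≤ 1 := by rw [norm_transpose_eq]; exact norm_le_one_of_orthonormal hU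
      simpa using norm_mul_le_of_le h0 (norm_le_one_of_orthonormal hUh)
    have h2 : ‖W‖ ≤ 1 := norm_le_one_of_orthonormal hWW
    have h3 := _root_.norm_sub_le P W
    have h4 : 0 ≤ √(k : ℝ) := Real.sqrt_nonneg _
    nlinarith

/-! ### Singular values and leading singular vectors -/

/-- Lower bound for a singular value in terms of the transpose on a `k`-dimensional subspace. -/
theorem le_sv_of_le_norm_transpose_mulVec {n q k : ℕ} (hk : 1 ≤ k) (Y : Matrix (Fin n) (Fin q) ℝ)
    (U : Matrix (Fin n) (Fin k) ℝ) (hU : ‖U‖ ≤ 1) (τ : ℝ)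
    (h : ∀ x : Fin k → ℝ, τ * ‖(WithLp.toLp 2 x : EuclideanSpace ℝ (Fin k))‖ ≤
      ‖(WithLp.toLp 2 (Yᵀ *ᵥ (U *ᵥ x)) : EuclideanSpace ℝ (Fin q))‖) :
    τ ≤ sv Y (k - 1) := by
  set T := Matrix.toEuclideanLin Y with hT
  set V := Matrix.toEuclideanLin U with hV
  have hn : Module.finrank ℝ (EuclideanSpace ℝ (Fin q)) = q := by simp
  set b := T.isSymmetric_adjoint_comp_self.eigenvectorBasis hn with hb
  set s := sv Y (k - 1) with hs
  have hs0 : 0 ≤ s := T.singularValues_nonneg _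
  -- Courant-Fischer by dimension count: the leading `k - 1` right singular directions impose fewer
  -- than `k` conditions, so some `x ≠ 0` makes `w = Yᵀ U x` orthogonal to all of them. Then `‖T w‖
  -- ≤ s * ‖w‖`, and pairing `T w` with `U x` gives `τ * ‖x‖ ≤ ‖w‖ ≤ s * ‖x‖`.
  let J := {j : Fin q // (j : ℕ) < k - 1}
  let φ : EuclideanSpace ℝ (Fin k) →ₗ[ℝ] (J → ℝ) :=
    LinearMap.pi fun j => (innerₛₗ ℝ (b j)) ∘ₗ (LinearMap.adjoint T) ∘ₗ V
  have hcard : Fintype.card J ≤ k - 1 := by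
    have : Function.Injective fun j : J => (⟨j.1, j.2⟩ : Fin (k - 1)) := by
      intro i j hij
      simp only [Fin.mk.injEq] at hij
      exact Subtype.ext (Fin.ext hij)
    simpa using Fintype.card_le_of_injective _ this
  have hker : LinearMap.ker φ ≠ ⊥ := by
    apply LinearMap.ker_ne_bot_of_finrank_lt
    rw [Module.finrank_fintype_fun_eq_card, finrank_euclideanSpace, Fintype.card_fin]
    omega
  obtain ⟨x, hx, hx0⟩ := (Submodule.ne_bot_iff _).1 hker
  set w := LinearMap.adjoint T (V x) with hw
  have hw0 : ∀ j : Fin q, (j : ℕ) < k - 1 → inner ℝ (b j) w = 0 := fun j hj =>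
    congrFun (LinearMap.mem_ker.1 hx) ⟨j, hj⟩
  have hTw : ‖T w‖ ^ 2 ≤ (s * ‖w‖) ^ 2 := by
    have e1 : ‖T w‖ ^ 2 = inner ℝ w ((LinearMap.adjoint T ∘ₗ T) w) := by
      rw [LinearMap.comp_apply, LinearMap.adjoint_inner_right, real_inner_self_eq_norm_sq]
    have e2 : inner ℝ w ((LinearMap.adjoint T ∘ₗ T) w) =
        ∑ j : Fin q, sv Y j ^ 2 * inner ℝ (b j) w ^ 2 := by
      rw [← b.sum_inner_mul_inner]
      refine Finset.sum_congr rfl fun j _ => ?_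
      have h1 := T.isSymmetric_adjoint_comp_self (b j) w
      have h2 := T.isSymmetric_adjoint_comp_self.apply_eigenvectorBasis hn j
      rw [← hb] at h2
      rw [← h1, h2, sv, T.sq_singularValues_fin hn]
      simp only [RCLike.ofReal_real_eq_id, id, inner_smul_left, conj_trivial]
      rw [real_inner_comm (b j) w]
      ring
    rw [e1, e2, mul_pow, ← b.sum_sq_inner_right w, Finset.mul_sum]
    refine Finset.sum_le_sum fun j _ => ?_
    by_cases hj : (j : ℕ) < k - 1
    · simp [hw0 j hj]
    · have : sv Y j ≤ s := T.singularValues_antitone (by omega)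
      have h0 : 0 ≤ sv Y j := T.singularValues_nonneg _
      gcongr
  have hTw' : ‖T w‖ ≤ s * ‖w‖ := le_of_sq_le_sq hTw (by positivity)
  have hVx : ‖V x‖ ≤ ‖x‖ := by
    refine (norm_mulVec_le U x.ofLp).trans ?_
    exact mul_le_of_le_one_left (norm_nonneg x) hU
  have hww : ‖w‖ ^ 2 ≤ s * ‖w‖ * ‖x‖ := by
    have : ‖w‖ ^ 2 = inner ℝ (T w) (V x) := by
      rw [← real_inner_self_eq_norm_sq]
      conv_lhs => rw [hw]
      rw [LinearMap.adjoint_inner_left, real_inner_comm]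
    rw [this]
    refine (real_inner_le_norm _ _).trans ?_
    gcongr
  have hadj : w = WithLp.toLp 2 (Yᵀ *ᵥ (U *ᵥ x.ofLp)) := by
    rw [hw, hT, ← Matrix.toEuclideanLin_conjTranspose_eq_adjoint,
      conjTranspose_eq_transpose_of_trivial]
    rfl
  have hxw : τ * ‖x‖ ≤ ‖w‖ := by rw [hadj]; exact h x.ofLp
  have hxpos : 0 < ‖x‖ := norm_pos_iff.2 hx0
  rcases (norm_nonneg w).eq_or_lt with hwz | hwpos
  · rw [← hwz] at hxw
    nlinarith
  · have : ‖w‖ ≤ s * ‖x‖ := by nlinarith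
    nlinarith

theorem IsLeadingLeftSingular.transpose_mul_self {n q k : ℕ} {Y : Matrix (Fin n) (Fin q) ℝ}
    {Uh : Matrix (Fin n) (Fin k) ℝ} (h : IsLeadingLeftSingular Y Uh) : Uhᵀ * Uh = 1 := by
  obtain ⟨hkn, A, hA, B, hB, hY, rfl⟩ := h
  have hAA : Aᵀ * A = 1 := (Matrix.mem_orthogonalGroup_iff' _ _).1 hA
  ext i j
  have := congrFun (congrFun hAA (Fin.castLE hkn i)) (Fin.castLE hkn j)
  rw [Matrix.mul_apply] at this ⊢
  simpa [Matrix.one_apply] using this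

/-- Leading left singular vectors are obtained from the matrix by multiplication from the right by
a matrix of controlled norm. -/
theorem IsLeadingLeftSingular.exists_eq_mul {n q k : ℕ} (hkq : k ≤ q)
    {Y : Matrix (Fin n) (Fin q) ℝ} {Uh : Matrix (Fin n) (Fin k) ℝ}
    (h : IsLeadingLeftSingular Y Uh) {τ : ℝ} (hτ : 0 < τ) (hsv : τ ≤ sv Y (k - 1)) :
    ∃ R : Matrix (Fin q) (Fin k) ℝ, Uh = Y * R ∧ ‖R‖ ≤ τ⁻¹ := by
  obtain ⟨hkn, A, hA, B, hB, hY, rfl⟩ := h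
  have hBB : Bᵀ * B = 1 := (Matrix.mem_orthogonalGroup_iff' _ _).1 hB
  have hsvj : ∀ j : Fin k, τ ≤ sv Y j := fun j =>
    hsv.trans ((Matrix.toEuclideanLin Y).singularValues_antitone (by omega))
  set Bk : Matrix (Fin q) (Fin k) ℝ := Matrix.of fun t j => B t (Fin.castLE hkq j) with hBk
  have hBk1 : Bkᵀ * Bk = 1 := by
    ext i j
    have := congrFun (congrFun hBB (Fin.castLE hkq i)) (Fin.castLE hkq j)
    rw [Matrix.mul_apply] at this ⊢
    simpa [hBk, Matrix.one_apply] using this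
  -- From `Y * B = A * Σ`, the leading columns of `A` result on dividing by the leading singular
  -- values, all of which are at least `τ`.
  refine ⟨Bk * diagonal fun j : Fin k => (sv Y j)⁻¹, ?_, ?_⟩
  · have hYB : Y * B = A * (Matrix.of fun (i : Fin n) (j : Fin q) =>
        if (i : ℕ) = (j : ℕ) then sv Y i else 0) := by
      conv_lhs => rw [hY]
      rw [Matrix.mul_assoc, hBB, Matrix.mul_one]
    ext i j
    have hij := congrFun (congrFun hYB i) (Fin.castLE hkq j)
    have h1 : (Y * Bk) i j = (Y * B) i (Fin.castLE hkq j) := by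
      simp [Matrix.mul_apply, hBk]
    rw [← Matrix.mul_assoc, Matrix.mul_diagonal, h1, hij, Matrix.mul_apply]
    rw [Finset.sum_eq_single (Fin.castLE hkn j)]
    · have : sv Y j ≠ 0 := (hτ.trans_le (hsvj j)).ne'
      simp [this]
    · intro l _ hl
      have : (l : ℕ) ≠ j := fun hlj => hl (Fin.ext hlj)
      simp [this]
    · simp
  · have hd : ‖(diagonal fun j : Fin k => (sv Y j)⁻¹ : Matrix (Fin k) (Fin k) ℝ)‖ ≤ τ⁻¹ := by
      rw [l2_opNorm_diagonal, pi_norm_le_iff_of_nonneg (by positivity)]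
      intro j
      have := hsvj j
      rw [Real.norm_eq_abs, abs_of_nonneg (inv_nonneg.2 (hτ.le.trans this))]
      gcongr
    simpa using norm_mul_le_of_le (norm_le_one_of_orthonormal hBk1) hd

/-! ### Gaussian vectors and their tails -/

/-- The law of a family of independent standard normal variables. -/
noncomputable def gaussPi (ι : Type*) [Fintype ι] : Measure (ι → ℝ) :=
  Measure.pi fun _ => gaussianReal 0 1

instance gaussPi_isProbabilityMeasure (ι : Type*) [Fintype ι] :
    IsProbabilityMeasure (gaussPi ι) := by
  unfold gaussPi; infer_instance

/-- The characteristic function of the standard Gaussian depends only on the norm of its argument,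
and `Aᵀ` is an isometry. All linear images of the sketches are handled by exhibiting a matrix with
orthonormal rows. -/
theorem gaussPi_map_mulVec {ι κ : Type*} [Fintype ι] [Fintype κ] [DecidableEq κ]
    (A : Matrix κ ι ℝ) (hA : A * Aᵀ = 1) :
    (gaussPi ι).map (fun x => A *ᵥ x) = gaussPi κ := by
  have hAm : Measurable fun x : ι → ℝ => A *ᵥ x := by
    refine measurable_pi_lambda _ fun i => ?_
    simp only [mulVec, dotProduct]
    fun_prop
  have hm : Measurable (WithLp.toLp 2 : (κ → ℝ) → EuclideanSpace ℝ κ) :=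
    (MeasurableEquiv.toLp 2 (κ → ℝ)).measurable
  have hm' : Measurable (WithLp.toLp 2 : (ι → ℝ) → EuclideanSpace ℝ ι) :=
    (MeasurableEquiv.toLp 2 (ι → ℝ)).measurable
  have hinj : ((gaussPi ι).map (fun x => A *ᵥ x)).map (MeasurableEquiv.toLp 2 (κ → ℝ)) =
      (gaussPi κ).map (MeasurableEquiv.toLp 2 (κ → ℝ)) := by
    change ((gaussPi ι).map (fun x => A *ᵥ x)).map (WithLp.toLp 2) =
      (gaussPi κ).map (WithLp.toLp 2)
    rw [gaussPi, gaussPi, map_pi_eq_stdGaussian, Measure.map_map hm hAm]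
    have : IsProbabilityMeasure ((Measure.pi fun _ : ι => gaussianReal 0 1).map
        ((WithLp.toLp 2 : (κ → ℝ) → EuclideanSpace ℝ κ) ∘ fun x => A *ᵥ x)) :=
      Measure.isProbabilityMeasure_map
        (hm.comp hAm).aemeasurable
    apply Measure.ext_of_charFun (E := EuclideanSpace ℝ κ)
    ext t
    have h1 : charFun ((Measure.pi fun _ : ι => gaussianReal 0 1).map
        ((WithLp.toLp 2 : (κ → ℝ) → EuclideanSpace ℝ κ) ∘ fun x => A *ᵥ x)) t =
        charFun ((Measure.pi fun _ : ι => gaussianReal 0 1).map (WithLp.toLp 2))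
          (WithLp.toLp 2 (Aᵀ *ᵥ t.ofLp)) := by
      rw [charFun_apply, charFun_apply, integral_map
        (hm.comp hAm).aemeasurable
          (Measurable.aestronglyMeasurable (by fun_prop)),
        integral_map hm'.aemeasurable
          (Measurable.aestronglyMeasurable (by fun_prop))]
      refine integral_congr_ae (ae_of_all _ fun x => ?_)
      simp only [Function.comp_apply, EuclideanSpace.inner_eq_star_dotProduct, star_trivial]
      rw [dotProduct_mulVec, ← mulVec_transpose]
    rw [h1, map_pi_eq_stdGaussian, charFun_stdGaussian, charFun_stdGaussian]
    have h2 : ‖(WithLp.toLp 2 (Aᵀ *ᵥ t.ofLp) : EuclideanSpace ℝ ι)‖ ^ 2 = ‖t‖ ^ 2 := by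
      rw [EuclideanSpace.real_norm_sq_eq, EuclideanSpace.real_norm_sq_eq]
      have : (Aᵀ *ᵥ t.ofLp) ⬝ᵥ (Aᵀ *ᵥ t.ofLp) = t.ofLp ⬝ᵥ t.ofLp := by
        rw [dotProduct_mulVec, vecMul_transpose, mulVec_mulVec, hA, one_mulVec]
      simpa [dotProduct, sq] using this
    have h3 : ((‖(WithLp.toLp 2 (Aᵀ *ᵥ t.ofLp) : EuclideanSpace ℝ ι)‖ : ℂ)) ^ 2 =
        (‖t‖ : ℂ) ^ 2 := by exact_mod_cast h2
    rw [h3]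
  exact (MeasurableEquiv.toLp 2 (κ → ℝ)).map_measurableEquiv_injective hinj

theorem gaussPi_map_curry (α β : Type*) [Fintype α] [Fintype β] :
    (gaussPi (α × β)).map (fun x a b => x (a, b)) = Measure.pi fun _ : α => gaussPi β := by
  let e : (α × β → ℝ) ≃ᵐ (α → β → ℝ) := MeasurableEquiv.curry α β ℝ
  have h : (Measure.pi fun _ : α => gaussPi β).map e.symm = gaussPi (α × β) := by
    refine (Measure.pi_eq fun s hs => ?_).symm
    rw [e.symm.map_apply]
    have : e.symm ⁻¹' (Set.univ.pi s) = Set.univ.pi fun a => Set.univ.pi fun b => s (a, b) := by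
      ext x
      simp only [Set.mem_preimage, Set.mem_univ_pi, Prod.forall]
      rfl
    rw [this, Measure.pi_pi, Fintype.prod_prod_type]
    refine Finset.prod_congr rfl fun a _ => ?_
    rw [gaussPi, Measure.pi_pi]
  change (gaussPi (α × β)).map e = _
  rw [← h, Measure.map_map e.measurable e.symm.measurable]
  simp

/-- The exponent `1 / 4` is half the critical value `1 / 2`; it gives the exponential moment for the
Chernoff bound on the chi-square tail. -/
theorem integrable_exp_sq_gaussianReal :
    Integrable (fun x : ℝ => Real.exp (x ^ 2 / 4)) (gaussianReal 0 1) ∧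
      ∫ x, Real.exp (x ^ 2 / 4) ∂(gaussianReal 0 1) = √2 := by
  have h0 : ∀ x : ℝ, gaussianPDFReal 0 1 x • Real.exp (x ^ 2 / 4) =
      (√(2 * Real.pi))⁻¹ * Real.exp (-(1 / 4) * x ^ 2) := by
    intro x
    rw [gaussianPDFReal, smul_eq_mul, mul_assoc, ← Real.exp_add]
    simp only [NNReal.coe_one, mul_one, sub_zero]
    congr 2
    ring
  constructor
  · rw [gaussianReal_of_var_ne_zero _ one_ne_zero]
    have hpdf : gaussianPDF 0 1 = fun x => ENNReal.ofReal (gaussianPDFReal 0 1 x) := rfl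
    rw [hpdf, integrable_withDensity_iff_integrable_smul₀' (by fun_prop) (by simp)]
    have : (fun x : ℝ => (ENNReal.ofReal (gaussianPDFReal 0 1 x)).toReal • Real.exp (x ^ 2 / 4)) =
        fun x => (√(2 * Real.pi))⁻¹ * Real.exp (-(1 / 4) * x ^ 2) := by
      ext x
      rw [ENNReal.toReal_ofReal (gaussianPDFReal_nonneg _ _ _), h0]
    rw [this]
    exact (integrable_exp_neg_mul_sq (by norm_num)).const_mul _
  · rw [integral_gaussianReal_eq_integral_smul one_ne_zero]
    simp_rw [h0]
    rw [integral_const_mul, integral_gaussian, inv_mul_eq_div, ← Real.sqrt_div (by positivity)]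
    congr 1
    have := Real.pi_pos
    field_simp
    norm_num

/-- Upper tail of the chi-square distribution. -/
theorem gaussPi_sum_sq_tail (q : ℕ) (s : ℝ) :
    gaussPi (Fin q) {x | s < ∑ t, x t ^ 2} ≤ ENNReal.ofReal (Real.exp (q / 2 - s / 4)) := by
  obtain ⟨hint, hval⟩ := integrable_exp_sq_gaussianReal
  have hI : Integrable (fun x : Fin q → ℝ => ∏ t, Real.exp (x t ^ 2 / 4)) (gaussPi (Fin q)) :=
    Integrable.fintype_prod (f := fun _ : Fin q => fun x : ℝ => Real.exp (x ^ 2 / 4)) fun _ => hint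
  have hE : ∫ x : Fin q → ℝ, ∏ t, Real.exp (x t ^ 2 / 4) ∂(gaussPi (Fin q)) = √2 ^ q := by
    rw [gaussPi, integral_fintype_prod_eq_prod (𝕜 := ℝ) (f := fun (_ : Fin q) (x : ℝ) =>
      Real.exp (x ^ 2 / 4))]
    simp [hval]
  have hmarkov := mul_meas_ge_le_integral_of_nonneg (μ := gaussPi (Fin q))
    (ae_of_all _ fun x => Finset.prod_nonneg fun t _ => (Real.exp_pos (x t ^ 2 / 4)).le) hI
    (Real.exp (s / 4))
  rw [hE] at hmarkov
  have h2 : √2 ≤ Real.exp (1 / 2) := by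
    rw [Real.sqrt_le_left (Real.exp_pos _).le, ← Real.exp_nat_mul]
    have := Real.add_one_le_exp (1 : ℝ)
    norm_num
    linarith
  have h3 : √2 ^ q ≤ Real.exp (q / 2) := by
    refine (pow_le_pow_left₀ (Real.sqrt_nonneg _) h2 q).trans (le_of_eq ?_)
    rw [← Real.exp_nat_mul]
    congr 1; ring
  have hsub : {x : Fin q → ℝ | s < ∑ t, x t ^ 2} ⊆
      {x | Real.exp (s / 4) ≤ ∏ t, Real.exp (x t ^ 2 / 4)} := by
    intro x hx
    change Real.exp (s / 4) ≤ ∏ t, Real.exp (x t ^ 2 / 4)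
    rw [← Real.exp_sum, ← Finset.sum_div]
    have : s < ∑ t, x t ^ 2 := hx
    gcongr
  refine (measure_mono hsub).trans ?_
  rw [← ofReal_measureReal]
  refine ENNReal.ofReal_le_ofReal ?_
  rw [Real.exp_sub, le_div_iff₀ (Real.exp_pos _)]
  linarith

/-- Uniform tail bound for a linear combination of the rows of a Gaussian sketch. -/
theorem gaussPi_sketch_tail {N n q : ℕ} (y : Fin n → ℝ) (b : Fin N) (s : ℝ) :
    gaussPi (Fin N × Fin n × Fin q)
      {x | s * ∑ i, y i ^ 2 < ∑ t, (∑ i, y i * x (b, i, t)) ^ 2} ≤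
      ENNReal.ofReal (Real.exp (q / 2 - s / 4)) := by
  rcases (Finset.sum_nonneg fun i _ => sq_nonneg (y i) : 0 ≤ ∑ i, y i ^ 2).eq_or_lt with h0 | hpos
  · have hy : ∀ i, y i = 0 := fun i => by
      have := (Finset.sum_eq_zero_iff_of_nonneg fun i _ => sq_nonneg (y i)).1 h0.symm i
        (Finset.mem_univ i)
      exact pow_eq_zero_iff (two_ne_zero) |>.1 this
    have : {x : Fin N × Fin n × Fin q → ℝ |
        s * ∑ i, y i ^ 2 < ∑ t, (∑ i, y i * x (b, i, t)) ^ 2} = ∅ := by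
      ext x; simp [hy]
    rw [this]; simp
  · set v := ∑ i, y i ^ 2 with hv
    set c := √v with hc
    have hcpos : 0 < c := Real.sqrt_pos.2 hpos
    have hcc : c * c = v := Real.mul_self_sqrt hpos.le
    -- After normalization by the length `c` of `y`, the coordinates of `A *ᵥ x` are the
    -- combinations of the rows of the sketch. They involve disjoint columns, hence the rows of `A`
    -- are orthonormal.
    let A : Matrix (Fin q) (Fin N × Fin n × Fin q) ℝ :=
      Matrix.of fun t p => if p.1 = b ∧ p.2.2 = t then c⁻¹ * y p.2.1 else 0
    have hAx : ∀ (x : Fin N × Fin n × Fin q → ℝ) t,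
        (A *ᵥ x) t = c⁻¹ * ∑ i, y i * x (b, i, t) := by
      intro x t
      simp only [mulVec, dotProduct, A, Matrix.of_apply, Fintype.sum_prod_type]
      rw [Finset.sum_eq_single b (by intro b' _ hb'; simp [hb']) (by simp), Finset.mul_sum]
      refine Finset.sum_congr rfl fun i _ => ?_
      rw [Finset.sum_eq_single t (by intro t' _ ht'; simp [ht']) (by simp)]
      simp [mul_assoc]
    have hAA : A * Aᵀ = 1 := by
      ext t t'
      have : (A * Aᵀ) t t' = (A *ᵥ fun p => A t' p) t := rfl
      rw [this, hAx]
      by_cases htt : t = t'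
      · subst htt
        simp only [A, Matrix.of_apply, and_self, if_true, one_apply_eq]
        have : ∑ i, y i * (c⁻¹ * y i) = c⁻¹ * v := by
          rw [hv, Finset.mul_sum]; exact Finset.sum_congr rfl fun i _ => by ring
        rw [this, ← hcc]; field_simp
      · simp [A, htt, one_apply_ne htt]
    have hlaw := gaussPi_map_mulVec A hAA
    have hAm : Measurable fun x : Fin N × Fin n × Fin q → ℝ => A *ᵥ x := by
      refine measurable_pi_lambda _ fun i => ?_
      simp only [mulVec, dotProduct]
      fun_prop
    refine le_trans (le_of_eq ?_) (gaussPi_sum_sq_tail q s)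
    rw [← hlaw, Measure.map_apply hAm (measurableSet_lt measurable_const (by fun_prop))]
    congr 1
    ext x
    change s * v < _ ↔ s < ∑ t, (A *ᵥ x) t ^ 2
    have : ∑ t, (A *ᵥ x) t ^ 2 = (∑ t, (∑ i, y i * x (b, i, t)) ^ 2) / v := by
      rw [Finset.sum_div]
      refine Finset.sum_congr rfl fun t _ => ?_
      rw [hAx, ← hcc, mul_pow, inv_pow, sq c]; field_simp
    rw [this, lt_div_iff₀ hpos]

/-! ### Conditioning of the best compressed sketch -/

/-- The `b`-th matrix in a family of sketching matrices with entries `x`. -/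
def sketch {N n q : ℕ} (x : Fin N × Fin n × Fin q → ℝ) (b : Fin N) : Matrix (Fin n) (Fin q) ℝ :=
  Matrix.of fun i t => x (b, i, t)

/-- All `k` singular values of the `k × q` matrix `Z` are at least `T`. -/
def IsWellConditioned {k q : ℕ} (T : ℝ) (Z : Matrix (Fin k) (Fin q) ℝ) : Prop :=
  ∀ v : Fin k → ℝ, T * ‖(WithLp.toLp 2 v : EuclideanSpace ℝ (Fin k))‖ ≤
    ‖(WithLp.toLp 2 (Zᵀ *ᵥ v) : EuclideanSpace ℝ (Fin q))‖

/-- On an interval of length one inside `[0, R]` the decreasing density is at least its value at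
`R`. -/
theorem gaussianReal_Icc_ge {x R : ℝ} (hx : 0 ≤ x) (hR : x + 1 ≤ R) :
    ENNReal.ofReal ((√(2 * Real.pi))⁻¹ * Real.exp (-R ^ 2 / 2)) ≤
      gaussianReal 0 1 (Set.Icc x (x + 1)) := by
  rw [gaussianReal_apply _ one_ne_zero]
  have h1 : ∫⁻ _ in Set.Icc x (x + 1), ENNReal.ofReal ((√(2 * Real.pi))⁻¹ * Real.exp (-R ^ 2 / 2)) =
      ENNReal.ofReal ((√(2 * Real.pi))⁻¹ * Real.exp (-R ^ 2 / 2)) := by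
    rw [setLIntegral_const, Real.volume_Icc]; simp
  rw [← h1]
  refine setLIntegral_mono (by fun_prop) fun y hy => ?_
  rw [gaussianPDF]
  refine ENNReal.ofReal_le_ofReal ?_
  rw [gaussianPDFReal]
  simp only [NNReal.coe_one, mul_one, sub_zero]
  have : y ^ 2 ≤ R ^ 2 := by
    have h0 : 0 ≤ y := hx.trans hy.1
    have h2 : y ≤ R := hy.2.trans hR
    gcongr
  gcongr

/-- The diagonal part expands lengths by at least `T + k`, and the remainder, with entries in `[0,
1]`, has norm at most `k`. -/
theorem isWellConditioned_of_box {k : ℕ} {T : ℝ} (hT : 0 ≤ T) (Z : Matrix (Fin k) (Fin k) ℝ)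
    (hdiag : ∀ j, T + k ≤ Z j j) (hoff : ∀ j l, j ≠ l → 0 ≤ Z j l ∧ Z j l ≤ 1) :
    IsWellConditioned T Z := by
  intro v
  set D : Matrix (Fin k) (Fin k) ℝ := diagonal fun j => Z j j with hD
  set R : Matrix (Fin k) (Fin k) ℝ := Zᵀ - D with hR
  have hRn : ‖R‖ ≤ k := by
    have hrow : ∀ i, rowNorm R i ≤ √k := by
      intro i
      rw [rowNorm_eq_sqrt]
      refine Real.sqrt_le_sqrt ?_
      have : ∀ j ∈ Finset.univ, R i j ^ 2 ≤ 1 := by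
        intro j _
        by_cases hij : i = j
        · subst hij; simp [hR, hD]
        · have := hoff j i (Ne.symm hij)
          simp only [hR, hD, Matrix.sub_apply, Matrix.transpose_apply, diagonal_apply_ne _ hij,
            sub_zero]
          nlinarith
      simpa using Finset.sum_le_sum this
    have := norm_le_sqrt_card_mul R (Real.sqrt_nonneg _) hrow
    rwa [Fintype.card_fin, Real.mul_self_sqrt (Nat.cast_nonneg k)] at this
  have hDv : (T + k) * ‖(WithLp.toLp 2 v : EuclideanSpace ℝ (Fin k))‖ ≤
      ‖(WithLp.toLp 2 (D *ᵥ v) : EuclideanSpace ℝ (Fin k))‖ := by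
    refine abs_le_of_sq_le_sq' ?_ (norm_nonneg _) |>.2
    rw [mul_pow, EuclideanSpace.real_norm_sq_eq, EuclideanSpace.real_norm_sq_eq, Finset.mul_sum]
    refine Finset.sum_le_sum fun j _ => ?_
    simp only [hD, mulVec_diagonal, mul_pow]
    have := hdiag j
    have h0 : 0 ≤ T + k := by positivity
    gcongr
  have hRv := norm_mulVec_le R v
  have hsplit : (WithLp.toLp 2 (D *ᵥ v) : EuclideanSpace ℝ (Fin k)) =
      WithLp.toLp 2 (Zᵀ *ᵥ v) - WithLp.toLp 2 (R *ᵥ v) := by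
    rw [← WithLp.toLp_sub, ← sub_mulVec, hR, sub_sub_cancel]
  have h3 := norm_sub_le (WithLp.toLp 2 (Zᵀ *ᵥ v) : EuclideanSpace ℝ (Fin k))
    (WithLp.toLp 2 (R *ᵥ v))
  rw [← hsplit] at h3
  have h4 : ‖R‖ * ‖(WithLp.toLp 2 v : EuclideanSpace ℝ (Fin k))‖ ≤
    k * ‖(WithLp.toLp 2 v : EuclideanSpace ℝ (Fin k))‖ := by gcongr
  linarith

/-- Further columns of `Z` only add coordinates to `Zᵀ *ᵥ v`. This reduces conditioning to a square
block. -/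
theorem IsWellConditioned.of_submatrix {k q r : ℕ} {T : ℝ} {Z : Matrix (Fin k) (Fin q) ℝ}
    (f : Fin r → Fin q) (hf : Function.Injective f)
    (h : IsWellConditioned T (Z.submatrix id f)) : IsWellConditioned T Z := by
  intro v
  refine (h v).trans ?_
  rw [EuclideanSpace.norm_eq, EuclideanSpace.norm_eq]
  refine Real.sqrt_le_sqrt ?_
  have : ∀ l, ‖((Z.submatrix id f)ᵀ *ᵥ v) l‖ ^ 2 = (fun t => ‖(Zᵀ *ᵥ v) t‖ ^ 2) (f l) :=
    fun l => rfl
  simp only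
  rw [Finset.sum_congr rfl fun l _ => this l, ← Finset.sum_image (f := fun t => ‖(Zᵀ *ᵥ v) t‖ ^ 2)
    (fun a _ b _ hab => hf hab)]
  exact Finset.sum_le_sum_of_subset_of_nonneg (Finset.subset_univ _) fun _ _ _ => by positivity

/-- The probability that none of `N` Gaussian sketches is well conditioned. -/
theorem gaussPi_forall_not_isWellConditioned_le {N n q k : ℕ} (hkq : k ≤ q)
    (U : Matrix (Fin n) (Fin k) ℝ) (hU : Uᵀ * U = 1) {T : ℝ} (hT : 0 ≤ T) :
    gaussPi (Fin N × Fin n × Fin q) {x | ∀ b, ¬ IsWellConditioned T (Uᵀ * sketch x b)} ≤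
      ENNReal.ofReal (Real.exp (-(N * ((√(2 * Real.pi))⁻¹ *
        Real.exp (-(T + k + 1) ^ 2 / 2)) ^ (k * k)))) := by
  set m : ℝ := (√(2 * Real.pi))⁻¹ * Real.exp (-(T + k + 1) ^ 2 / 2) with hm
  have hm0 : 0 ≤ m := by positivity
  -- Lower endpoints of the box for the entries of a `k × k` block. All its sides lie in `[0, T + k
  -- + 1]`, so each contributes a factor of at least `m`.
  let c : Fin k × Fin k → ℝ := fun p => if p.1 = p.2 then T + k else 0
  let Bx : Set (Fin k × Fin k → ℝ) := Set.univ.pi fun p => Set.Icc (c p) (c p + 1)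
  have hBxm : MeasurableSet Bx := MeasurableSet.univ_pi fun _ => measurableSet_Icc
  have hBx : ENNReal.ofReal (m ^ (k * k)) ≤ gaussPi (Fin k × Fin k) Bx := by
    rw [gaussPi, Measure.pi_pi, ENNReal.ofReal_pow hm0]
    have : ENNReal.ofReal m ^ (k * k) = ∏ _p : Fin k × Fin k, ENNReal.ofReal m := by simp
    rw [this]
    refine Finset.prod_le_prod' fun p _ => gaussianReal_Icc_ge ?_ ?_
    · simp only [c]; split_ifs <;> positivity
    · simp only [c]
      have : (0 : ℝ) ≤ k := Nat.cast_nonneg k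
      split_ifs <;> linarith
  have hBxc : gaussPi (Fin k × Fin k) Bxᶜ ≤ ENNReal.ofReal (Real.exp (-(m ^ (k * k)))) := by
    rw [prob_compl_eq_one_sub hBxm]
    refine (tsub_le_tsub_left hBx 1).trans ?_
    rw [← ENNReal.ofReal_one, ← ENNReal.ofReal_sub _ (by positivity)]
    refine ENNReal.ofReal_le_ofReal ?_
    have := Real.add_one_le_exp (-(m ^ (k * k)))
    linarith
  -- Extracts the first `k` columns of every `Uᵀ * sketch x b`. Orthonormality of its rows makes the
  -- blocks independent standard Gaussian, so the failure probability is an `N`-th power.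
  let A : Matrix (Fin N × (Fin k × Fin k)) (Fin N × Fin n × Fin q) ℝ :=
    Matrix.of fun p r => if r.1 = p.1 ∧ r.2.2 = Fin.castLE hkq p.2.2 then U r.2.1 p.2.1 else 0
  have hAx : ∀ (x : Fin N × Fin n × Fin q → ℝ) b j l,
      (A *ᵥ x) (b, (j, l)) = (Uᵀ * sketch x b) j (Fin.castLE hkq l) := by
    intro x b j l
    simp only [mulVec, dotProduct, A, Matrix.of_apply, Fintype.sum_prod_type, Matrix.mul_apply,
      Matrix.transpose_apply, sketch]
    rw [Finset.sum_eq_single b (by intro b' _ hb'; simp [hb']) (by simp)]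
    refine Finset.sum_congr rfl fun i _ => ?_
    rw [Finset.sum_eq_single (Fin.castLE hkq l) (by intro t' _ ht'; simp [ht']) (by simp)]
    simp
  have hAA : A * Aᵀ = 1 := by
    ext p p'
    obtain ⟨b, j, l⟩ := p
    obtain ⟨b', j', l'⟩ := p'
    have h1 : (A * Aᵀ) (b, j, l) (b', j', l') = (A *ᵥ fun r => A (b', j', l') r) (b, j, l) := rfl
    rw [h1, hAx]
    have hUjj : ∑ i, U i j * U i j' = if j = j' then 1 else 0 := by
      have := congrFun (congrFun hU j) j'
      simpa [Matrix.mul_apply, Matrix.one_apply] using this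
    simp only [A, sketch, Matrix.mul_apply, Matrix.transpose_apply, Matrix.of_apply,
      Matrix.one_apply, Prod.mk.injEq]
    by_cases hb : b = b'
    · by_cases hl : l = l'
      · simp [hb, hl, hUjj]
      · have : Fin.castLE hkq l ≠ Fin.castLE hkq l' := fun h => hl (Fin.castLE_injective hkq h)
        simp [hl, this]
    · simp [hb]
  have hAm : Measurable fun x : Fin N × Fin n × Fin q → ℝ => A *ᵥ x := by
    refine measurable_pi_lambda _ fun i => ?_
    simp only [mulVec, dotProduct]
    fun_prop
  have hcm : Measurable fun (x : Fin N × (Fin k × Fin k) → ℝ) b p => x (b, p) := by fun_prop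
  have hsub : {x : Fin N × Fin n × Fin q → ℝ | ∀ b, ¬ IsWellConditioned T (Uᵀ * sketch x b)} ⊆
      (fun x b p => (A *ᵥ x) (b, p)) ⁻¹' (Set.univ.pi fun _ : Fin N => Bxᶜ) := by
    intro x hx b _ hb
    refine hx b (IsWellConditioned.of_submatrix (Fin.castLE hkq) (Fin.castLE_injective hkq) ?_)
    have hb' : ∀ j l, (Uᵀ * sketch x b) j (Fin.castLE hkq l) ∈ Set.Icc (c (j, l)) (c (j, l) + 1) :=
      fun j l => hAx x b j l ▸ hb (j, l) (Set.mem_univ _)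
    refine isWellConditioned_of_box hT _ (fun j => ?_) fun j l hjl => ?_
    · have := (hb' j j).1
      simpa [c] using this
    · have := hb' j l
      simpa [c, hjl] using this
  refine (measure_mono hsub).trans ?_
  have hcomp : (fun (x : Fin N × Fin n × Fin q → ℝ) b p => (A *ᵥ x) (b, p)) =
      (fun (x : Fin N × (Fin k × Fin k) → ℝ) b p => x (b, p)) ∘ fun x => A *ᵥ x := rfl
  rw [hcomp, ← Measure.map_apply (hcm.comp hAm) (MeasurableSet.univ_pi fun _ => hBxm.compl),
    ← Measure.map_map hcm hAm, gaussPi_map_mulVec A hAA, gaussPi_map_curry, Measure.pi_pi,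
    Finset.prod_const, Finset.card_univ, Fintype.card_fin]
  refine (pow_le_pow_left' hBxc N).trans (le_of_eq ?_)
  rw [← ENNReal.ofReal_pow (Real.exp_pos _).le, ← Real.exp_nat_mul]
  congr 2
  ring

theorem memLp_eval_mul_eval_gaussPi {k : ℕ} (j l : Fin k) :
    MemLp (fun w : Fin k → ℝ => w j * w l) 2 (gaussPi (Fin k)) := by
  have h : ∀ j : Fin k, MemLp (fun w : Fin k → ℝ => w j) 4 (gaussPi (Fin k)) := fun j =>
    (IsGaussian.memLp_id (gaussianReal 0 1) 4 (by norm_num)).comp_measurePreserving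
      (measurePreserving_eval (fun _ : Fin k => gaussianReal 0 1) j)
  have : ENNReal.HolderTriple 4 4 2 := ⟨by
    rw [← two_mul, show (4 : ENNReal) = 2 * 2 by norm_num,
      ENNReal.mul_inv (by simp) (by simp), ← mul_assoc, ENNReal.mul_inv_cancel (by simp) (by simp),
      one_mul]⟩
  exact (h l).mul (h j)

theorem integral_eval_mul_eval_gaussPi {k : ℕ} (j l : Fin k) :
    ∫ w : Fin k → ℝ, w j * w l ∂(gaussPi (Fin k)) = if j = l then 1 else 0 := by
  have hmp := fun j : Fin k => measurePreserving_eval (fun _ : Fin k => gaussianReal 0 1) j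
  by_cases hjl : j = l
  · subst hjl
    have h1 : ∫ w : Fin k → ℝ, w j * w j ∂(gaussPi (Fin k)) = ∫ x, x ^ 2 ∂(gaussianReal 0 1) := by
      rw [← (hmp j).map_eq, integral_map (hmp j).measurable.aemeasurable
        (Measurable.aestronglyMeasurable (by fun_prop))]
      simp [gaussPi, sq]
    have h2 := variance_fun_id_gaussianReal (μ := 0) (v := 1)
    rw [variance_eq_integral aemeasurable_id'] at h2
    simp only [integral_id_gaussianReal, sub_zero, NNReal.coe_one] at h2
    rw [h1, h2, if_pos rfl]
  · have hind : IndepFun (fun w : Fin k → ℝ => w j) (fun w => w l) (gaussPi (Fin k)) :=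
      (iIndepFun_pi (μ := fun _ : Fin k => gaussianReal 0 1) (X := fun _ x => x)
        fun _ => aemeasurable_id').indepFun hjl
    have h0 : ∀ j : Fin k, ∫ w : Fin k → ℝ, w j ∂(gaussPi (Fin k)) = 0 := by
      intro j
      have := integral_id_gaussianReal (μ := 0) (v := 1)
      rw [← (hmp j).map_eq, integral_map (hmp j).measurable.aemeasurable
        (Measurable.aestronglyMeasurable (by fun_prop))] at this
      exact this
    have := hind.integral_mul_eq_mul_integral (Measurable.aestronglyMeasurable (by fun_prop))
      (Measurable.aestronglyMeasurable (by fun_prop))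
    rw [if_neg hjl]
    refine this.trans ?_
    rw [h0, zero_mul]

/-- The Gram matrix differs from `q` times the identity by at most `q / 2` in norm, so its smallest
eigenvalue is at least `q / 2`. -/
theorem isWellConditioned_of_gram {k q : ℕ} (hk : 1 ≤ k) {T : ℝ} (hTq : T ^ 2 ≤ q / 2)
    (Z : Matrix (Fin k) (Fin q) ℝ)
    (h : ∀ j l, |(∑ t, Z j t * Z l t) - (q : ℝ) * (if j = l then 1 else 0)| < q / (2 * k)) :
    IsWellConditioned T Z := by
  intro v
  have hk0 : (0 : ℝ) < k := by exact_mod_cast hk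
  set H : Matrix (Fin k) (Fin k) ℝ := Z * Zᵀ - (q : ℝ) • 1 with hH
  have hq0 : (0 : ℝ) ≤ q := Nat.cast_nonneg q
  have hHn : ‖H‖ ≤ q / 2 := by
    have hrow : ∀ i, rowNorm H i ≤ √k * (q / (2 * k)) := by
      intro i
      rw [rowNorm_eq_sqrt, ← Real.sqrt_sq (show 0 ≤ (q : ℝ) / (2 * k) by positivity),
        ← Real.sqrt_mul hk0.le]
      refine Real.sqrt_le_sqrt ?_
      have : ∀ j ∈ Finset.univ, H i j ^ 2 ≤ ((q : ℝ) / (2 * k)) ^ 2 := by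
        intro j _
        rw [sq_le_sq]
        refine le_trans (le_of_eq ?_) ((h i j).le.trans (le_abs_self _))
        simp [hH, Matrix.mul_apply, Matrix.one_apply]
      simpa using Finset.sum_le_sum this
    have := norm_le_sqrt_card_mul H (by positivity) hrow
    rw [Fintype.card_fin, ← mul_assoc, Real.mul_self_sqrt hk0.le] at this
    refine this.trans (le_of_eq ?_)
    field_simp
  set nv := ‖(WithLp.toLp 2 v : EuclideanSpace ℝ (Fin k))‖ with hnv
  have hvv : v ⬝ᵥ v = nv ^ 2 := by
    rw [hnv, EuclideanSpace.real_norm_sq_eq]; simp [dotProduct, sq]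
  have h1 : ‖(WithLp.toLp 2 (Zᵀ *ᵥ v) : EuclideanSpace ℝ (Fin q))‖ ^ 2 =
      q * nv ^ 2 + v ⬝ᵥ (H *ᵥ v) := by
    have e : (Zᵀ *ᵥ v) ⬝ᵥ (Zᵀ *ᵥ v) = v ⬝ᵥ ((Z * Zᵀ) *ᵥ v) := by
      rw [dotProduct_mulVec, vecMul_transpose, mulVec_mulVec, dotProduct_comm]
    have e2 : ‖(WithLp.toLp 2 (Zᵀ *ᵥ v) : EuclideanSpace ℝ (Fin q))‖ ^ 2 =
        (Zᵀ *ᵥ v) ⬝ᵥ (Zᵀ *ᵥ v) := by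
      rw [EuclideanSpace.real_norm_sq_eq]; simp [dotProduct, sq]
    rw [e2, e, hH, sub_mulVec, dotProduct_sub, smul_mulVec, one_mulVec, dotProduct_smul, hvv,
      smul_eq_mul]
    ring
  have h2 : |v ⬝ᵥ (H *ᵥ v)| ≤ q / 2 * nv ^ 2 := by
    have e := abs_real_inner_le_norm (WithLp.toLp 2 (H *ᵥ v) : EuclideanSpace ℝ (Fin k))
      (WithLp.toLp 2 v)
    rw [EuclideanSpace.inner_toLp_toLp, star_trivial] at e
    have e3 := norm_mulVec_le H v
    have e4 : ‖H‖ * nv ≤ q / 2 * nv := by gcongr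
    refine e.trans ?_
    calc _ ≤ (q / 2 * nv) * nv := by
          refine mul_le_mul_of_nonneg_right (e3.trans e4) (norm_nonneg _)
      _ = _ := by ring
  refine le_of_sq_le_sq ?_ (norm_nonneg _)
  rw [h1, mul_pow]
  have h3 := (abs_le.1 h2).1
  have : T ^ 2 * nv ^ 2 ≤ q / 2 * nv ^ 2 := by gcongr
  linarith

/-- A single Gaussian sketch is well conditioned when the sketching dimension is large. -/
theorem exists_gaussPi_not_isWellConditioned_le (k : ℕ) (hk : 1 ≤ k) :
    ∃ V : ℝ, 0 ≤ V ∧ ∀ {N n q : ℕ}, 1 ≤ q → ∀ (U : Matrix (Fin n) (Fin k) ℝ), Uᵀ * U = 1 →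
      ∀ (b : Fin N) {T : ℝ}, T ^ 2 ≤ q / 2 →
      gaussPi (Fin N × Fin n × Fin q) {x | ¬ IsWellConditioned T (Uᵀ * sketch x b)} ≤
        ENNReal.ofReal (V / q) := by
  let Vr : Fin k → Fin k → ℝ := fun j l => Var[fun w : Fin k → ℝ => w j * w l; gaussPi (Fin k)]
  have hVr : ∀ j l, 0 ≤ Vr j l := fun j l => variance_nonneg _ _
  refine ⟨∑ j, ∑ l, 4 * k ^ 2 * Vr j l, Finset.sum_nonneg fun j _ => Finset.sum_nonneg fun l _ => by
    have := hVr j l; positivity, ?_⟩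
  intro N n q hq U hU b T hTq
  have hk0 : (0 : ℝ) < k := by exact_mod_cast hk
  have hq0 : (0 : ℝ) < q := by exact_mod_cast hq
  let A : Matrix (Fin q × Fin k) (Fin N × Fin n × Fin q) ℝ :=
    Matrix.of fun p r => if r.1 = b ∧ r.2.2 = p.1 then U r.2.1 p.2 else 0
  have hAx : ∀ (x : Fin N × Fin n × Fin q → ℝ) t j,
      (A *ᵥ x) (t, j) = (Uᵀ * sketch x b) j t := by
    intro x t j
    simp only [mulVec, dotProduct, A, Matrix.of_apply, Fintype.sum_prod_type, Matrix.mul_apply,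
      Matrix.transpose_apply, sketch]
    rw [Finset.sum_eq_single b (by intro b' _ hb'; simp [hb']) (by simp)]
    refine Finset.sum_congr rfl fun i _ => ?_
    rw [Finset.sum_eq_single t (by intro t' _ ht'; simp [ht']) (by simp)]
    simp
  have hAA : A * Aᵀ = 1 := by
    ext p p'
    obtain ⟨t, j⟩ := p
    obtain ⟨t', j'⟩ := p'
    have h1 : (A * Aᵀ) (t, j) (t', j') = (A *ᵥ fun r => A (t', j') r) (t, j) := rfl
    rw [h1, hAx]
    have hUjj : ∑ i, U i j * U i j' = if j = j' then 1 else 0 := by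
      have := congrFun (congrFun hU j) j'
      simpa [Matrix.mul_apply, Matrix.one_apply] using this
    simp only [A, sketch, Matrix.mul_apply, Matrix.transpose_apply, Matrix.of_apply,
      Matrix.one_apply, Prod.mk.injEq]
    by_cases ht : t = t'
    · simp [ht, hUjj]
    · simp [ht]
  have hAm : Measurable fun x : Fin N × Fin n × Fin q → ℝ => A *ᵥ x := by
    refine measurable_pi_lambda _ fun i => ?_
    simp only [mulVec, dotProduct]
    fun_prop
  have hcm : Measurable fun (x : Fin q × Fin k → ℝ) t j => x (t, j) := by fun_prop
  let S : Fin k → Fin k → (Fin q → Fin k → ℝ) → ℝ := fun j l w => ∑ t, w t j * w t l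
  have hSeq : ∀ j l, S j l = ∑ t, fun w : Fin q → Fin k → ℝ => w t j * w t l := by
    intro j l; ext w; simp [S]
  have hmp := fun t : Fin q => measurePreserving_eval (fun _ : Fin q => gaussPi (Fin k)) t
  have hL2 : ∀ j l t, MemLp (fun w : Fin q → Fin k → ℝ => w t j * w t l) 2
      (Measure.pi fun _ : Fin q => gaussPi (Fin k)) := fun j l t =>
    (memLp_eval_mul_eval_gaussPi j l).comp_measurePreserving (hmp t)
  have hSL2 : ∀ j l, MemLp (S j l) 2 (Measure.pi fun _ : Fin q => gaussPi (Fin k)) := by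
    intro j l
    rw [hSeq]
    exact memLp_finsetSum' _ fun t _ => hL2 j l t
  have hSint : ∀ j l, ∫ w, S j l w ∂(Measure.pi fun _ : Fin q => gaussPi (Fin k)) =
      q * (if j = l then 1 else 0) := by
    intro j l
    simp only [S]
    rw [integral_finsetSum _ fun t _ => (hL2 j l t).integrable (by norm_num)]
    have : ∀ t ∈ Finset.univ, ∫ w : Fin q → Fin k → ℝ, w t j * w t l
        ∂(Measure.pi fun _ : Fin q => gaussPi (Fin k)) = if j = l then 1 else 0 := by
      intro t _
      have h := integral_map (μ := Measure.pi fun _ : Fin q => gaussPi (Fin k))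
        (f := fun w : Fin k → ℝ => w j * w l) (hmp t).measurable.aemeasurable
        (Measurable.aestronglyMeasurable (by fun_prop))
      rw [(hmp t).map_eq, integral_eval_mul_eval_gaussPi] at h
      exact h.symm
    rw [Finset.sum_congr rfl this]
    simp
  have hSvar : ∀ j l, Var[S j l; Measure.pi fun _ : Fin q => gaussPi (Fin k)] = q * Vr j l := by
    intro j l
    rw [hSeq]
    have := variance_sum_pi (μ := fun _ : Fin q => gaussPi (Fin k))
      (X := fun _ : Fin q => fun w : Fin k → ℝ => w j * w l)
      fun _ => memLp_eval_mul_eval_gaussPi j l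
    rw [this]
    simp [Vr]
  -- Chebyshev for each entry of the Gram matrix: variance `q * Vr j l` against the squared
  -- threshold `(q / (2 * k)) ^ 2` leaves a bound of order `1 / q`.
  let bad : Fin k → Fin k → Set (Fin q → Fin k → ℝ) := fun j l =>
    {w | q / (2 * k) ≤ |S j l w - q * (if j = l then 1 else 0)|}
  have hbadm : ∀ j l, MeasurableSet (bad j l) := fun j l =>
    measurableSet_le measurable_const (by simp only [S]; fun_prop)
  have hbad : ∀ j l, (Measure.pi fun _ : Fin q => gaussPi (Fin k)) (bad j l) ≤
      ENNReal.ofReal (4 * k ^ 2 * Vr j l / q) := by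
    intro j l
    have h := meas_ge_le_variance_div_sq (hSL2 j l) (c := q / (2 * k)) (by positivity)
    rw [hSint, hSvar] at h
    refine h.trans (le_of_eq ?_)
    congr 1
    field_simp
    norm_num
  have hsub : {x : Fin N × Fin n × Fin q → ℝ | ¬ IsWellConditioned T (Uᵀ * sketch x b)} ⊆
      (fun x t j => (A *ᵥ x) (t, j)) ⁻¹' (⋃ j, ⋃ l, bad j l) := by
    intro x hx
    by_contra hnot
    refine hx (isWellConditioned_of_gram hk hTq _ fun j l => ?_)
    simp only [Set.mem_preimage, Set.mem_iUnion, not_exists] at hnot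
    have := hnot j l
    simp only [bad, S, Set.mem_ofPred_eq, not_le, hAx] at this
    exact this
  refine (measure_mono hsub).trans ?_
  have hcomp : (fun (x : Fin N × Fin n × Fin q → ℝ) t j => (A *ᵥ x) (t, j)) =
      (fun (x : Fin q × Fin k → ℝ) t j => x (t, j)) ∘ fun x => A *ᵥ x := rfl
  rw [hcomp, ← Measure.map_apply (hcm.comp hAm)
      (MeasurableSet.iUnion fun j => MeasurableSet.iUnion fun l => hbadm j l),
    ← Measure.map_map hcm hAm, gaussPi_map_mulVec A hAA, gaussPi_map_curry]
  refine (measure_iUnion_fintype_le _ _).trans ?_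
  rw [Finset.sum_div, ENNReal.ofReal_sum_of_nonneg fun j _ => by
    refine div_nonneg (Finset.sum_nonneg fun l _ => ?_) hq0.le
    have := hVr j l; positivity]
  refine Finset.sum_le_sum fun j _ => (measure_iUnion_fintype_le _ _).trans ?_
  rw [Finset.sum_div, ENNReal.ofReal_sum_of_nonneg fun l _ => by
    have := hVr j l; positivity]
  exact Finset.sum_le_sum fun l _ => hbad j l

/-- The size to which the best among `N` Gaussian sketches of dimension `q` is well conditioned. -/
noncomputable def sketchLevel (k q N : ℕ) : ℝ := √(q / 4 + Real.log N / (4 * k ^ 2))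

theorem sketchLevel_sq (k q : ℕ) {N : ℕ} (hN : 1 ≤ N) :
    sketchLevel k q N ^ 2 = q / 4 + Real.log N / (4 * k ^ 2) := by
  have : 0 ≤ Real.log N := Real.log_nonneg (by exact_mod_cast hN)
  rw [sketchLevel, Real.sq_sqrt (by positivity)]

/-- With many sketches or a large sketching dimension, some sketch is well conditioned. -/
theorem exists_gaussPi_sketchLevel_le (k : ℕ) (hk : 1 ≤ k) {ε : ℝ} (hε : 0 < ε) :
    ∃ L : ℕ, ∀ {N n q : ℕ}, 1 ≤ N → k ≤ q → (L ≤ N ∨ L ≤ q) →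
      ∀ (U : Matrix (Fin n) (Fin k) ℝ), Uᵀ * U = 1 →
      gaussPi (Fin N × Fin n × Fin q)
        {x | ∀ b, ¬ IsWellConditioned (sketchLevel k q N) (Uᵀ * sketch x b)} ≤
        ENNReal.ofReal ε := by
  obtain ⟨V, hV0, hV⟩ := exists_gaussPi_not_isWellConditioned_le k hk
  have hk0 : (0 : ℝ) < k := by exact_mod_cast hk
  set c : ℝ := (√(2 * Real.pi))⁻¹ * Real.exp (-((k : ℝ) + 1) ^ 2) with hc
  have hcpos : 0 < c := by positivity
  set c1 : ℝ := c ^ (k * k) with hc1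
  have hc1pos : 0 < c1 := by positivity
  have hbox : ∀ {N n q : ℕ}, k ≤ q → ∀ (U : Matrix (Fin n) (Fin k) ℝ), Uᵀ * U = 1 → ∀ {T B : ℝ},
      0 ≤ T → T ^ 2 ≤ B →
      gaussPi (Fin N × Fin n × Fin q) {x | ∀ b, ¬ IsWellConditioned T (Uᵀ * sketch x b)} ≤
      ENNReal.ofReal (Real.exp (-(N * (c1 * Real.exp (-(k ^ 2 * B)))))) := by
    intro N n q hkq U hU T B hT hTB
    refine (gaussPi_forall_not_isWellConditioned_le hkq U hU hT).trans (ENNReal.ofReal_le_ofReal ?_)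
    -- By `(T + k + 1) ^ 2 / 2 ≤ T ^ 2 + (k + 1) ^ 2`, which separates `T` from the constant
    -- depending on `k`.
    have h1 : c * Real.exp (-B) ≤ (√(2 * Real.pi))⁻¹ * Real.exp (-(T + k + 1) ^ 2 / 2) := by
      rw [hc, mul_assoc, ← Real.exp_add]
      gcongr
      nlinarith [sq_nonneg (T - (k + 1))]
    have h2 := pow_le_pow_left₀ (by positivity) h1 (k * k)
    have h3 : (c * Real.exp (-B)) ^ (k * k) = c1 * Real.exp (-(k ^ 2 * B)) := by
      rw [mul_pow, ← Real.exp_nat_mul]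
      congr 2
      push_cast; ring
    rw [h3] at h2
    gcongr
  obtain ⟨L1, hL1⟩ : ∃ L1 : ℕ, 1 ≤ L1 ∧ V / L1 ≤ ε := by
    obtain ⟨m, hm⟩ := exists_nat_ge (V / ε)
    refine ⟨m + 1, by omega, ?_⟩
    rw [div_le_iff₀ (by positivity)]
    rw [div_le_iff₀ hε] at hm
    push_cast
    nlinarith
  have hlim : ∀ a : ℝ, 0 < a → ∃ L : ℕ, ∀ N : ℕ, L ≤ N → Real.exp (-(a * √N)) ≤ ε := by
    intro a ha
    have h : Tendsto (fun N : ℕ => Real.exp (-(a * √(N : ℝ)))) atTop (𝓝 0) :=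
      Real.tendsto_exp_neg_atTop_nhds_zero.comp ((Real.tendsto_sqrt_atTop.comp
        tendsto_natCast_atTop_atTop).const_mul_atTop ha)
    exact eventually_atTop.1 (h.eventually_le_const hε)
  obtain ⟨L2, hL2⟩ := hlim (c1 * Real.exp (-(k ^ 2 * (L1 / 2)))) (by positivity)
  obtain ⟨L3, hL3⟩ := hlim c1 hc1pos
  refine ⟨max L1 (max L2 L3), ?_⟩
  intro N n q hN hkq hNq U hU
  have hN0 : (1 : ℝ) ≤ N := by exact_mod_cast hN
  have hTsq := sketchLevel_sq k q hN
  have hT0 : 0 ≤ sketchLevel k q N := Real.sqrt_nonneg _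
  set T := sketchLevel k q N
  have hsqrtN : √(N : ℝ) ≤ N := by
    rw [Real.sqrt_le_left (by linarith)]; nlinarith
  -- If the term in `q` dominates the level, then either `q` is large and one sketch suffices by
  -- Chebyshev, or `q` and hence the level are bounded and many sketches help through the box. If
  -- `log N` dominates, the `4 * k ^ 2` in the level makes the box probability at least `c1 / √N`,
  -- so the expected number of hits is of order `√N`; moreover `q ≤ N`, so `N` is large in either
  -- alternative.
  rcases le_total (Real.log N / (4 * k ^ 2)) ((q : ℝ) / 4) with hcase | hcase
  · have hTq : T ^ 2 ≤ q / 2 := by rw [hTsq]; linarith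
    rcases le_or_gt L1 q with hq | hq
    · have hsub : {x : Fin N × Fin n × Fin q → ℝ | ∀ b, ¬ IsWellConditioned T (Uᵀ * sketch x b)} ⊆
          {x | ¬ IsWellConditioned T (Uᵀ * sketch x ⟨0, hN⟩)} := fun x hx => hx _
      refine (measure_mono hsub).trans ((hV (hk.trans hkq) U hU _ hTq).trans
        (ENNReal.ofReal_le_ofReal (le_trans ?_ hL1.2)))
      have : (0 : ℝ) < L1 := by exact_mod_cast hL1.1
      have : (L1 : ℝ) ≤ q := by exact_mod_cast hq
      gcongr
    · have hTL : T ^ 2 ≤ L1 / 2 := by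
        have : (q : ℝ) ≤ L1 := by exact_mod_cast hq.le
        linarith
      have hNL2 : L2 ≤ N := by
        rcases hNq with h | h
        · exact (le_max_left _ _).trans ((le_max_right _ _).trans h)
        · exact absurd ((le_max_left _ _).trans h) (by omega)
      refine (hbox hkq U hU hT0 hTL).trans (ENNReal.ofReal_le_ofReal (le_trans ?_ (hL2 N hNL2)))
      rw [mul_comm (N : ℝ)]
      gcongr
  · have hTB : T ^ 2 ≤ Real.log N / (2 * k ^ 2) := by
      rw [hTsq]
      have : Real.log N / (2 * (k : ℝ) ^ 2) = Real.log N / (4 * k ^ 2) + Real.log N / (4 * k ^ 2) := by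
        field_simp; ring
      linarith
    have hqN : q ≤ N := by
      have h1 : (q : ℝ) ≤ Real.log N := by
        rw [div_le_div_iff₀ (by norm_num) (by positivity)] at hcase
        have : (1 : ℝ) ≤ (k : ℝ) ^ 2 := one_le_pow₀ (by exact_mod_cast hk)
        have hq0 : (0 : ℝ) ≤ q := Nat.cast_nonneg q
        nlinarith
      have h2 := Real.log_le_sub_one_of_pos (by linarith : (0 : ℝ) < N)
      have : (q : ℝ) ≤ N := by linarith
      exact_mod_cast this
    have hNL3 : L3 ≤ N := by
      rcases hNq with h | h
      · exact (le_max_right _ _).trans ((le_max_right _ _).trans h)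
      · exact ((le_max_right _ _).trans ((le_max_right _ _).trans h)).trans hqN
    refine (hbox hkq U hU hT0 hTB).trans (ENNReal.ofReal_le_ofReal (le_trans ?_ (hL3 N hNL3)))
    have e1 : Real.exp (-((k : ℝ) ^ 2 * (Real.log N / (2 * k ^ 2)))) = (√(N : ℝ))⁻¹ := by
      have : (k : ℝ) ^ 2 * (Real.log N / (2 * k ^ 2)) = Real.log (√(N : ℝ)) := by
        rw [Real.log_sqrt (by linarith)]; field_simp
      rw [this, Real.exp_neg, Real.exp_log (Real.sqrt_pos.2 (by linarith))]
    rw [e1]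
    have hs : (0 : ℝ) < √N := Real.sqrt_pos.2 (by linarith)
    have e2 : (N : ℝ) * (c1 * (√(N : ℝ))⁻¹) = c1 * √N := by
      nth_rewrite 1 [← Real.mul_self_sqrt (by linarith : (0 : ℝ) ≤ N)]
      field_simp
    rw [e2]

/-- In `(κ * T) ^ 2 / 4` the part with `log N` pays for the union over the sketches as soon as `κ ^
2 ≥ 16 * k ^ 2`. The part `κ ^ 2 * q / 16` outweighs `q / 2`, leaving a bound free of `N` and `q`.
-/
theorem sketch_level_union_bound {k q N : ℕ} {κ : ℝ} (hk : 1 ≤ k) (hq : 1 ≤ q) (hN : 1 ≤ N)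
    (hκ : 16 * (k : ℝ) ^ 2 ≤ κ ^ 2) :
    N * Real.exp (q / 2 - (κ * sketchLevel k q N) ^ 2 / 4) ≤ Real.exp (-((κ ^ 2 - 8) / 16)) := by
  have hk1 : (1 : ℝ) ≤ (k : ℝ) ^ 2 := one_le_pow₀ (by exact_mod_cast hk)
  have hN0 : (1 : ℝ) ≤ N := by exact_mod_cast hN
  have hq0 : (1 : ℝ) ≤ q := by exact_mod_cast hq
  have hlog : 0 ≤ Real.log N := Real.log_nonneg hN0
  have hNe : (N : ℝ) = Real.exp (Real.log N) := (Real.exp_log (by linarith)).symm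
  conv_lhs => rw [hNe]
  rw [← Real.exp_add, mul_pow, sketchLevel_sq k q hN]
  refine Real.exp_le_exp.2 ?_
  have h1 : Real.log N ≤ κ ^ 2 * (Real.log N / (4 * k ^ 2)) / 4 := by
    have h : κ ^ 2 * (Real.log N / (4 * k ^ 2)) / 4 = κ ^ 2 * Real.log N / (16 * k ^ 2) := by
      field_simp
      norm_num
    rw [h, le_div_iff₀ (by positivity), mul_comm]
    exact mul_le_mul_of_nonneg_right hκ hlog
  have h2 : (κ ^ 2 - 8) / 16 ≤ q * ((κ ^ 2 - 8) / 16) :=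
    le_mul_of_one_le_left (by linarith) hq0
  linarith

/-! ### Noise-dependent linear forms on the sketches -/

theorem rowNorm_sq {m n : Type*} [Fintype n] [Fintype m] [DecidableEq m] [DecidableEq n]
    (A : Matrix m n ℝ) (i : m) : rowNorm A i ^ 2 = ∑ j, A i j ^ 2 := by
  rw [rowNorm_eq_sqrt, Real.sq_sqrt (by positivity)]

/-- A family of linear forms depending on the noise is uniformly controlled on all independent
Gaussian sketches. -/
theorem IsGaussianSketch.measure_rowNorm_mul_gt_le {Ω : Type*} [MeasurableSpace Ω]
    {P : Measure Ω} [IsProbabilityMeasure P] {n q N m : ℕ}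
    {E : Ω → Matrix (Fin n) (Fin n) ℝ} {G : Ω → Fin N → Matrix (Fin n) (Fin q) ℝ}
    (h : IsGaussianSketch P E G) (hE : ∀ i j, Measurable fun ω => E ω i j)
    (Y : Matrix (Fin n) (Fin n) ℝ → Matrix (Fin m) (Fin n) ℝ) (hY : Continuous Y) {s : ℝ}
    (hs : 0 ≤ s) :
    P {ω | ¬ ∀ b j, rowNorm (Y (E ω) * G ω b) j ≤ s * rowNorm (Y (E ω)) j} ≤
      ENNReal.ofReal (m * (N * Real.exp (q / 2 - s ^ 2 / 4))) := by
  have hEm : Measurable fun ω (p : Fin n × Fin n) => E ω p.1 p.2 :=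
    measurable_pi_lambda _ fun p => hE p.1 p.2
  have hGm := h.law.aemeasurable
  have hmap := (indepFun_iff_map_prod_eq_prod_map_map hEm.aemeasurable hGm).1 h.indep
  let y : (Fin n × Fin n → ℝ) → Fin m → Fin n → ℝ := fun e => Y (Matrix.of fun i j => e (i, j))
  have hy : ∀ j i, Measurable fun e => y e j i := by
    intro j i
    have h1 : Continuous fun e : Fin n × Fin n → ℝ =>
        (Matrix.of fun i j => e (i, j) : Matrix (Fin n) (Fin n) ℝ) := by fun_prop
    have h2 := (hY.comp h1).matrix_elem j i
    exact h2.measurable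
  let B : Fin N → Fin m → Set ((Fin n × Fin n → ℝ) × (Fin N × Fin n × Fin q → ℝ)) := fun b j =>
    {p | s ^ 2 * ∑ i, y p.1 j i ^ 2 < ∑ t, (∑ i, y p.1 j i * p.2 (b, i, t)) ^ 2}
  have hBm : ∀ b j, MeasurableSet (B b j) := by
    intro b j
    have h1 : ∀ i, Measurable fun p : (Fin n × Fin n → ℝ) × (Fin N × Fin n × Fin q → ℝ) =>
        y p.1 j i := fun i => (hy j i).comp measurable_fst
    refine measurableSet_lt ?_ ?_
    · exact (Finset.measurable_sum _ fun i _ => (h1 i).pow_const 2).const_mul _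
    · refine Finset.measurable_sum _ fun t _ => (Finset.measurable_sum _ fun i _ =>
        (h1 i).mul ?_).pow_const 2
      fun_prop
  -- By independence the joint law is a product: for a frozen noise matrix the linear form is
  -- deterministic, and the Gaussian tail bound is integrated over the noise.
  have hprod : ∀ b j, P.map (fun ω => ((fun p : Fin n × Fin n => E ω p.1 p.2),
      fun p : Fin N × Fin n × Fin q => G ω p.1 p.2.1 p.2.2)) (B b j) ≤
      ENNReal.ofReal (Real.exp (q / 2 - s ^ 2 / 4)) := by
    intro b j
    rw [hmap, h.law.map_eq, Measure.prod_apply (hBm b j)]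
    have : IsProbabilityMeasure (P.map fun ω (p : Fin n × Fin n) => E ω p.1 p.2) :=
      Measure.isProbabilityMeasure_map hEm.aemeasurable
    refine (lintegral_mono (g := fun _ => ENNReal.ofReal (Real.exp (q / 2 - s ^ 2 / 4)))
      fun e => ?_).trans (by simp)
    exact gaussPi_sketch_tail (y e j) b (s ^ 2)
  have hsub : {ω | ¬ ∀ b j, rowNorm (Y (E ω) * G ω b) j ≤ s * rowNorm (Y (E ω)) j} ⊆
      ⋃ b, ⋃ j, (fun ω => ((fun p : Fin n × Fin n => E ω p.1 p.2),
      fun p : Fin N × Fin n × Fin q => G ω p.1 p.2.1 p.2.2)) ⁻¹' (B b j) := by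
    intro ω hω
    simp only [Set.mem_ofPred_eq, not_forall, not_le] at hω
    obtain ⟨b, j, hbj⟩ := hω
    refine Set.mem_iUnion.2 ⟨b, Set.mem_iUnion.2 ⟨j, ?_⟩⟩
    change s ^ 2 * ∑ i, Y (E ω) j i ^ 2 < ∑ t, ((Y (E ω) * G ω b) j t) ^ 2
    rw [← rowNorm_sq, ← rowNorm_sq, ← mul_pow]
    exact pow_lt_pow_left₀ hbj (mul_nonneg hs (rowNorm_nonneg _ _)) two_ne_zero
  refine (measure_mono hsub).trans ((measure_iUnion_fintype_le _ _).trans ?_)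
  have hb : ∀ b ∈ Finset.univ, P (⋃ j, (fun ω => ((fun p : Fin n × Fin n => E ω p.1 p.2),
      fun p : Fin N × Fin n × Fin q => G ω p.1 p.2.1 p.2.2)) ⁻¹' (B b j)) ≤
      m * ENNReal.ofReal (Real.exp (q / 2 - s ^ 2 / 4)) := by
    intro b _
    refine (measure_iUnion_fintype_le _ _).trans ?_
    refine (Finset.sum_le_sum fun j _ => (le_of_eq (Measure.map_apply_of_aemeasurable
      (hEm.aemeasurable.prodMk hGm) (hBm b j)).symm).trans (hprod b j)).trans ?_
    simp
  refine (Finset.sum_le_sum hb).trans (le_of_eq ?_)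
  rw [Finset.sum_const, Finset.card_univ, Fintype.card_fin, nsmul_eq_mul,
    ENNReal.ofReal_mul (by positivity), ENNReal.ofReal_mul (by positivity), ENNReal.ofReal_natCast,
    ENNReal.ofReal_natCast]
  ring

/-- An upper bound suffices for bad events, and it needs no measurability of `s`. -/
theorem IsGaussianSketch.measure_eq {Ω : Type*} [MeasurableSpace Ω]
    {P : Measure Ω} {n q N : ℕ}
    {E : Ω → Matrix (Fin n) (Fin n) ℝ} {G : Ω → Fin N → Matrix (Fin n) (Fin q) ℝ}
    (h : IsGaussianSketch P E G) (s : Set (Fin N × Fin n × Fin q → ℝ)) :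
    P {ω | (fun p : Fin N × Fin n × Fin q => G ω p.1 p.2.1 p.2.2) ∈ s} ≤
      gaussPi (Fin N × Fin n × Fin q) s := by
  rw [gaussPi, ← h.law.map_eq]
  exact Measure.le_map_apply h.law.aemeasurable s

/-! ### The randomized SVD on a good event -/

section Output

variable {n k q N g : ℕ} {U : Matrix (Fin n) (Fin k) ℝ} {Λ Λi : Matrix (Fin k) (Fin k) ℝ}
  {E : Matrix (Fin n) (Fin n) ℝ} {G : Fin N → Matrix (Fin n) (Fin q) ℝ} {ψ T d : ℝ}

/-- As `‖Λ‖ ≤ 1`, each step of the forward recursion adds an error of at most `d`. The compressed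
sketch of the power is thus close to `Λ ^ g` applied to the compressed sketch. -/
theorem norm_transpose_mul_pow_sub_le {X : Matrix (Fin n) (Fin q) ℝ} (hU : Uᵀ * U = 1)
    (hΛ : ‖Λ‖ ≤ 1) (hd : ∀ s < g, ‖Uᵀ * E * (U * Λ * Uᵀ + E) ^ s * X‖ ≤ d) :
    ∀ s ≤ g, ‖Uᵀ * (U * Λ * Uᵀ + E) ^ s * X - Λ ^ s * (Uᵀ * X)‖ ≤ s * d := by
  intro s
  induction s with
  | zero => intro _; simp
  | succ s ih =>
    intro hs
    have h1 : Uᵀ * (U * Λ * Uᵀ + E) ^ (s + 1) * X - Λ ^ (s + 1) * (Uᵀ * X) =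
        Λ * (Uᵀ * (U * Λ * Uᵀ + E) ^ s * X - Λ ^ s * (Uᵀ * X)) +
          Uᵀ * E * (U * Λ * Uᵀ + E) ^ s * X := by
      rw [transpose_mul_pow_succ U Λ E X hU, Matrix.mul_sub, pow_succ' Λ, Matrix.mul_assoc Λ]
      abel
    rw [h1]
    refine (norm_add_le _ _).trans ?_
    have h2 := norm_mul_le_of_le hΛ (ih (by omega))
    have h3 := hd s (by omega)
    push_cast
    linarith

/-- The output of the randomized SVD is the power iteration applied to a well-scaled
combination of the columns of one of the sketches. -/
theorem IsRSVDOutput.exists_eq_mul {S : ℝ} (hS : 0 < S) (hk : 1 ≤ k) (hkq : k ≤ q)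
    (hU : Uᵀ * U = 1) (hΛi : Λi * Λ = 1) (hΛ : ‖Λ‖ ≤ 1) (hΛin : ‖Λi‖ ≤ ψ) (hψ : 1 ≤ ψ)
    (hT : 0 < T) (hd : ∀ b, ∀ s < g, ‖Uᵀ * E * (U * Λ * Uᵀ + E) ^ s * G b‖ ≤ d)
    (hsmall : 2 * ψ ^ g * (g * d) ≤ T) (hwell : ∃ b, IsWellConditioned T (Uᵀ * G b))
    {Uh : Matrix (Fin n) (Fin k) ℝ} (h : IsRSVDOutput g (S • (U * Λ * Uᵀ + E)) G Uh) :
    Uhᵀ * Uh = 1 ∧ ∃ b, ∃ R : Matrix (Fin q) (Fin k) ℝ,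
      Uh = (U * Λ * Uᵀ + E) ^ g * (G b * R) ∧ ‖R‖ ≤ 2 * ψ ^ g / T := by
  obtain ⟨b, hmax, hlead⟩ := h
  refine ⟨hlead.transpose_mul_self, b, ?_⟩
  obtain ⟨b0, hb0⟩ := hwell
  have hψg : 0 < ψ ^ g := by positivity
  -- The noiseless singular value is at least `S ^ g * T / ψ ^ g`; half of it is given up to the
  -- perturbation, by `hsmall`.
  set τ : ℝ := S ^ g * (T / (2 * ψ ^ g)) with hτ
  have hτ0 : 0 < τ := by positivity
  have hsv0 : τ ≤ sv ((S • (U * Λ * Uᵀ + E)) ^ g * G b0) (k - 1) := by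
    refine le_sv_of_le_norm_transpose_mulVec hk _ U (norm_le_one_of_orthonormal hU) τ fun x => ?_
    set Mh := U * Λ * Uᵀ + E with hMh
    have h1 : ((S • Mh) ^ g * G b0)ᵀ *ᵥ (U *ᵥ x) = S ^ g • ((Uᵀ * Mh ^ g * G b0)ᵀ *ᵥ x) := by
      rw [smul_pow, Matrix.smul_mul, transpose_smul, smul_mulVec, mulVec_mulVec]
      congr 2
      rw [Matrix.mul_assoc, transpose_mul, transpose_mul, transpose_mul, transpose_transpose,
        Matrix.mul_assoc]
    set Δ := Uᵀ * Mh ^ g * G b0 - Λ ^ g * (Uᵀ * G b0) with hΔ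
    have hΔn : ‖Δ‖ ≤ g * d := norm_transpose_mul_pow_sub_le hU hΛ (hd b0) g le_rfl
    have h2 : (Uᵀ * Mh ^ g * G b0)ᵀ *ᵥ x =
        (Uᵀ * G b0)ᵀ *ᵥ ((Λ ^ g)ᵀ *ᵥ x) + Δᵀ *ᵥ x := by
      rw [mulVec_mulVec, ← transpose_mul, ← add_mulVec, ← transpose_add, hΔ, add_sub_cancel]
    set nx := ‖(WithLp.toLp 2 x : EuclideanSpace ℝ (Fin k))‖ with hnx
    have h3 : nx ≤ ψ ^ g * ‖(WithLp.toLp 2 ((Λ ^ g)ᵀ *ᵥ x) : EuclideanSpace ℝ (Fin k))‖ := by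
      have hcomm : Λ * Λi = 1 := mul_eq_one_comm.1 hΛi
      have hpow : Λ ^ g * Λi ^ g = 1 := by
        rw [← Commute.mul_pow (show Commute Λ Λi from hcomm.trans hΛi.symm), hcomm, one_pow]
      have hx : x = (Λi ^ g)ᵀ *ᵥ ((Λ ^ g)ᵀ *ᵥ x) := by
        rw [mulVec_mulVec, ← transpose_mul, hpow, transpose_one, one_mulVec]
      conv_lhs => rw [hnx, hx]
      refine (norm_mulVec_le _ _).trans ?_
      rw [norm_transpose_eq]
      gcongr
      exact norm_pow_le_of_le hΛin g
    have h4 := hb0 ((Λ ^ g)ᵀ *ᵥ x)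
    have h5 : ‖(WithLp.toLp 2 (Δᵀ *ᵥ x) : EuclideanSpace ℝ (Fin q))‖ ≤ g * d * nx := by
      refine (norm_mulVec_le _ _).trans ?_
      rw [norm_transpose_eq]
      gcongr
    have h6 : ‖(WithLp.toLp 2 ((Uᵀ * G b0)ᵀ *ᵥ ((Λ ^ g)ᵀ *ᵥ x)) : EuclideanSpace ℝ (Fin q))‖ -
        ‖(WithLp.toLp 2 (Δᵀ *ᵥ x) : EuclideanSpace ℝ (Fin q))‖ ≤
        ‖(WithLp.toLp 2 ((Uᵀ * Mh ^ g * G b0)ᵀ *ᵥ x) : EuclideanSpace ℝ (Fin q))‖ := by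
      rw [h2, WithLp.toLp_add]
      exact norm_sub_le_norm_add _ _
    have hnx0 : 0 ≤ nx := norm_nonneg _
    have h7 : T / (2 * ψ ^ g) * nx ≤
        ‖(WithLp.toLp 2 ((Uᵀ * Mh ^ g * G b0)ᵀ *ᵥ x) : EuclideanSpace ℝ (Fin q))‖ := by
      have e1 : T / ψ ^ g * nx ≤
          T * ‖(WithLp.toLp 2 ((Λ ^ g)ᵀ *ᵥ x) : EuclideanSpace ℝ (Fin k))‖ := by
        rw [div_mul_eq_mul_div, div_le_iff₀ hψg]
        nlinarith
      have e2 : (g : ℝ) * d ≤ T / (2 * ψ ^ g) := by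
        rw [le_div_iff₀ (by positivity)]; linarith
      have e3 : (g : ℝ) * d * nx ≤ T / (2 * ψ ^ g) * nx := by gcongr
      have e4 : T / ψ ^ g = T / (2 * ψ ^ g) + T / (2 * ψ ^ g) := by field_simp; norm_num
      rw [e4] at e1
      linarith
    rw [h1, WithLp.toLp_smul, norm_smul, Real.norm_eq_abs, abs_of_pos (by positivity), hτ,
      mul_assoc]
    gcongr
  -- The selection rule enters here: the chosen sketch inherits the lower bound proved for the
  -- well-conditioned sketch `b0`.
  obtain ⟨R, hR, hRn⟩ := hlead.exists_eq_mul hkq hτ0 (hsv0.trans (hmax b0))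
  refine ⟨S ^ g • R, ?_, ?_⟩
  · rw [hR, smul_pow, Matrix.smul_mul, Matrix.smul_mul, Matrix.mul_smul, Matrix.mul_smul,
      Matrix.mul_assoc]
  · rw [norm_smul, Real.norm_eq_abs, abs_of_pos (by positivity)]
    calc S ^ g * ‖R‖ ≤ S ^ g * τ⁻¹ := by gcongr
      _ = _ := by rw [hτ]; field_simp

end Output

/-- First-order expansion of a row of the output of the randomized SVD, on a good event. -/
theorem exists_rsvd_rowNorm_expansion_le (ψ : ℝ) (k g : ℕ) (hk : 1 ≤ k) (hg : 3 ≤ g)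
    (hψ : 1 ≤ ψ) :
    ∃ K : ℝ, 0 ≤ K ∧ ∀ {n q N : ℕ} (U : Matrix (Fin n) (Fin k) ℝ)
      (Λ Λi W : Matrix (Fin k) (Fin k) ℝ) (E : Matrix (Fin n) (Fin n) ℝ)
      (G : Fin N → Matrix (Fin n) (Fin q) ℝ) (Uh : Matrix (Fin n) (Fin k) ℝ)
      (S ε κ T μ L : ℝ) (i : Fin n),
      k ≤ q → 0 < S → Uᵀ * U = 1 → Λi * Λ = 1 → ‖Λ‖ ≤ 1 → ‖Λi‖ ≤ ψ →
      0 ≤ ε → ε ≤ 1 → ‖E‖ ≤ ε → 0 < T → 0 ≤ κ →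
      (∀ s < g, ∀ b j, rowNorm (Uᵀ * E * (U * Λ * Uᵀ + E) ^ s * G b) j ≤
        κ * T * rowNorm (Uᵀ * E * (U * Λ * Uᵀ + E) ^ s) j) →
      (∀ s < g, ∀ b j, rowNorm (Uᵀ * E ^ (s + 1) * G b) j ≤
        κ * T * rowNorm (Uᵀ * E ^ (s + 1)) j) →
      (∀ b j, rowNorm (E ^ g * G b) j ≤ κ * T * rowNorm (E ^ g) j) →
      (∃ b, IsWellConditioned T (Uᵀ * G b)) →
      2 * ψ ^ g * g * (√k * 2 ^ g) * (κ * ε) ≤ 1 →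
      2 * ψ ^ g * (√n * κ * ε ^ (g - 1)) ≤ 1 →
      0 ≤ μ → μ ≤ 1 → 1 ≤ L → L * ε ≤ 1 →
      rowNorm U i ≤ μ →
      (∀ r, 1 ≤ r → r < g → rowNorm (E ^ r * U) i ≤ (L * ε) ^ r * μ) →
      IsRSVDOutput g (S • (U * Λ * Uᵀ + E)) G Uh → IsProcrustes Uh U W →
      rowNorm (Uh * Wᵀ - U - E * U * Λi) i ≤
        K * (μ * ‖Uᵀ * E * U‖ + (L * ε) ^ 2 * μ + κ * ε ^ g) := by
  obtain ⟨K, hK, hmain⟩ := exists_rowNorm_expansion_le ψ (√k + 2) g hg hψ (by positivity)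
  -- Here `2 * ψ ^ g` stems from the norm of `R`, `√k` from the passage from rows to the norm of a
  -- matrix with `k` rows, and `2 ^ g` from `‖M + E‖ ≤ 2` after scaling.
  set a : ℝ := 2 * ψ ^ g * (√k * 2 ^ g) with ha
  have hk1 : (1 : ℝ) ≤ √k := by
    rw [Real.one_le_sqrt]; exact_mod_cast hk
  have hψg : 1 ≤ ψ ^ g := one_le_pow₀ hψ
  have h2g : (1 : ℝ) ≤ 2 ^ g := one_le_pow₀ (by norm_num)
  have hk2 : 1 ≤ √k * 2 ^ g := by nlinarith
  have ha1 : 1 ≤ a := by rw [ha]; nlinarith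
  refine ⟨K * a, by positivity, ?_⟩
  intro n q N U Λ Λi W E G Uh S ε κ T μ L i hkq hS hU hΛi hΛ hΛin hε0 hε1 hE hT hκ he1 he2 he3 he4
    hsm1 hsm2 hμ hμ1 hL hLε hUi hrow hout hproc
  have hUt : ‖Uᵀ‖ ≤ 1 := by rw [norm_transpose_eq]; exact norm_le_one_of_orthonormal hU
  have hUn : ‖U‖ ≤ 1 := norm_le_one_of_orthonormal hU
  have hMh : ‖U * Λ * Uᵀ + E‖ ≤ 2 := by
    refine (norm_add_le _ _).trans ?_
    have := norm_mul_le_of_le (norm_mul_le_of_le hUn hΛ) hUt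
    linarith
  have hg1 : (1 : ℝ) ≤ g := by exact_mod_cast (by omega : 1 ≤ g)
  have hκT : 0 ≤ κ * T := by positivity
  have hbound : ∀ (Y : Matrix (Fin k) (Fin n) ℝ) (c : ℝ), ‖Y‖ ≤ c →
      (∀ b j, rowNorm (Y * G b) j ≤ κ * T * rowNorm Y j) → ∀ b, ‖Y * G b‖ ≤ √k * (κ * T * c) := by
    intro Y c hY h b
    have hc : 0 ≤ c := (norm_nonneg _).trans hY
    have := norm_le_sqrt_card_mul (Y * G b) (b := κ * T * c) (by positivity) fun j =>
      (h b j).trans (by gcongr; exact (rowNorm_le_norm Y j).trans hY)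
    rwa [Fintype.card_fin] at this
  have hn1 : ∀ s < g, ‖Uᵀ * E * (U * Λ * Uᵀ + E) ^ s‖ ≤ ε * 2 ^ g := by
    intro s hs
    refine (norm_mul_le_of_le (norm_mul_le_of_le hUt hE) (norm_pow_le_of_le hMh s)).trans ?_
    have : (2 : ℝ) ^ s ≤ 2 ^ g := pow_le_pow_right₀ (by norm_num) hs.le
    rw [one_mul]
    gcongr
  have hn2 : ∀ s, ‖Uᵀ * E ^ (s + 1)‖ ≤ ε ^ (s + 1) := fun s => by
    simpa using norm_mul_le_of_le hUt (norm_pow_le_of_le hE (s + 1))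
  have hb1 : ∀ s < g, ∀ b, ‖Uᵀ * E * (U * Λ * Uᵀ + E) ^ s * G b‖ ≤
      √k * (κ * T * (ε * 2 ^ g)) := fun s hs => hbound _ _ (hn1 s hs) (he1 s hs)
  have hb2 : ∀ s < g, ∀ b, ‖Uᵀ * E ^ (s + 1) * G b‖ ≤ √k * (κ * T * ε ^ (s + 1)) :=
    fun s hs => hbound _ _ (hn2 s) (he2 s hs)
  have hgn : ‖E ^ g‖ ≤ ε ^ g := norm_pow_le_of_le hE g
  have hb3i : ∀ b j, rowNorm (E ^ g * G b) j ≤ κ * T * ε ^ g := fun b j =>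
    (he3 b j).trans (by gcongr; exact (rowNorm_le_norm _ j).trans hgn)
  have hb3 : ∀ b, ‖E ^ g * G b‖ ≤ √n * (κ * T * ε ^ g) := by
    intro b
    have := norm_le_sqrt_card_mul (E ^ g * G b) (by positivity) (hb3i b)
    rwa [Fintype.card_fin] at this
  obtain ⟨hUhU, b, R, hUh, hR⟩ := hout.exists_eq_mul hS hk hkq hU hΛi hΛ hΛin hψ hT
    (fun b s hs => hb1 s hs b) (by
      calc 2 * ψ ^ g * (g * (√k * (κ * T * (ε * 2 ^ g)))) =
          2 * ψ ^ g * g * (√k * 2 ^ g) * (κ * ε) * T := by ring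
        _ ≤ 1 * T := by gcongr
        _ = T := one_mul T) he4
  have hTne : T ≠ 0 := hT.ne'
  -- The expansion is applied to `Q = G b * R` with `τ = a * κ`. The level `T` cancels between the
  -- sketch bounds `κ * T` and `‖R‖ ≤ 2 * ψ ^ g / T`.
  have hfin := hmain (n := Fin n) (k := Fin k) U Λ Λi W E (G b * R) Uh ε (a * κ) μ L i hU hΛi hΛ
    hΛin hε0 hε1 hE hUh hUhU
    (by positivity) (by
      have hx : 0 ≤ κ * ε * (2 * ψ ^ g * (√k * 2 ^ g)) := by positivity
      calc a * κ * ε = 1 * (κ * ε * (2 * ψ ^ g * (√k * 2 ^ g))) := by rw [ha]; ring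
        _ ≤ g * (κ * ε * (2 * ψ ^ g * (√k * 2 ^ g))) := by gcongr
        _ = 2 * ψ ^ g * g * (√k * 2 ^ g) * (κ * ε) := by ring
        _ ≤ 1 := hsm1) (fun s hs => by
      rw [← Matrix.mul_assoc]
      refine (norm_mul_le_of_le (hb1 s hs b) hR).trans ?_
      have hx : 0 ≤ κ * ε * (2 * ψ ^ g * (√k * 2 ^ g)) := by positivity
      calc √k * (κ * T * (ε * 2 ^ g)) * (2 * ψ ^ g / T) =
            1 * (κ * ε * (2 * ψ ^ g * (√k * 2 ^ g))) := by field_simp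
        _ ≤ g * (κ * ε * (2 * ψ ^ g * (√k * 2 ^ g))) := by gcongr
        _ = 2 * ψ ^ g * g * (√k * 2 ^ g) * (κ * ε) := by ring
        _ ≤ 1 := hsm1) (fun s hs => by
      rw [← Matrix.mul_assoc]
      refine (norm_mul_le_of_le (hb2 s hs b) hR).trans ?_
      have hx : 0 ≤ √k * κ * ε ^ (s + 1) * (2 * ψ ^ g) := by positivity
      calc √k * (κ * T * ε ^ (s + 1)) * (2 * ψ ^ g / T) =
            √k * κ * ε ^ (s + 1) * (2 * ψ ^ g) * 1 := by field_simp
        _ ≤ √k * κ * ε ^ (s + 1) * (2 * ψ ^ g) * 2 ^ g := by gcongr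
        _ = a * κ * ε ^ (s + 1) := by rw [ha]; ring) (by
      rw [← Matrix.mul_assoc]
      refine (norm_mul_le_of_le (hb3 b) hR).trans ?_
      have hgs : ε ^ g = ε ^ (g - 1) * ε := by
        rw [← pow_succ]; congr 1; omega
      calc √n * (κ * T * ε ^ g) * (2 * ψ ^ g / T) =
            2 * ψ ^ g * (√n * κ * ε ^ (g - 1)) * ε := by rw [hgs]; field_simp
        _ ≤ 1 * ε := by gcongr
        _ = ε := one_mul _) (by
      rw [← Matrix.mul_assoc]
      refine (rowNorm_mul_le _ _ _).trans ?_
      have hx : 0 ≤ κ * ε ^ g * (2 * ψ ^ g) := by positivity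
      calc rowNorm (E ^ g * G b) i * ‖R‖ ≤ κ * T * ε ^ g * (2 * ψ ^ g / T) :=
            mul_le_mul (hb3i b i) hR (norm_nonneg _) (by positivity)
        _ = κ * ε ^ g * (2 * ψ ^ g) * 1 := by field_simp
        _ ≤ κ * ε ^ g * (2 * ψ ^ g) * (√k * 2 ^ g) := by gcongr
        _ = a * κ * ε ^ g := by rw [ha]; ring)
    hμ hμ1 hL hLε hUi hrow
    ((Matrix.mem_orthogonalGroup_iff _ _).1 hproc.1) (hproc.norm_sub_le hU hUhU)
  refine hfin.trans ?_
  rw [mul_assoc K a, mul_assoc a κ]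
  refine mul_le_mul_of_nonneg_left ?_ hK
  have h1 : 0 ≤ μ * ‖Uᵀ * E * U‖ := by positivity
  have h2 : 0 ≤ (L * ε) ^ 2 * μ := by positivity
  nlinarith

/-! ### Convergence in distribution on varying probability spaces -/

/-- Slutsky's theorem for random variables on varying probability spaces. -/
theorem tendstoInDistribution_of_sub {Ω : ℕ → Type*} [∀ n, MeasurableSpace (Ω n)]
    {P : ∀ n, Measure (Ω n)} [∀ n, IsProbabilityMeasure (P n)] {F Ω' : Type*}
    [NormedAddCommGroup F] [MeasurableSpace F] [BorelSpace F] [SecondCountableTopology F]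
    [MeasurableSpace Ω'] {ν : Measure Ω'} [IsProbabilityMeasure ν]
    {X Y : ∀ n, Ω n → F} {Z : Ω' → F}
    (hX : TendstoInDistribution X atTop Z P ν) (hY : ∀ n, AEMeasurable (Y n) (P n))
    (h : ∀ ε : ℝ, 0 < ε → Tendsto (fun n => P n {ω | ε ≤ ‖Y n ω - X n ω‖}) atTop (𝓝 0)) :
    TendstoInDistribution Y atTop Z P ν := by
  -- All variables are carried to one product space through the coordinate maps. This preserves
  -- their laws and the probabilities of `ε ≤ ‖Y n - X n‖`, so Slutsky's theorem on a single space
  -- applies.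
  let Q := Measure.infinitePi P
  have hev : ∀ n, MeasurePreserving (Function.eval n) Q (P n) := fun n =>
    measurePreserving_eval_infinitePi P n
  have hXm := hX.forall_aemeasurable
  have hmapX : ∀ n, Q.map (fun ω => X n (ω n)) = (P n).map (X n) := fun n => by
    rw [← (hev n).map_eq, AEMeasurable.map_map_of_aemeasurable _ (hev n).aemeasurable]
    · rfl
    · rw [(hev n).map_eq]; exact hXm n
  have hmapY : ∀ n, Q.map (fun ω => Y n (ω n)) = (P n).map (Y n) := fun n => by
    rw [← (hev n).map_eq, AEMeasurable.map_map_of_aemeasurable _ (hev n).aemeasurable]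
    · rfl
    · rw [(hev n).map_eq]; exact hY n
  have hYQ : ∀ n, AEMeasurable (fun ω => Y n (ω n)) Q := fun n =>
    (hY n).comp_quasiMeasurePreserving (hev n).quasiMeasurePreserving
  have h1 : TendstoInDistribution (fun n (ω : ∀ n, Ω n) => X n (ω n)) atTop Z (fun _ => Q) ν := by
    refine ⟨fun n => (hXm n).comp_quasiMeasurePreserving (hev n).quasiMeasurePreserving, hX.aemeasurable_limit, ?_⟩
    simpa only [hmapX] using hX.tendsto
  have h2 : TendstoInDistribution (fun n (ω : ∀ n, Ω n) => Y n (ω n)) atTop Z (fun _ => Q) ν := by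
    refine tendstoInDistribution_of_tendstoInMeasure_sub _ Z h1 ?_ hYQ
    rw [tendstoInMeasure_iff_norm]
    intro ε hε
    refine (h ε hε).congr fun n => ?_
    have hs : NullMeasurableSet {ω | ε ≤ ‖Y n ω - X n ω‖} (P n) :=
      nullMeasurableSet_le aemeasurable_const ((hY n).sub (hXm n)).norm
    have := (hev n).measure_preimage hs
    rw [← this]
    simp
  refine ⟨hY, hX.aemeasurable_limit, ?_⟩
  simpa only [hmapY] using h2.tendsto

/-! ### Matrices -/

/-- The hypothesis places the spectrum of `Γ` in `[c, ∞)`, where the function defining `invSqrt` is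
at most `(√c)⁻¹`. -/
theorem norm_invSqrt_le {k : ℕ} {Γ : Matrix (Fin k) (Fin k) ℝ} {c : ℝ} (hc : 0 < c)
    (h : (Γ - c • (1 : Matrix (Fin k) (Fin k) ℝ)).PosSemidef) : ‖invSqrt Γ‖ ≤ (√c)⁻¹ := by
  refine norm_cfc_le (by positivity) fun x hx => ?_
  have hcx : c ≤ x := by
    have h1 : x - c ∈ spectrum ℝ (Γ - c • (1 : Matrix (Fin k) (Fin k) ℝ)) := by
      rw [← Algebra.algebraMap_eq_smul_one, ← spectrum.sub_singleton_eq]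
      exact Set.sub_mem_sub hx rfl
    have h2 : 0 ≤ x - c := (posSemidef_iff_isHermitian_and_spectrum_nonneg.1 h).2 h1
    linarith
  rw [Real.norm_of_nonneg (by positivity)]
  gcongr

theorem twoInfNorm_eq {m n : ℕ} (A : Matrix (Fin m) (Fin n) ℝ) :
    twoInfNorm A = ⨆ i, rowNorm A i := by
  simp only [twoInfNorm, rowNorm_eq_sqrt]

theorem rowNorm_le_twoInfNorm {m n : ℕ} (A : Matrix (Fin m) (Fin n) ℝ) (i : Fin m) :
    rowNorm A i ≤ twoInfNorm A := by
  rw [twoInfNorm_eq]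
  exact le_ciSup (Set.finite_range _).bddAbove i

theorem twoInfNorm_nonneg {m n : ℕ} (A : Matrix (Fin m) (Fin n) ℝ) : 0 ≤ twoInfNorm A :=
  Real.iSup_nonneg fun _ => Real.sqrt_nonneg _

theorem twoInfNorm_le_norm {m n : ℕ} (A : Matrix (Fin m) (Fin n) ℝ) : twoInfNorm A ≤ ‖A‖ := by
  rw [twoInfNorm_eq]
  exact Real.iSup_le (rowNorm_le_norm A) (norm_nonneg _)

theorem abs_entry_le_rowNorm {m n : Type*} [Fintype n] (A : Matrix m n ℝ) (i : m) (j : n) :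
    |A i j| ≤ rowNorm A i :=
  PiLp.norm_apply_le (WithLp.toLp 2 (A i) : EuclideanSpace ℝ n) j

theorem norm_col_le_twoInfNorm {m n : ℕ} (A : Matrix (Fin m) (Fin n) ℝ) (j : Fin n) :
    ‖Aᵀ j‖ ≤ twoInfNorm A :=
  (pi_norm_le_iff_of_nonneg (twoInfNorm_nonneg A)).2 fun i =>
    (abs_entry_le_rowNorm A i j).trans (rowNorm_le_twoInfNorm A i)

namespace IsEigendecomposition

variable {n k : ℕ} {M : Matrix (Fin n) (Fin n) ℝ} {U : Matrix (Fin n) (Fin k) ℝ}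
  {lam : Fin k → ℝ}

theorem norm_diagonal_le (h : IsEigendecomposition M U lam) : ‖diagonal lam‖ ≤ ‖M‖ := by
  have h1 : diagonal lam = Uᵀ * M * U := by
    have : Uᵀ * M * U = (Uᵀ * U) * diagonal lam * (Uᵀ * U) := by
      rw [h.eq_mul]; simp only [Matrix.mul_assoc]
    rw [this, h.orthonormal, Matrix.one_mul, Matrix.mul_one]
  have hU := norm_le_one_of_orthonormal h.orthonormal
  have hUt : ‖Uᵀ‖ ≤ 1 := by rwa [norm_transpose_eq]
  rw [h1]
  have := norm_mul_le_of_le (norm_mul_le_of_le hUt (le_refl ‖M‖)) hU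
  simpa using this

theorem norm_le_norm_diagonal (h : IsEigendecomposition M U lam) : ‖M‖ ≤ ‖diagonal lam‖ := by
  have hU := norm_le_one_of_orthonormal h.orthonormal
  have hUt : ‖Uᵀ‖ ≤ 1 := by rwa [norm_transpose_eq]
  have := norm_mul_le_of_le (norm_mul_le_of_le hU (le_refl ‖diagonal lam‖)) hUt
  rw [← h.eq_mul] at this
  simpa using this

theorem inv_diagonal_mul (h : IsEigendecomposition M U lam) :
    (diagonal lam)⁻¹ * diagonal lam = 1 := by
  refine Matrix.nonsing_inv_mul _ ?_
  rw [det_diagonal, isUnit_iff_ne_zero]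
  exact Finset.prod_ne_zero_iff.2 fun j _ => h.ne_zero j

theorem inv_diagonal (h : IsEigendecomposition M U lam) :
    (diagonal lam)⁻¹ = diagonal fun j => (lam j)⁻¹ := by
  refine Matrix.inv_eq_left_inv ?_
  rw [diagonal_mul_diagonal, ← diagonal_one]
  congr 1
  ext j
  exact inv_mul_cancel₀ (h.ne_zero j)

theorem norm_pos (h : IsEigendecomposition M U lam) (hk : 1 ≤ k) : 0 < ‖M‖ := by
  refine lt_of_lt_of_le ?_ h.norm_diagonal_le
  rw [l2_opNorm_diagonal]
  exact (abs_pos.2 (h.ne_zero ⟨0, hk⟩)).trans_le (norm_le_pi_norm lam ⟨0, hk⟩)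

theorem norm_inv_diagonal_le (h : IsEigendecomposition M U lam) (hk : 1 ≤ k) {B : ℝ} (hB0 : 0 ≤ B)
    (hB : condNumber hk lam ≤ B) : ‖(diagonal lam)⁻¹‖ ≤ B / ‖M‖ := by
  have hM := h.norm_pos hk
  rw [h.inv_diagonal, l2_opNorm_diagonal]
  refine (pi_norm_le_iff_of_nonneg (by positivity)).2 fun j => ?_
  have hM1 : ‖M‖ ≤ |lam ⟨0, hk⟩| := by
    refine h.norm_le_norm_diagonal.trans ?_
    rw [l2_opNorm_diagonal]
    exact (pi_norm_le_iff_of_nonneg (abs_nonneg _)).2 fun i =>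
      h.antitone (Fin.mk_le_of_le_val (Nat.zero_le _))
  have hlast : |lam ⟨k - 1, Nat.sub_lt hk Nat.one_pos⟩| ≤ |lam j| :=
    h.antitone (Fin.le_def.2 (Nat.le_sub_one_of_lt j.isLt))
  have hl0 := abs_pos.2 (h.ne_zero ⟨k - 1, Nat.sub_lt hk Nat.one_pos⟩)
  rw [condNumber, abs_div, div_le_iff₀ hl0] at hB
  rw [norm_inv, Real.norm_eq_abs, le_div_iff₀ hM, inv_mul_le_iff₀ (abs_pos.2 (h.ne_zero j)),
    mul_comm]
  exact hM1.trans (hB.trans (by gcongr))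

end IsEigendecomposition

/-! ### Probabilities of the bad events -/

theorem measure_compl_le_of_one_sub_le {Ω : Type*} [MeasurableSpace Ω] {P : Measure Ω}
    [IsProbabilityMeasure P] {s : Set Ω} (hs : MeasurableSet s) {η : ℝ} (h : 1 - η ≤ P.real s) :
    P sᶜ ≤ ENNReal.ofReal η := by
  rw [← ENNReal.ofReal_toReal (measure_ne_top P sᶜ)]
  refine ENNReal.ofReal_le_ofReal ?_
  have := probReal_compl_eq_one_sub (μ := P) hs
  simp only [Measure.real] at this h ⊢
  linarith

/-- A continuous function of a matrix with measurable entries is measurable. -/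
theorem measurable_comp_matrix {Ω : Type*} [MeasurableSpace Ω] {m n : Type*} [Fintype m] [Fintype n]
    {E : Ω → Matrix m n ℝ} (hE : ∀ i j, Measurable fun ω => E ω i j)
    {f : Matrix m n ℝ → ℝ} (hf : Continuous f) : Measurable fun ω => f (E ω) := by
  have h1 : Continuous fun e : m × n → ℝ => f (Matrix.of fun i j => e (i, j)) :=
    hf.comp (by fun_prop)
  exact h1.measurable.comp (measurable_pi_lambda _ fun p : m × n => hE p.1 p.2)

theorem measurableSet_norm_le {Ω : Type*} [MeasurableSpace Ω] {m n : Type*} [Fintype m] [Fintype n]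
    [DecidableEq n] {E : Ω → Matrix m n ℝ} (hE : ∀ i j, Measurable fun ω => E ω i j) (c : ℝ) :
    MeasurableSet {ω | ‖E ω‖ ≤ c} :=
  measurableSet_le (measurable_comp_matrix hE continuous_norm) measurable_const

/-- Concentration of the vectors `E ^ r u` controls the rows of `E ^ r U`. -/
theorem measure_rowNorm_pow_mul_gt_le {Ω : Type*} [MeasurableSpace Ω] {P : Measure Ω}
    [IsProbabilityMeasure P] {n k g : ℕ} {E : Ω → Matrix (Fin n) (Fin n) ℝ}
    (hE : ∀ i j, Measurable fun ω => E ω i j) (U : Matrix (Fin n) (Fin k) ℝ) {c η : ℝ}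
    {b : ℕ → ℝ} (hb : ∀ r, 0 ≤ b r)
    (hc : ∀ r, 1 ≤ r → r < g → √k * b r ≤ c ^ r)
    (h : ∀ r, 1 ≤ r → r < g → ∀ u : Fin n → ℝ,
      1 - η ≤ P.real {ω | ∀ i, |((E ω ^ r) *ᵥ u) i| ≤ b r * ‖u‖}) :
    P {ω | ¬ ∀ r, 1 ≤ r → r < g → ∀ i, rowNorm (E ω ^ r * U) i ≤ c ^ r * twoInfNorm U} ≤
      (g * k : ℕ) • ENNReal.ofReal η := by
  -- Failure of concentration for the column `j` of `U`, whose maximum norm is at most `twoInfNorm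
  -- U`. Combining the `k` columns into a row costs the factor `√k`.
  let A : ℕ → Fin k → Set Ω := fun r j =>
    if 1 ≤ r then {ω | ∀ i, |((E ω ^ r) *ᵥ Uᵀ j) i| ≤ b r * ‖Uᵀ j‖}ᶜ else ∅
  have hsub : {ω | ¬ ∀ r, 1 ≤ r → r < g → ∀ i, rowNorm (E ω ^ r * U) i ≤ c ^ r * twoInfNorm U} ⊆
      ⋃ r ∈ Finset.range g, ⋃ j ∈ (Finset.univ : Finset (Fin k)), A r j := by
    intro ω hω
    by_contra hcon
    refine hω fun r hr hrg i => ?_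
    have hall : ∀ j, |(E ω ^ r * U) i j| ≤ b r * twoInfNorm U := by
      intro j
      have : ω ∉ A r j := fun hmem => hcon <| by
        simp only [Set.mem_iUnion, Finset.mem_range, Finset.mem_univ, exists_prop, true_and]
        exact ⟨r, hrg, j, hmem⟩
      simp only [A, hr, if_true, Set.mem_compl_iff, not_not] at this
      exact (this i).trans (mul_le_mul_of_nonneg_left (norm_col_le_twoInfNorm U j) (hb r))
    have h0 := mul_nonneg (hb r) (twoInfNorm_nonneg U)
    rw [rowNorm_eq_sqrt]
    calc √(∑ j, (E ω ^ r * U) i j ^ 2) ≤ √(∑ _ : Fin k, (b r * twoInfNorm U) ^ 2) :=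
          Real.sqrt_le_sqrt (Finset.sum_le_sum fun j _ => sq_le_sq' (abs_le.1 (hall j)).1
            (abs_le.1 (hall j)).2)
      _ = √k * b r * twoInfNorm U := by
          rw [Finset.sum_const, Finset.card_univ, Fintype.card_fin, nsmul_eq_mul,
            Real.sqrt_mul (by positivity), Real.sqrt_sq h0]
          ring
      _ ≤ c ^ r * twoInfNorm U :=
          mul_le_mul_of_nonneg_right (hc r hr hrg) (twoInfNorm_nonneg U)
  refine (measure_mono hsub).trans ((measure_biUnion_finset_le _ _).trans ?_)
  have hA : ∀ r ∈ Finset.range g, ∀ j, P (A r j) ≤ ENNReal.ofReal η := by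
    intro r hr j
    by_cases h1 : 1 ≤ r
    · simp only [A, h1, if_true]
      refine measure_compl_le_of_one_sub_le ?_ (h r h1 (Finset.mem_range.1 hr) _)
      simp only [Set.ofPred_forall]
      refine MeasurableSet.iInter fun i => measurableSet_le ?_ measurable_const
      refine measurable_comp_matrix hE (f := fun e => |((e ^ r) *ᵥ Uᵀ j) i|) ?_
      fun_prop
    · simp [A, h1]
  calc ∑ r ∈ Finset.range g, P (⋃ j ∈ (Finset.univ : Finset (Fin k)), A r j)
      ≤ ∑ r ∈ Finset.range g, ∑ _ : Fin k, ENNReal.ofReal η :=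
        Finset.sum_le_sum fun r hr => (measure_biUnion_finset_le _ _).trans
          (Finset.sum_le_sum fun j _ => hA r hr j)
    _ = (g * k : ℕ) • ENNReal.ofReal η := by
        simp [mul_assoc]

/-- Uniform control of the sketches of all the noise terms of the power iteration. -/
theorem IsGaussianSketch.measure_power_sketch_gt_le {Ω : Type*} [MeasurableSpace Ω]
    {P : Measure Ω} [IsProbabilityMeasure P] {n q N k : ℕ}
    {E : Ω → Matrix (Fin n) (Fin n) ℝ} {G : Ω → Fin N → Matrix (Fin n) (Fin q) ℝ}
    (h : IsGaussianSketch P E G) (hE : ∀ i j, Measurable fun ω => E ω i j)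
    (U : Matrix (Fin n) (Fin k) ℝ) (D : Matrix (Fin n) (Fin n) ℝ) (S : ℝ) (g : ℕ) (hk : 1 ≤ k)
    (hq : 1 ≤ q) (hN : 1 ≤ N) {κ : ℝ} (hκ0 : 0 ≤ κ) (hκ : 16 * (k : ℝ) ^ 2 ≤ κ ^ 2) :
    P {ω | ¬ ((∀ s < g, ∀ b j, rowNorm (Uᵀ * (S • E ω) * (D + S • E ω) ^ s * G ω b) j ≤
          κ * sketchLevel k q N * rowNorm (Uᵀ * (S • E ω) * (D + S • E ω) ^ s) j) ∧
        (∀ s < g, ∀ b j, rowNorm (Uᵀ * (S • E ω) ^ (s + 1) * G ω b) j ≤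
          κ * sketchLevel k q N * rowNorm (Uᵀ * (S • E ω) ^ (s + 1)) j) ∧
        ∀ b j, rowNorm ((S • E ω) ^ g * G ω b) j ≤
          κ * sketchLevel k q N * rowNorm ((S • E ω) ^ g) j)} ≤
      ENNReal.ofReal ((2 * g * k + n) * Real.exp (-((κ ^ 2 - 8) / 16))) := by
  set x := Real.exp (-((κ ^ 2 - 8) / 16)) with hx
  have hx0 : 0 ≤ x := (Real.exp_pos _).le
  have hs : 0 ≤ κ * sketchLevel k q N := mul_nonneg hκ0 (Real.sqrt_nonneg _)
  have key : ∀ {m : ℕ} (Y : Matrix (Fin n) (Fin n) ℝ → Matrix (Fin m) (Fin n) ℝ), Continuous Y →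
      P {ω | ¬ ∀ b j, rowNorm (Y (E ω) * G ω b) j ≤
        κ * sketchLevel k q N * rowNorm (Y (E ω)) j} ≤ ENNReal.ofReal (m * x) := by
    intro m Y hY
    refine (h.measure_rowNorm_mul_gt_le hE Y hY hs).trans (ENNReal.ofReal_le_ofReal ?_)
    exact mul_le_mul_of_nonneg_left (sketch_level_union_bound hk hq hN hκ) (Nat.cast_nonneg _)
  have hfam : ∀ (Y : ℕ → Matrix (Fin n) (Fin n) ℝ → Matrix (Fin k) (Fin n) ℝ),
      (∀ s, Continuous (Y s)) →
      P {ω | ¬ ∀ s < g, ∀ b j, rowNorm (Y s (E ω) * G ω b) j ≤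
        κ * sketchLevel k q N * rowNorm (Y s (E ω)) j} ≤ ENNReal.ofReal (g * (k * x)) := by
    intro Y hY
    have hsub : {ω | ¬ ∀ s < g, ∀ b j, rowNorm (Y s (E ω) * G ω b) j ≤
        κ * sketchLevel k q N * rowNorm (Y s (E ω)) j} ⊆
        ⋃ s ∈ Finset.range g, {ω | ¬ ∀ b j, rowNorm (Y s (E ω) * G ω b) j ≤
          κ * sketchLevel k q N * rowNorm (Y s (E ω)) j} := by
      intro ω hω
      simp only [Set.mem_iUnion, Finset.mem_range, Set.mem_ofPred_eq, exists_prop] at hω ⊢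
      push Not at hω ⊢
      exact hω
    refine (measure_mono hsub).trans ((measure_biUnion_finset_le _ _).trans
      ((Finset.sum_le_sum fun s _ => key (Y s) (hY s)).trans ?_))
    rw [Finset.sum_const, Finset.card_range, nsmul_eq_mul, ← ENNReal.ofReal_natCast g,
      ← ENNReal.ofReal_mul (Nat.cast_nonneg g)]
  have e1 := hfam (fun s e => Uᵀ * (S • e) * (D + S • e) ^ s) fun s => by fun_prop
  have e2 := hfam (fun s e => Uᵀ * (S • e) ^ (s + 1)) fun s => by fun_prop
  have e3 := key (fun e => (S • e) ^ g) (by fun_prop)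
  have htot : ENNReal.ofReal ((2 * g * k + n) * x) = ENNReal.ofReal (g * (k * x)) +
      (ENNReal.ofReal (g * (k * x)) + ENNReal.ofReal (n * x)) := by
    rw [← ENNReal.ofReal_add (by positivity) (by positivity),
      ← ENNReal.ofReal_add (by positivity) (by positivity)]
    congr 1; ring
  rw [htot]
  refine le_trans (measure_mono ?_) ((measure_union_le _ _).trans (add_le_add e1
    ((measure_union_le _ _).trans (add_le_add e2 e3))))
  intro ω hω
  by_contra hcon
  simp only [Set.mem_union, not_or, Set.mem_ofPred_eq, not_not] at hcon
  exact hω hcon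

/-- Non-asymptotic entrywise expansion of the output of the randomized SVD, outside an event of
explicitly bounded probability. -/
theorem exists_measure_rsvd_expansion_gt_le (ψ : ℝ) (k g : ℕ) (hk : 1 ≤ k) (hg : 3 ≤ g)
    (hψ : 1 ≤ ψ) :
    ∃ K : ℝ, 0 ≤ K ∧ ∀ {Ω : Type*} [MeasurableSpace Ω] (P : Measure Ω) [IsProbabilityMeasure P]
      {n q N : ℕ} (M : Matrix (Fin n) (Fin n) ℝ) (U : Matrix (Fin n) (Fin k) ℝ) (lam : Fin k → ℝ)
      (E : Ω → Matrix (Fin n) (Fin n) ℝ) (G : Ω → Fin N → Matrix (Fin n) (Fin q) ℝ)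
      (Uh : Ω → Matrix (Fin n) (Fin k) ℝ) (W : Ω → Matrix (Fin k) (Fin k) ℝ)
      (ε κ L : ℝ) (i : Fin n),
      k ≤ q → 1 ≤ N → IsEigendecomposition M U lam → condNumber hk lam ≤ ψ →
      (∀ i j, Measurable fun ω => E ω i j) → IsGaussianSketch P E G →
      (∀ ω, IsRSVDOutput g (M + E ω) (G ω) (Uh ω)) → (∀ ω, IsProcrustes (Uh ω) U (W ω)) →
      0 ≤ ε → ε ≤ 1 → 0 ≤ κ → 16 * (k : ℝ) ^ 2 ≤ κ ^ 2 →
      2 * ψ ^ g * g * (√k * 2 ^ g) * (κ * ε) ≤ 1 →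
      2 * ψ ^ g * (√n * κ * ε ^ (g - 1)) ≤ 1 →
      1 ≤ L → L * ε ≤ 1 →
      P {ω | K * (twoInfNorm U * (‖Uᵀ * E ω * U‖ / ‖M‖) + (L * ε) ^ 2 * twoInfNorm U +
            κ * ε ^ g) < rowNorm (Uh ω * (W ω)ᵀ - U - E ω * U * (diagonal lam)⁻¹) i} ≤
        P {ω | ‖E ω‖ ≤ ε * ‖M‖}ᶜ +
        (P {ω | ¬ ∀ r, 1 ≤ r → r < g → ∀ i,
          rowNorm (E ω ^ r * U) i ≤ (L * (ε * ‖M‖)) ^ r * twoInfNorm U} +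
        (ENNReal.ofReal ((2 * g * k + n) * Real.exp (-((κ ^ 2 - 8) / 16))) +
        gaussPi (Fin N × Fin n × Fin q)
          {x | ∀ b, ¬ IsWellConditioned (sketchLevel k q N) (Uᵀ * sketch x b)})) := by
  obtain ⟨K, hK, hmain⟩ := exists_rsvd_rowNorm_expansion_le ψ k g hk hg hψ
  refine ⟨K, hK, ?_⟩
  intro Ω _ P _ n q N M U lam E G Uh W ε κ L i hkq hN hM hcond hE hG hout hproc hε0 hε1 hκ0 hκ
    hsm1 hsm2 hL hLε
  set S : ℝ := ‖M‖ with hSdef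
  have hS : 0 < S := hM.norm_pos hk
  have hU := hM.orthonormal
  -- Division by the norm of the signal gives `‖Λ‖ ≤ 1`, and the condition number bounds the inverse
  -- `Λi`.
  set Λ : Matrix (Fin k) (Fin k) ℝ := S⁻¹ • diagonal lam with hΛ
  set Λi : Matrix (Fin k) (Fin k) ℝ := S • (diagonal lam)⁻¹ with hΛi
  have hq : 1 ≤ q := hk.trans hkq
  have hT : 0 < sketchLevel k q N := by
    refine Real.sqrt_pos.2 ?_
    have h1 : 0 ≤ Real.log N := Real.log_nonneg (by exact_mod_cast hN)
    have h2 : (0 : ℝ) < q := by exact_mod_cast hq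
    positivity
  have e3 := hG.measure_power_sketch_gt_le hE U (U * Λ * Uᵀ) S⁻¹ g hk hq hN hκ0 hκ
  have e4 := hG.measure_eq {x | ∀ b, ¬ IsWellConditioned (sketchLevel k q N) (Uᵀ * sketch x b)}
  refine le_trans (measure_mono ?_) ((measure_union_le _ _).trans (add_le_add le_rfl
    ((measure_union_le _ _).trans (add_le_add le_rfl
    ((measure_union_le _ _).trans (add_le_add e3 e4))))))
  intro ω hω
  by_contra hcon
  simp only [Set.mem_union, not_or, Set.mem_ofPred_eq, not_not, Set.mem_compl_iff] at hcon
  obtain ⟨hEn, hrow, ⟨hs1, hs2, hs3⟩, hwell⟩ := hcon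
  simp only [not_forall, not_not] at hwell
  have hMhat : M + E ω = S • (U * Λ * Uᵀ + S⁻¹ • E ω) := by
    rw [smul_add, smul_smul, mul_inv_cancel₀ hS.ne', one_smul, hM.eq_mul, hΛ, Matrix.mul_smul,
      Matrix.smul_mul, smul_smul, mul_inv_cancel₀ hS.ne', one_smul]
  have hsc : (S⁻¹ • E ω) * U * Λi = E ω * U * (diagonal lam)⁻¹ := by
    rw [hΛi, Matrix.smul_mul, Matrix.smul_mul, Matrix.mul_smul, smul_smul, inv_mul_cancel₀ hS.ne',
      one_smul]
  have hUE : ‖Uᵀ * (S⁻¹ • E ω) * U‖ = ‖Uᵀ * E ω * U‖ / S := by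
    rw [Matrix.mul_smul, Matrix.smul_mul, norm_smul, Real.norm_of_nonneg (by positivity),
      inv_mul_eq_div]
  have hnorm : ∀ A : Matrix (Fin n) (Fin n) ℝ, ‖S⁻¹ • A‖ = ‖A‖ / S := fun A => by
    rw [norm_smul, Real.norm_of_nonneg (by positivity), inv_mul_eq_div]
  have hμ1 : twoInfNorm U ≤ 1 := (twoInfNorm_le_norm U).trans (norm_le_one_of_orthonormal hU)
  have hfin := hmain U Λ Λi (W ω) (S⁻¹ • E ω) (G ω) (Uh ω) S ε κ (sketchLevel k q N)
    (twoInfNorm U) L i hkq hS hU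
    (by rw [hΛ, hΛi, Matrix.smul_mul, Matrix.mul_smul, smul_smul, mul_inv_cancel₀ hS.ne', one_smul,
      hM.inv_diagonal_mul])
    (by
      rw [hΛ, norm_smul, Real.norm_of_nonneg (by positivity), inv_mul_le_iff₀ hS, mul_one]
      exact hM.norm_diagonal_le)
    (by
      rw [hΛi, norm_smul, Real.norm_of_nonneg hS.le]
      have := hM.norm_inv_diagonal_le hk (by linarith) hcond
      rwa [le_div_iff₀ hS, mul_comm] at this)
    hε0 hε1 (by rw [hnorm, div_le_iff₀ hS]; exact hEn) hT hκ0 hs1 hs2 hs3 hwell hsm1 hsm2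
    (twoInfNorm_nonneg U) hμ1 hL hLε (rowNorm_le_twoInfNorm U i)
    (fun r h1 h2 => by
      have := hrow r h1 h2 i
      rw [smul_pow, Matrix.smul_mul, rowNorm_smul, abs_of_nonneg (by positivity), inv_pow,
        inv_mul_le_iff₀ (by positivity)]
      refine this.trans_eq ?_
      ring)
    (hMhat ▸ hout ω) (hproc ω)
  rw [hsc, hUE] at hfin
  exact absurd hω (not_lt.2 hfin)

/-! ### Rates -/

theorem tendsto_natCast_rpow_neg {β : ℝ} (hβ : 0 < β) :
    Tendsto (fun n : ℕ => (n : ℝ) ^ (-β)) atTop (𝓝 0) :=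
  (tendsto_rpow_neg_atTop hβ).comp tendsto_natCast_atTop_atTop

theorem tendsto_rpow_half_mul_of_le {β c : ℝ} (hβ : 0 < β) {ε : ℕ → ℝ} (h0 : ∀ᶠ n in atTop, 0 ≤ ε n)
    (h : ∀ᶠ n : ℕ in atTop, ε n ≤ c * (n : ℝ) ^ (-β)) :
    Tendsto (fun n : ℕ => (n : ℝ) ^ (β / 2) * ε n) atTop (𝓝 0) := by
  have h1 := (tendsto_natCast_rpow_neg (half_pos hβ)).const_mul c
  rw [mul_zero] at h1
  refine squeeze_zero' ?_ ?_ h1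
  · filter_upwards [h0] with n hn
    positivity
  · filter_upwards [h, eventually_gt_atTop 0] with n hn hn0
    have hn0' : (0 : ℝ) < n := by exact_mod_cast hn0
    calc (n : ℝ) ^ (β / 2) * ε n ≤ (n : ℝ) ^ (β / 2) * (c * (n : ℝ) ^ (-β)) := by gcongr
      _ = c * ((n : ℝ) ^ (β / 2) * (n : ℝ) ^ (-β)) := by ring
      _ = c * (n : ℝ) ^ (-(β / 2)) := by rw [← Real.rpow_add hn0']; ring_nf

theorem tendsto_log_rpow_mul_of_le {β c δ : ℝ} (hβ : 0 < β) {ε : ℕ → ℝ}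
    (h0 : ∀ᶠ n in atTop, 0 ≤ ε n) (h : ∀ᶠ n : ℕ in atTop, ε n ≤ c * (n : ℝ) ^ (-β)) :
    Tendsto (fun n : ℕ => Real.log n ^ δ * ε n) atTop (𝓝 0) := by
  have h1 := ((isLittleO_log_rpow_rpow_atTop δ hβ).tendsto_div_nhds_zero.comp
    tendsto_natCast_atTop_atTop).const_mul c
  rw [mul_zero] at h1
  refine squeeze_zero' ?_ ?_ h1
  · filter_upwards [h0] with n hn
    have := Real.rpow_nonneg (Real.log_natCast_nonneg n) δ
    positivity
  · filter_upwards [h, eventually_gt_atTop 0] with n hn hn0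
    have := Real.rpow_nonneg (Real.log_natCast_nonneg n) δ
    calc Real.log n ^ δ * ε n ≤ Real.log n ^ δ * (c * (n : ℝ) ^ (-β)) := by gcongr
      _ = c * (Real.log n ^ δ / (n : ℝ) ^ β) := by
        rw [Real.rpow_neg (Nat.cast_nonneg n)]; ring

/-- The threshold for `g` says precisely that `(g - 1) * β ≥ β + 1 / 2`. After the loss of `√n` and
`n ^ (β / 2)`, a factor `n ^ (-(β / 2))` remains. -/
theorem tendsto_sqrt_mul_rpow_half_mul_pow_of_le {β c : ℝ} (hβ : 0 < β) {ε : ℕ → ℝ} {g : ℕ}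
    (hg : 2 + (2 * β)⁻¹ ≤ (g : ℝ)) (hc : 0 ≤ c) (h0 : ∀ᶠ n in atTop, 0 ≤ ε n)
    (h : ∀ᶠ n : ℕ in atTop, ε n ≤ c * (n : ℝ) ^ (-β)) :
    Tendsto (fun n : ℕ => √n * (n : ℝ) ^ (β / 2) * ε n ^ (g - 1)) atTop (𝓝 0) := by
  have h1 := (tendsto_natCast_rpow_neg (half_pos hβ)).const_mul (c ^ (g - 1))
  rw [mul_zero] at h1
  have hg1 : 1 ≤ g := by
    have : (0 : ℝ) < (2 * β)⁻¹ := by positivity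
    have : (1 : ℝ) ≤ g := by linarith
    exact_mod_cast this
  have hgβ : β + 1 / 2 ≤ ((g : ℝ) - 1) * β := by
    have h2 : (2 * β)⁻¹ * β = 1 / 2 := by field_simp
    nlinarith
  refine squeeze_zero' ?_ ?_ h1
  · filter_upwards [h0] with n hn
    positivity
  · filter_upwards [h0, h, eventually_ge_atTop 1] with n hn' hn hn0
    have hn1 : (1 : ℝ) ≤ n := by exact_mod_cast hn0
    have hn0' : (0 : ℝ) < n := by linarith
    calc √n * (n : ℝ) ^ (β / 2) * ε n ^ (g - 1)
        ≤ √n * (n : ℝ) ^ (β / 2) * (c * (n : ℝ) ^ (-β)) ^ (g - 1) := by gcongr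
      _ = c ^ (g - 1) * ((n : ℝ) ^ (1 / 2 : ℝ) * (n : ℝ) ^ (β / 2) *
            (n : ℝ) ^ (-β * ((g : ℝ) - 1))) := by
          rw [mul_pow, ← Real.rpow_mul_natCast hn0'.le, Real.sqrt_eq_rpow, Nat.cast_sub hg1,
            Nat.cast_one]
          ring
      _ = c ^ (g - 1) * (n : ℝ) ^ (1 / 2 + β / 2 + -β * ((g : ℝ) - 1)) := by
          rw [← Real.rpow_add hn0', ← Real.rpow_add hn0']
      _ ≤ c ^ (g - 1) * (n : ℝ) ^ (-(β / 2)) := by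
          gcongr
          linarith

/-- In terms of `x = n ^ β` the prefactor is a constant plus `x ^ β⁻¹`, which the exponential decay
in `x` outweighs. -/
theorem tendsto_add_mul_exp_neg_rpow {β : ℝ} (hβ : 0 < β) (d : ℝ) :
    Tendsto (fun n : ℕ => (d + n) * Real.exp (-((((n : ℝ) ^ (β / 2)) ^ 2 - 8) / 16))) atTop
      (𝓝 0) := by
  have hpow : Tendsto (fun n : ℕ => (n : ℝ) ^ β) atTop atTop :=
    (tendsto_rpow_atTop hβ).comp tendsto_natCast_atTop_atTop
  have h0 := (tendsto_rpow_mul_exp_neg_mul_atTop_nhds_zero 0 (1 / 16) (by norm_num)).comp hpow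
  have h1 := (tendsto_rpow_mul_exp_neg_mul_atTop_nhds_zero β⁻¹ (1 / 16) (by norm_num)).comp hpow
  have h2 := ((h0.const_mul d).add h1).mul_const (Real.exp (1 / 2))
  simp only [mul_zero, add_zero, zero_mul] at h2
  refine h2.congr fun n => ?_
  simp only [Function.comp_apply, Real.rpow_zero, one_mul]
  rw [← Real.rpow_mul (Nat.cast_nonneg n), mul_inv_cancel₀ hβ.ne', Real.rpow_one,
    ← Real.rpow_mul_natCast (Nat.cast_nonneg n), ← add_mul, mul_assoc, ← Real.exp_add]
  congr 2
  rw [show β / 2 * ((2 : ℕ) : ℝ) = β by push_cast; ring]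
  ring

/-- If `a n ≥ c q n⁻¹ log n`, then `a n` or `q n` is eventually large. -/
theorem eventually_le_or_le_of_ceil_le {a q : ℕ → ℕ} {c : ℝ} (hc : 0 < c) (hq : ∀ n, 1 ≤ q n)
    (h : ∀ n, ⌈c * (q n : ℝ)⁻¹ * Real.log n⌉₊ ≤ a n) (L : ℕ) :
    ∀ᶠ n in atTop, L ≤ a n ∨ L ≤ q n := by
  have hlog : Tendsto (fun n : ℕ => Real.log n) atTop atTop :=
    Real.tendsto_log_atTop.comp tendsto_natCast_atTop_atTop
  filter_upwards [hlog.eventually_ge_atTop ((L : ℝ) * L / c)] with n hn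
  -- If both were below `L`, their product would be below `L * L`, whereas it is at least `c * log
  -- n`.
  by_contra! hcon
  obtain ⟨h1, h2⟩ := hcon
  have hq0 : (0 : ℝ) < q n := by exact_mod_cast hq n
  have h3 : c * (q n : ℝ)⁻¹ * Real.log n ≤ a n := Nat.ceil_le.1 (h n)
  have h4 : c * Real.log n ≤ a n * q n := by
    rw [mul_right_comm, ← div_eq_mul_inv, div_le_iff₀ hq0] at h3
    exact h3
  have h5 : (a n : ℝ) * q n < L * L := by
    exact_mod_cast Nat.mul_lt_mul'' h1 h2
  rw [div_le_iff₀ hc, mul_comm] at hn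
  linarith

/-- Of the factor `lclt`, the argument needs only that it dominates `(log n) ^ (2 * δ)`: in the
boundary case because `g ≥ 2`, otherwise because `vartheta` is at least `1`. -/
theorem log_rpow_le_lclt {β δ : ℝ} {g q n : ℕ} (hδ : 0 ≤ δ) (hg : 2 ≤ g) (hn : 1 ≤ Real.log n) :
    Real.log n ^ (2 * δ) ≤ lclt β δ g q n := by
  have h0 : 0 ≤ Real.log n ^ (2 * δ) := by positivity
  rw [lclt]
  split_ifs
  · refine Real.rpow_le_rpow_of_exponent_le hn ?_
    have : (2 : ℝ) ≤ g := by exact_mod_cast hg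
    nlinarith
  · exact le_mul_of_one_le_right h0 (le_max_left _ _)

/-- The expansion error, after standardization. -/
theorem standardized_error_le {n g : ℕ} {S σ En μ e κ L C c ℓ ℓ' : ℝ} (hS : 0 < S) (hσ : 0 < σ)
    (hEn : 0 < En) (hc : 0 ≤ c) (hle : En ≤ c * (√n * σ)) (hμ : 0 ≤ μ)
    (hκ : 0 ≤ κ) (hL : L ^ 2 = C ^ 2 * ℓ) (hℓ : ℓ ≤ ℓ') (hg : 1 ≤ g) :
    S * σ⁻¹ * (μ * (e / S) + (L * (En / S)) ^ 2 * μ + κ * (En / S) ^ g) ≤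
      (1 + c ^ 2 * C ^ 2) * (max (σ⁻¹ * e) (n * σ * ℓ' * S⁻¹) * μ) +
        c * (√n * κ * (En / S) ^ (g - 1)) := by
  set Z := max (σ⁻¹ * e) (n * σ * ℓ' * S⁻¹) with hZ
  have h1 : S * σ⁻¹ * (μ * (e / S)) ≤ Z * μ := by
    calc S * σ⁻¹ * (μ * (e / S)) = σ⁻¹ * e * μ := by field_simp
      _ ≤ Z * μ := by gcongr; exact le_max_left _ _
  have hEσ : En * σ⁻¹ ≤ c * √n := by
    rw [← div_eq_mul_inv, div_le_iff₀ hσ]; linarith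
  have hsq : √(n : ℝ) * √n = n := Real.mul_self_sqrt (Nat.cast_nonneg n)
  have h2 : S * σ⁻¹ * ((L * (En / S)) ^ 2 * μ) ≤ c ^ 2 * C ^ 2 * (Z * μ) := by
    -- No sign is assumed for `ℓ`. If it is negative, `L ^ 2 = C ^ 2 * ℓ` forces `C = L = 0`, and
    -- both sides vanish.
    by_cases hℓ0 : 0 ≤ ℓ
    · calc S * σ⁻¹ * ((L * (En / S)) ^ 2 * μ) = (En * σ⁻¹) * En * L ^ 2 * S⁻¹ * μ := by field_simp
        _ ≤ (c * √n) * (c * (√n * σ)) * L ^ 2 * S⁻¹ * μ := by gcongr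
        _ = c ^ 2 * C ^ 2 * ((√n * √n) * σ * ℓ * S⁻¹ * μ) := by rw [hL]; ring
        _ ≤ c ^ 2 * C ^ 2 * (Z * μ) := by
          rw [hsq]
          have : n * σ * ℓ * S⁻¹ ≤ Z := le_trans (by gcongr) (le_max_right _ _)
          gcongr
    · have hC : C = 0 := by
        by_contra hC
        have : 0 < C ^ 2 := by positivity
        nlinarith [sq_nonneg L]
      have hL0 : L = 0 := by
        rw [hC] at hL
        simpa using hL
      simp [hC, hL0]
  have h3 : S * σ⁻¹ * (κ * (En / S) ^ g) ≤ c * (√n * κ * (En / S) ^ (g - 1)) := by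
    obtain ⟨m, rfl⟩ : ∃ m, g = m + 1 := ⟨g - 1, by omega⟩
    calc S * σ⁻¹ * (κ * (En / S) ^ (m + 1)) = (En * σ⁻¹) * (κ * (En / S) ^ m) := by
          rw [pow_succ]; field_simp
      _ ≤ (c * √n) * (κ * (En / S) ^ m) := by gcongr
      _ = c * (√n * κ * (En / S) ^ (m + 1 - 1)) := by rw [Nat.add_sub_cancel]; ring
  nlinarith

/-! ### Standardized rows -/

theorem norm_standardize_sub_le {k : ℕ} {S σ c : ℝ} {Γ : Matrix (Fin k) (Fin k) ℝ} (hS : 0 ≤ S)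
    (hσ : 0 ≤ σ) (hc : 0 < c) (hΓ : (Γ - c • (1 : Matrix (Fin k) (Fin k) ℝ)).PosSemidef)
    (v w : Fin k → ℝ) :
    ‖standardize S σ Γ v - standardize S σ Γ w‖ ≤
      (√c)⁻¹ * (S * σ⁻¹ * ‖(WithLp.toLp 2 (v - w) : EuclideanSpace ℝ (Fin k))‖) := by
  have h : standardize S σ Γ v - standardize S σ Γ w =
      (S * σ⁻¹) • (WithLp.toLp 2 (invSqrt Γ *ᵥ (v - w)) : EuclideanSpace ℝ (Fin k)) := by
    rw [standardize, standardize, ← WithLp.toLp_sub, ← smul_sub, ← mulVec_sub, WithLp.toLp_smul]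
  rw [h, norm_smul, Real.norm_of_nonneg (by positivity)]
  have h1 := (norm_mulVec_le (invSqrt Γ) (v - w)).trans
    (mul_le_mul_of_nonneg_right (norm_invSqrt_le hc hΓ) (norm_nonneg _))
  calc S * σ⁻¹ * ‖(WithLp.toLp 2 (invSqrt Γ *ᵥ (v - w)) : EuclideanSpace ℝ (Fin k))‖
      ≤ S * σ⁻¹ * ((√c)⁻¹ * ‖(WithLp.toLp 2 (v - w) : EuclideanSpace ℝ (Fin k))‖) := by gcongr
    _ = _ := by ring

theorem measurable_standardize {Ω : Type*} [MeasurableSpace Ω] {k : ℕ} (S σ : ℝ)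
    (Γ : Matrix (Fin k) (Fin k) ℝ) {v : Ω → Fin k → ℝ} (hv : Measurable v) :
    Measurable fun ω => standardize S σ Γ (v ω) := by
  have : Continuous fun v : Fin k → ℝ => standardize S σ Γ v := by
    unfold standardize
    fun_prop
  exact this.measurable.comp hv

theorem measurable_rowVec {Ω : Type*} [MeasurableSpace Ω] {n k : ℕ}
    {A : Ω → Matrix (Fin n) (Fin k) ℝ} (hA : ∀ i j, Measurable fun ω => A ω i j) (i : ℕ) :
    Measurable fun ω => rowVec (A ω) i := by
  unfold rowVec
  split_ifs with h
  · exact measurable_pi_lambda _ fun j => hA ⟨i, h⟩ j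
  · exact measurable_const

theorem rowVec_sub_sub_eq {n k : ℕ} (Uh U X : Matrix (Fin n) (Fin k) ℝ)
    (W : Matrix (Fin k) (Fin k) ℝ) {i : ℕ} (hi : i < n) :
    ‖(WithLp.toLp 2 (W *ᵥ rowVec Uh i - rowVec U i - rowVec X i) : EuclideanSpace ℝ (Fin k))‖ =
      rowNorm (Uh * Wᵀ - U - X) ⟨i, hi⟩ := by
  rw [rowNorm]
  congr 2
  ext j
  simp [rowVec, hi, Matrix.mul_apply, Matrix.mulVec, dotProduct, mul_comm]

/-! ### The assumptions in the limit -/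

theorem opNorm_eq_norm {m n : ℕ} (A : Matrix (Fin m) (Fin n) ℝ) : opNorm A = ‖A‖ := rfl

/-- Concentration is available for `r ≤ log n`, which eventually covers all `r < g`. Passing to the
constant `√k * |C| + 1`, at least `1`, allows it to be moved inside the `r`-th power. -/
theorem RowConcentration.tendsto_measure {Ω : ℕ → Type*} [∀ n, MeasurableSpace (Ω n)]
    {P : ∀ n, Measure (Ω n)} [∀ n, IsProbabilityMeasure (P n)] {k : ℕ}
    {E : ∀ n, Ω n → Matrix (Fin n) (Fin n) ℝ} {En : ℕ → ℝ} {δ : ℝ}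
    (h : RowConcentration P E En δ) (hE : ∀ n i j, Measurable fun ω => E n ω i j)
    (hEn : ∀ᶠ n in atTop, 0 ≤ En n) (U : ∀ n, Matrix (Fin n) (Fin k) ℝ) (g : ℕ) :
    ∃ C : ℝ, 1 ≤ C ∧ Tendsto (fun n => P n {ω | ¬ ∀ r, 1 ≤ r → r < g → ∀ i,
      rowNorm (E n ω ^ r * U n) i ≤ (C * Real.log n ^ δ * En n) ^ r * twoInfNorm (U n)})
      atTop (𝓝 0) := by
  obtain ⟨C, hC⟩ := h
  have hkC : 0 ≤ √k * |C| := by positivity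
  refine ⟨√k * |C| + 1, by linarith, ?_⟩
  have hlog : Tendsto (fun n : ℕ => Real.log n) atTop atTop :=
    Real.tendsto_log_atTop.comp tendsto_natCast_atTop_atTop
  have hlim : Tendsto (fun n : ℕ => (g * k : ℕ) • ENNReal.ofReal (((n : ℝ) ^ 8)⁻¹)) atTop
      (𝓝 0) := by
    have h1 : Tendsto (fun n : ℕ => ((n : ℝ) ^ 8)⁻¹) atTop (𝓝 0) :=
      ((tendsto_pow_atTop (by norm_num)).comp tendsto_natCast_atTop_atTop).inv_tendsto_atTop
    have h2 := (h1.const_mul ((g * k : ℕ) : ℝ))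
    rw [mul_zero] at h2
    have h3 := ENNReal.tendsto_ofReal h2
    rw [ENNReal.ofReal_zero] at h3
    refine h3.congr fun n => ?_
    rw [ENNReal.ofReal_mul (Nat.cast_nonneg _), ENNReal.ofReal_natCast, nsmul_eq_mul]
  refine tendsto_of_tendsto_of_tendsto_of_le_of_le' tendsto_const_nhds hlim
    (Eventually.of_forall fun _ => zero_le) ?_
  filter_upwards [hC, hEn, hlog.eventually_ge_atTop g] with n hn hEn0 hgn
  have hl0 := Real.log_natCast_nonneg n
  refine measure_rowNorm_pow_mul_gt_le (b := fun r => |C| * En n ^ r * Real.log n ^ (δ * r))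
    (hE n) (U n) (fun r => by positivity) (fun r h1 _ => ?_) fun r h1 h2 u => ?_
  · have hr : (√k * |C|) ≤ (√k * |C| + 1) ^ r :=
      (by linarith : √k * |C| ≤ √k * |C| + 1).trans
        (le_self_pow₀ (by linarith) (by omega))
    calc √k * (|C| * En n ^ r * Real.log n ^ (δ * r))
        = √k * |C| * (En n ^ r * Real.log n ^ (δ * r)) := by ring
      _ ≤ (√k * |C| + 1) ^ r * (En n ^ r * Real.log n ^ (δ * r)) := by gcongr
      _ = ((√k * |C| + 1) * Real.log n ^ δ * En n) ^ r := by
        rw [Real.rpow_mul_natCast hl0, mul_pow, mul_pow]; ring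
  · have hrl : (r : ℝ) ≤ Real.log n := le_trans (by exact_mod_cast h2.le) hgn
    refine (hn r h1 hrl u).trans (measureReal_mono fun ω hω i => (hω i).trans ?_)
    gcongr
    exact le_abs_self C

/-- A negative `En n` would make the norm event empty, although its probability is at least `1 - n⁻⁶
> 0`. -/
theorem SNRAssumption.eventually_nonneg {Ω : ℕ → Type*} [∀ n, MeasurableSpace (Ω n)]
    {P : ∀ n, Measure (Ω n)} [∀ n, IsProbabilityMeasure (P n)]
    {E : ∀ n, Ω n → Matrix (Fin n) (Fin n) ℝ} {S En : ℕ → ℝ} {β : ℝ}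
    (h : SNRAssumption P E S En β) : ∀ᶠ n in atTop, 0 ≤ En n := by
  filter_upwards [h.2, eventually_ge_atTop 2] with n hn hn2
  by_contra! hneg
  have hempty : {ω | opNorm (E n ω) ≤ En n} = ∅ := by
    ext ω
    simp only [Set.mem_ofPred_eq, Set.mem_empty_iff_false, iff_false, not_le]
    exact hneg.trans_le (norm_nonneg _)
  rw [hempty, measureReal_empty] at hn
  have hn2' : (2 : ℝ) ≤ n := by exact_mod_cast hn2
  have : (1 : ℝ) < (n : ℝ) ^ 6 := one_lt_pow₀ (by linarith) (by norm_num)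
  have := inv_lt_one_of_one_lt₀ this
  linarith

theorem SNRAssumption.tendsto_measure {Ω : ℕ → Type*} [∀ n, MeasurableSpace (Ω n)]
    {P : ∀ n, Measure (Ω n)} [∀ n, IsProbabilityMeasure (P n)]
    {E : ∀ n, Ω n → Matrix (Fin n) (Fin n) ℝ} {S En : ℕ → ℝ} {β : ℝ}
    (h : SNRAssumption P E S En β) (hE : ∀ n i j, Measurable fun ω => E n ω i j) :
    Tendsto (fun n => P n {ω | ‖E n ω‖ ≤ En n}ᶜ) atTop (𝓝 0) := by
  have h1 : Tendsto (fun n : ℕ => ((n : ℝ) ^ 6)⁻¹) atTop (𝓝 0) :=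
    ((tendsto_pow_atTop (by norm_num)).comp tendsto_natCast_atTop_atTop).inv_tendsto_atTop
  have h3 := ENNReal.tendsto_ofReal h1
  rw [ENNReal.ofReal_zero] at h3
  refine tendsto_of_tendsto_of_tendsto_of_le_of_le' tendsto_const_nhds h3
    (Eventually.of_forall fun _ => zero_le) ?_
  filter_upwards [h.2] with n hn
  exact measure_compl_le_of_one_sub_le (measurableSet_norm_le (hE n) _) hn

theorem SNRAssumption.eventually_ratio_le {Ω : ℕ → Type*} [∀ n, MeasurableSpace (Ω n)]
    {P : ∀ n, Measure (Ω n)} [∀ n, IsProbabilityMeasure (P n)]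
    {E : ∀ n, Ω n → Matrix (Fin n) (Fin n) ℝ} {S En : ℕ → ℝ} {β : ℝ}
    (h : SNRAssumption P E S En β) (hS : ∀ n, 0 ≤ S n) :
    ∃ c : ℝ, 0 ≤ c ∧ ∀ᶠ n : ℕ in atTop, 0 < En n ∧ En n / S n ≤ c * (n : ℝ) ^ (-β) := by
  obtain ⟨c, hc⟩ := h.1
  refine ⟨|c|, abs_nonneg c, ?_⟩
  filter_upwards [hc, h.eventually_nonneg, eventually_gt_atTop 0] with n hn hEn hn0
  have hn0' : (0 : ℝ) < n := by exact_mod_cast hn0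
  have hpow : 0 < (n : ℝ) ^ β := Real.rpow_pos_of_pos hn0' β
  have hle : (n : ℝ) ^ β ≤ |c| * (S n / En n) :=
    hn.trans (mul_le_mul_of_nonneg_right (le_abs_self c) (div_nonneg (hS n) hEn))
  -- If `En n = 0`, then `S n / En n = 0` by the convention for division, contrary to the
  -- signal-to-noise ratio; likewise for `S n = 0` below.
  have hE0 : 0 < En n := by
    refine lt_of_le_of_ne hEn fun h0 => ?_
    rw [← h0, div_zero, mul_zero] at hle
    linarith
  have hS0 : 0 < S n := by
    refine lt_of_le_of_ne (hS n) fun h0 => ?_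
    rw [← h0, zero_div, mul_zero] at hle
    linarith
  refine ⟨hE0, ?_⟩
  rw [Real.rpow_neg hn0'.le, div_le_iff₀ hS0, mul_right_comm, ← div_eq_mul_inv, le_div_iff₀ hpow]
  rw [mul_div_assoc', le_div_iff₀ hE0] at hle
  linarith

/-- For each tolerance it is enough that `a n` or `q n` passes a fixed threshold, which any `c > 0`
guarantees eventually. -/
theorem tendsto_gaussPi_not_isWellConditioned {k : ℕ} (hk : 1 ≤ k) {q a : ℕ → ℕ} {c : ℝ}
    (hc : 0 < c) (hq : ∀ n, k ≤ q n) (ha : ∀ n, 1 ≤ a n ∧ ⌈c * (q n : ℝ)⁻¹ * Real.log n⌉₊ ≤ a n)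
    (U : ∀ n, Matrix (Fin n) (Fin k) ℝ) (hU : ∀ᶠ n in atTop, (U n)ᵀ * U n = 1) :
    Tendsto (fun n => gaussPi (Fin (a n) × Fin n × Fin (q n))
      {x | ∀ b, ¬ IsWellConditioned (sketchLevel k (q n) (a n)) ((U n)ᵀ * sketch x b)})
      atTop (𝓝 0) := by
  rw [ENNReal.tendsto_nhds_zero]
  intro η hη
  obtain ⟨ε, hε, hεη⟩ : ∃ ε : ℝ, 0 < ε ∧ ENNReal.ofReal ε ≤ η := by
    refine ⟨(min η 1).toReal, ENNReal.toReal_pos (by simp [hη.ne']) (by simp), ?_⟩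
    rw [ENNReal.ofReal_toReal (by simp)]
    exact min_le_left _ _
  obtain ⟨L, hL⟩ := exists_gaussPi_sketchLevel_le k hk hε
  filter_upwards [hU, eventually_le_or_le_of_ceil_le hc (fun n => hk.trans (hq n))
    (fun n => (ha n).2) L] with n hUn hn
  exact (hL (ha n).1 (hq n) hn (U n) hUn).trans hεη

end RsRSVD

/-! ### The central limit theorem for the rows -/

theorem theorem4 (k : ℕ) (hk : 1 ≤ k) (kt : ℕ → ℕ) (hkt : ∀ n, k ≤ kt n) :
    ∃ C : ℝ, 0 < C ∧ (Tendsto kt atTop atTop → C ≤ 15) ∧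
      ∀ (Ω : ℕ → Type*) [∀ n, MeasurableSpace (Ω n)] (P : ∀ n, Measure (Ω n))
        [∀ n, IsProbabilityMeasure (P n)]
        -- signal matrix, its eigendecomposition, and noise matrix
        (M : ∀ n, Matrix (Fin n) (Fin n) ℝ) (U : ∀ n, Matrix (Fin n) (Fin k) ℝ)
        (lam : ℕ → Fin k → ℝ) (E : ∀ n, Ω n → Matrix (Fin n) (Fin n) ℝ)
        (S En σ : ℕ → ℝ) (β δ : ℝ) (Γ : ℕ → ℕ → Matrix (Fin k) (Fin k) ℝ)
        -- sketches and output of the algorithm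
        (g : ℕ) (a : ℕ → ℕ) (G : ∀ n, Ω n → Fin (a n) → Matrix (Fin n) (Fin (kt n)) ℝ)
        (Uhat : ∀ n, Ω n → Matrix (Fin n) (Fin k) ℝ),
        (∀ᶠ n in atTop, IsEigendecomposition (M n) (U n) (lam n)) →
        (∃ B : ℝ, ∀ᶠ n in atTop, condNumber hk (lam n) ≤ B) →
        (∀ n, S n = opNorm (M n)) →
        (∀ n i j, Measurable fun ω => E n ω i j) →
        (∀ n ω, (E n ω).IsSymm) →
        0 < β →
        SNRAssumption P E S En β →
        1 < δ →
        RowConcentration P E En δ →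
        CLTAssumption P E U lam S En σ β Γ →
        2 + (2 * β)⁻¹ ≤ (g : ℝ) →
        (∀ n, 1 ≤ a n ∧ ⌈C * (kt n : ℝ)⁻¹ * Real.log n⌉₊ ≤ a n) →
        (∀ n, IsGaussianSketch (P n) (E n) (G n)) →
        (∀ n i j, Measurable fun ω => Uhat n ω i j) →
        (∀ᶠ n in atTop, ∀ ω, IsRSVDOutput g (M n + E n ω) (G n ω) (Uhat n ω)) →
        TendstoZeroInProbability P (fun n ω =>
          max ((σ n)⁻¹ * opNorm ((U n)ᵀ * E n ω * U n))
            (n * σ n * lclt β δ g (kt n) n * (S n)⁻¹) * twoInfNorm (U n)) →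
        ∃ W : ∀ n, Ω n → Matrix (Fin k) (Fin k) ℝ,
          (∀ n i j, Measurable fun ω => W n ω i j) ∧
          (∀ n ω, IsProcrustes (Uhat n ω) (U n) (W n ω)) ∧
          ∀ i : ℕ, TendstoInDistribution
            (fun n (ω : Ω n) => standardize (S n) (σ n) (Γ n i)
              (W n ω *ᵥ rowVec (Uhat n ω) i - rowVec (U n) i))
            atTop id P (stdGaussian (EuclideanSpace ℝ (Fin k))) := by
  -- Any positive constant would serve, since a well-conditioned sketch is needed only with
  -- probability tending to one.
  refine ⟨1, one_pos, fun _ => by norm_num, ?_⟩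
  intro Ω _ P _ M U lam E S En σ β δ Γ g a G Uhat hM hcond hS hE _ hβ hsnr hδ hrow hclt hg ha hG
    hUhat hout hcondition
  choose W hWm hWp using fun n => exists_measurable_procrustes (U n) (Uhat n) (hUhat n)
  refine ⟨W, hWm, hWp, fun i => ?_⟩
  obtain ⟨B, hB⟩ := hcond
  obtain ⟨c, hc0, hc⟩ := hclt.nondegenerate i
  obtain ⟨c₁, hc₁⟩ := hclt.noise_level.1
  have hSnn : ∀ n, 0 ≤ S n := fun n => by rw [hS]; exact norm_nonneg _
  obtain ⟨c₂, hc₂0, hc₂⟩ := hsnr.eventually_ratio_le hSnn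
  have hg3 : 3 ≤ g := by
    have h1 : (0 : ℝ) < (2 * β)⁻¹ := by positivity
    have h2 : (2 : ℝ) < g := by linarith
    exact_mod_cast h2
  obtain ⟨C, hC1, hrowlim⟩ := hrow.tendsto_measure hE hsnr.eventually_nonneg U g
  set ψ : ℝ := max B 1 with hψ
  obtain ⟨K, hK0, hK⟩ := exists_measure_rsvd_expansion_gt_le ψ k g hk hg3 (le_max_right _ _)
  have hε0 : ∀ᶠ n in atTop, 0 ≤ En n / S n := by
    filter_upwards [hc₂] with n hn using div_nonneg hn.1.le (hSnn n)
  have hεle : ∀ᶠ n : ℕ in atTop, En n / S n ≤ c₂ * (n : ℝ) ^ (-β) := hc₂.mono fun n hn => hn.2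
  have hlim1 := tendsto_rpow_half_mul_of_le hβ hε0 hεle
  have hlim2 := tendsto_sqrt_mul_rpow_half_mul_pow_of_le hβ hg hc₂0 hε0 hεle
  have hlim3 := tendsto_log_rpow_mul_of_le (δ := δ) hβ hε0 hεle
  have hlim4 : Tendsto (fun n => En n / S n) atTop (𝓝 0) := by
    simpa using tendsto_log_rpow_mul_of_le (δ := 0) hβ hε0 hεle
  have hlog : Tendsto (fun n : ℕ => Real.log n) atTop atTop :=
    Real.tendsto_log_atTop.comp tendsto_natCast_atTop_atTop
  have hpow : Tendsto (fun n : ℕ => (n : ℝ) ^ β) atTop atTop :=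
    (tendsto_rpow_atTop hβ).comp tendsto_natCast_atTop_atTop
  -- The bad events are large noise, failed row concentration, large sketched forms and no good
  -- sketch. Their total probability vanishes for `κ = n ^ (β / 2)`: large enough for a union over
  -- about `n` forms, small enough that `κ * En / S` still tends to `0`.
  have hbad := (hsnr.tendsto_measure hE).add (hrowlim.add
    ((ENNReal.ofReal_zero ▸ ENNReal.tendsto_ofReal (tendsto_add_mul_exp_neg_rpow hβ (2 * g * k))).add
      (tendsto_gaussPi_not_isWellConditioned hk one_pos hkt ha U
        (hM.mono fun n hn => hn.orthonormal))))
  refine tendstoInDistribution_of_sub (hclt.clt i) (fun n => ?_) fun η hη => ?_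
  · refine (measurable_standardize _ _ _ ?_).aemeasurable
    have h1 := measurable_pi_iff.1 (measurable_rowVec (hUhat n) i)
    refine measurable_pi_lambda _ fun j => ?_
    simp only [Pi.sub_apply, mulVec, dotProduct]
    exact (Finset.measurable_sum _ fun l _ => (hWm n j l).mul (h1 l)).sub_const _
  set c₃ : ℝ := (√c)⁻¹ * K with hc₃
  have hc₃0 : 0 ≤ c₃ := by positivity
  -- The summand `1` makes `c₄` positive, so that the threshold `η / (2 * c₄)` is meaningful; the
  -- part of the error governed by the condition then takes at most `η / 2`.
  set c₄ : ℝ := c₃ * (1 + |c₁| ^ 2 * C ^ 2) + 1 with hc₄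
  have hc₄0 : 0 < c₄ := by positivity
  have hZ := hcondition (η / (2 * c₄)) (by positivity)
  have hsum := hbad.add hZ
  simp only [add_zero] at hsum
  have hr := (hlim2.const_mul |c₁|).const_mul c₃
  simp only [mul_zero] at hr
  refine tendsto_of_tendsto_of_tendsto_of_le_of_le' tendsto_const_nhds hsum
    (Eventually.of_forall fun _ => zero_le) ?_
  have hs1 := hlim1.const_mul (2 * ψ ^ g * g * (√k * 2 ^ g))
  have hs2 := hlim2.const_mul (2 * ψ ^ g)
  have hs3 := hlim3.const_mul C
  rw [mul_zero] at hs1 hs2 hs3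
  filter_upwards [hM, hB, hout, hc, hc₁, hc₂, eventually_gt_atTop i,
    hs1.eventually_le_const one_pos, hs2.eventually_le_const one_pos,
    hs3.eventually_le_const one_pos, hlim4.eventually_le_const one_pos,
    hlog.eventually_ge_atTop 1, hpow.eventually_ge_atTop (16 * (k : ℝ) ^ 2),
    hr.eventually_lt_const (half_pos hη)]
    with n hMn hBn houtn hcn hc₁n hc₂n hin hs1n hs2n hs3n hεn hlogn hpown hrn
  open scoped Matrix.Norms.L2Operator in
  have hSn : S n = ‖M n‖ := hS n
  have hSpos : 0 < S n := hSn ▸ hMn.norm_pos hk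
  open scoped Matrix.Norms.L2Operator in
  have hEnS : En n / S n * ‖M n‖ = En n := by
    rw [← hSn, div_mul_cancel₀ _ hSpos.ne']
  have hEle : En n ≤ |c₁| * (√n * σ n) :=
    hc₁n.trans (mul_le_mul_of_nonneg_right (le_abs_self c₁)
      (mul_nonneg (Real.sqrt_nonneg _) (hclt.sigma_nonneg n)))
  -- Forced by `0 < En n` and the noise level; it makes `(σ n)⁻¹` a genuine inverse.
  have hσ : 0 < σ n := by
    refine lt_of_le_of_ne (hclt.sigma_nonneg n) fun h0 => ?_
    rw [← h0, mul_zero, mul_zero] at hEle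
    linarith [hc₂n.1]
  have hlogδ : 1 ≤ Real.log n ^ δ := Real.one_le_rpow hlogn (by linarith)
  have hκsq : ((n : ℝ) ^ (β / 2)) ^ 2 = (n : ℝ) ^ β := by
    rw [← Real.rpow_mul_natCast (Nat.cast_nonneg n)]
    congr 1
    push_cast
    ring
  have hmain := hK (P n) (M n) (U n) (lam n) (E n) (G n) (Uhat n) (W n) (En n / S n)
    ((n : ℝ) ^ (β / 2)) (C * Real.log n ^ δ) ⟨i, hin⟩ (hkt n) (ha n).1 hMn
    (hBn.trans (le_max_left _ _)) (hE n) (hG n) houtn (hWp n) (div_nonneg hc₂n.1.le hSpos.le) hεn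
    (by positivity) (by rw [hκsq]; exact hpown) hs1n hs2n
    (one_le_mul_of_one_le_of_one_le hC1 hlogδ) (by rw [mul_assoc]; exact hs3n)
  rw [hEnS] at hmain
  refine le_trans ((measure_mono ?_).trans (measure_union_le _ _)) (add_le_add hmain le_rfl)
  intro ω hω
  by_contra hcon
  simp only [Set.mem_union, not_or, Set.mem_ofPred_eq, not_lt, not_le] at hcon hω
  obtain ⟨hexp, hZn⟩ := hcon
  set Z := max ((σ n)⁻¹ * opNorm ((U n)ᵀ * E n ω * U n))
    (n * σ n * lclt β δ g (kt n) n * (S n)⁻¹) * twoInfNorm (U n) with hZdef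
  have hstd := norm_standardize_sub_le hSpos.le hσ.le hc0 hcn
    (W n ω *ᵥ rowVec (Uhat n ω) i - rowVec (U n) i)
    (rowVec (E n ω * U n * (Matrix.diagonal (lam n))⁻¹) i)
  rw [rowVec_sub_sub_eq _ _ _ _ hin] at hstd
  have herr := standardized_error_le (n := n) (g := g) (e := opNorm ((U n)ᵀ * E n ω * U n))
    (κ := (n : ℝ) ^ (β / 2)) (L := C * Real.log n ^ δ) (C := C) (ℓ := Real.log n ^ (2 * δ))
    (ℓ' := lclt β δ g (kt n) n) hSpos hσ hc₂n.1 (abs_nonneg c₁) hEle (twoInfNorm_nonneg (U n))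
    (by positivity) (by
      rw [mul_pow, mul_comm 2 δ, ← Real.rpow_mul_natCast (by linarith)]
      push_cast
      rfl)
    (log_rpow_le_lclt (by linarith) (by omega) hlogn) (by omega)
  rw [← hZdef] at herr
  rw [← hSn] at hexp
  have hfac : 0 ≤ (√c)⁻¹ * (S n * (σ n)⁻¹) := by positivity
  have hfin : η ≤ c₃ * ((1 + |c₁| ^ 2 * C ^ 2) * Z +
      |c₁| * (√n * (n : ℝ) ^ (β / 2) * (En n / S n) ^ (g - 1))) := by
    refine hω.trans (hstd.trans ?_)
    rw [← mul_assoc]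
    refine (mul_le_mul_of_nonneg_left hexp hfac).trans ?_
    refine le_trans (le_of_eq ?_) (mul_le_mul_of_nonneg_left herr hc₃0)
    rw [hc₃, ← opNorm_eq_norm]
    ring
  have hZle : c₃ * (1 + |c₁| ^ 2 * C ^ 2) * Z ≤ η / 2 := by
    calc c₃ * (1 + |c₁| ^ 2 * C ^ 2) * Z ≤ c₄ * |Z| := by
          have h1 : 0 ≤ c₃ * (1 + |c₁| ^ 2 * C ^ 2) := by positivity
          exact (mul_le_mul_of_nonneg_left (le_abs_self Z) h1).trans
            (mul_le_mul_of_nonneg_right (by rw [hc₄]; linarith) (abs_nonneg Z))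
      _ ≤ c₄ * (η / (2 * c₄)) := by gcongr
      _ = η / 2 := by field_simp
  linarith
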